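/- Let $l\ge 3$, $\eta=\mathrm{diag}(1,1,-1,\dots,-1)$ on $\mathbb R^{2,l-1}$, $e_0=(1,0,\dots,0)$, $G=SO(2,l-1)$, $H=SO(1,l-1)=\{g\in G: ge_0=e_0\}$ and $\mathcal G=\mathfrak{so}(2,l-1)$. Let $\sigma$ be conjugation by $\mathrm{diag}(1,-1,\dots,-1)$ (on $G$ and on $\mathcal G$). Let $AdS_l=G/H$, identified through $[g]\mapsto g e_0$ with the hyperboloid $u^2+t^2-x_1^2-\dots-x_{l-1}^2=1$, with the induced Lorentzian metric $\eta$ (a negative multiple of the metric given by the Killing form; time-like vectors have positive norm) and with the time orientation for which a light-like tangent vector $v$ at $x$ is future directed when $\eta(v,q_0x)>0$, where $q_0=E_{12}-E_{21}$. A future light ray is a geodesic $c:\mathbb R\to AdS_l$ whose velocity is everywhere light-like and future directed. For a set $\mathscr S\subset AdS_l$ let $BH$ be the set of the points $x$ such that every future light ray $c$ with $c(0)=x$ satisfies $c(s)\in\mathscr S$ for some $s\ge 0$; the event horizon is the boundary of $BH$. Let $\theta$ be a Cartan involution of $\mathcal G$ commuting with $\sigma$, $\mathcal P$ its $(-1)$-eigenspace,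 $\mathcal A$ a $\sigma$-stable maximal abelian subalgebra of $\mathcal P$, and fix a notion of positivity on $\mathcal A^*$. Let $\mathcal N$ be the sum of the root spaces of the positive restricted roots, and let $R=AN$ and $\overline R=A\overline N$ be the analytic subgroups of $G$ with Lie algebras $\mathcal A\oplus\mathcal N$ and $\mathcal A\oplus\theta(\mathcal N)$. Let $\mathscr S$ be the union of the closed orbits of $R$ and of the closed orbits of $\overline R$ in $AdS_l$. Theorem. $AdS_l$ with the singularity $\mathscr S$ is a causal solvable symmetric black hole, that is: (1) $AdS_l$ is a causal symmetric space: $\sigma$ is an involutive automorphism of $G$ that fixes $H$ pointwise, and $H$ contains all fixed points of $\sigma$ near the identity; the tangent space at $[g]$ is $\{gXe_0: X\in\mathcal G,\ \sigma X=-X\}$; there is $\kappa>0$ such that $\kappa\,\eta(gXe_0,gYe_0)=-B(X,Y)$ for the Killing form $B$ of $\mathcal G$, all $g\in G$ and all $X,Y\in\mathcal G$ with $\sigma X=-X$, $\sigma Y=-Y$; this metric is Lorentzian with $x\mapsto q_0x$ a time-like tangent vector field; and the identity component of $G$ maps future directed light-like vectors to future directed light-like vectors. (2) The event horizon is non-empty,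 and $\mathscr S\subsetneq BH\subsetneq AdS_l$. (3) There are only finitely many closed orbits of $R$ and $\overline R$. More precisely, each of $R$ and $\overline R$ has exactly four orbits in $AdS_l$, of which two are open (and not closed) and the other two are closed (and not open). -/

import Mathlib

open Matrix Topology
open scoped ContDiff

attribute [local instance] LieRing.ofAssociativeRing

namespace AntiDeSitter

/-! ### The groups `SO(2, l-1)`, `SO(1, l-1)` and the Lie algebra `so(2, l-1)` -/

/-- Coordinates of `ℝ^{2, l-1}`: `inl 0, inl 1` are `u, t` and `inr i` are the `l - 1` others. -/
abbrev Idx (l : ℕ) : Type := Fin 2 ⊕ Fin (l - 1)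

/-- The ambient space `ℝ^{2, l-1}`. -/
abbrev Ambient (l : ℕ) : Type := Idx l → ℝ

/-- `η = diag(1, 1, -1, …, -1)`. -/
noncomputable abbrev eta (l : ℕ) : Matrix (Idx l) (Idx l) ℝ :=
  LieAlgebra.Orthogonal.indefiniteDiagonal (Fin 2) (Fin (l - 1)) ℝ

/-- The bilinear form `u u' + t t' - ∑ xᵢ xᵢ'` of `ℝ^{2, l-1}`. -/
noncomputable def form (l : ℕ) (v w : Ambient l) : ℝ := v ⬝ᵥ (eta l *ᵥ w)

/-- The base vector `(1, 0, …, 0)`. -/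
def e0 (l : ℕ) : Ambient l := Pi.single (Sum.inl 0) 1

/-- The group `SO(2, l-1)`, with the topology of matrices. -/
def SO2 (l : ℕ) : Subgroup (GL (Idx l) ℝ) where
  carrier := {g | (g : Matrix (Idx l) (Idx l) ℝ)ᵀ * eta l * g = eta l ∧
    (g : Matrix (Idx l) (Idx l) ℝ).det = 1}
  one_mem' := by simp
  mul_mem' := by
    rintro a b ⟨ha, ha'⟩ ⟨hb, hb'⟩
    refine ⟨?_, by simp [ha', hb']⟩
    calc ((a * b : GL (Idx l) ℝ) : Matrix (Idx l) (Idx l) ℝ)ᵀ * eta l * (a * b : GL (Idx l) ℝ)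
        = (b : Matrix (Idx l) (Idx l) ℝ)ᵀ *
            ((a : Matrix (Idx l) (Idx l) ℝ)ᵀ * eta l * a) * b := by
          simp only [Units.val_mul, transpose_mul, Matrix.mul_assoc]
      _ = eta l := by rw [ha, hb]
  inv_mem' := by
    rintro a ⟨ha, ha'⟩
    have h1 : (a : Matrix (Idx l) (Idx l) ℝ) * (a⁻¹ : GL (Idx l) ℝ) = 1 := a.mul_inv
    have h2 : ((a⁻¹ : GL (Idx l) ℝ) : Matrix (Idx l) (Idx l) ℝ)ᵀ *
        (a : Matrix (Idx l) (Idx l) ℝ)ᵀ = 1 := by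
      rw [← transpose_mul, h1, transpose_one]
    refine ⟨?_, ?_⟩
    · calc ((a⁻¹ : GL (Idx l) ℝ) : Matrix (Idx l) (Idx l) ℝ)ᵀ * eta l * (a⁻¹ : GL (Idx l) ℝ)
          = ((a⁻¹ : GL (Idx l) ℝ) : Matrix (Idx l) (Idx l) ℝ)ᵀ *
              ((a : Matrix (Idx l) (Idx l) ℝ)ᵀ * eta l * a) * (a⁻¹ : GL (Idx l) ℝ) := by
            rw [ha]
        _ = (((a⁻¹ : GL (Idx l) ℝ) : Matrix (Idx l) (Idx l) ℝ)ᵀ *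
              (a : Matrix (Idx l) (Idx l) ℝ)ᵀ) * eta l *
              ((a : Matrix (Idx l) (Idx l) ℝ) * (a⁻¹ : GL (Idx l) ℝ)) := by
            simp only [Matrix.mul_assoc]
        _ = eta l := by rw [h1, h2, Matrix.one_mul, Matrix.mul_one]
    · have := congrArg Matrix.det h1
      rw [det_mul, ha', det_one, one_mul] at this
      exact this

/-- The matrix of an element of `SO(2, l-1)`. -/
def toMat {l : ℕ} (g : SO2 l) : Matrix (Idx l) (Idx l) ℝ := ((g : GL (Idx l) ℝ) : Matrix _ _ ℝ)

theorem toMat_mul {l : ℕ} (g h : SO2 l) : toMat (g * h) = toMat g * toMat h := rfl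

theorem toMat_one {l : ℕ} : toMat (1 : SO2 l) = 1 := rfl

/-- The copy of `SO(1, l-1)` in `SO(2, l-1)`: the stabiliser of `(1, 0, …, 0)`. -/
def SO1 (l : ℕ) : Subgroup (SO2 l) where
  carrier := {h | toMat h *ᵥ e0 l = e0 l}
  one_mem' := by simp [toMat_one]
  mul_mem' := by
    intro a b ha hb
    simp only [Set.mem_ofPred_eq] at ha hb ⊢
    rw [toMat_mul, ← mulVec_mulVec, hb, ha]
  inv_mem' := by
    intro a ha
    simp only [Set.mem_ofPred_eq] at ha ⊢
    conv_lhs => rw [← ha]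
    rw [mulVec_mulVec, ← toMat_mul, inv_mul_cancel, toMat_one, one_mulVec]

/-- `AdS_l = SO(2, l-1) / SO(1, l-1)`, with the quotient topology and the left action of
`SO(2, l-1)`. -/
abbrev AdS (l : ℕ) : Type := SO2 l ⧸ SO1 l

/-- The identification `[g] ↦ g · (1, 0, …, 0)` of `AdS_l` with the hyperboloid
`u² + t² - x₁² - ⋯ - x_{l-1}² = 1`. -/
def emb {l : ℕ} : AdS l → Ambient l :=
  Quotient.lift (fun g : SO2 l => toMat g *ᵥ e0 l) (by
    intro a b hab
    have h : toMat (a⁻¹ * b) *ᵥ e0 l = e0 l := QuotientGroup.leftRel_apply.mp hab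
    change toMat a *ᵥ e0 l = toMat b *ᵥ e0 l
    conv_lhs => rw [← h]
    rw [mulVec_mulVec, ← toMat_mul, mul_inv_cancel_left])

/-- The Lie algebra `so(2, l-1)` of the matrices `X` with `Xᵀ η + η X = 0`. -/
abbrev so2 (l : ℕ) : LieSubalgebra ℝ (Matrix (Idx l) (Idx l) ℝ) :=
  LieAlgebra.Orthogonal.so' (Fin 2) (Fin (l - 1)) ℝ

theorem mem_so2 {l : ℕ} {X : Matrix (Idx l) (Idx l) ℝ} :
    X ∈ so2 l ↔ Xᵀ * eta l = eta l * (-X) := by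
  rw [so2, LieAlgebra.Orthogonal.so', mem_skewAdjointMatricesLieSubalgebra,
    mem_skewAdjointMatricesSubmodule]
  rfl

/-! ### The symmetric space structure -/

/-- The reflection `diag(1, -1, …, -1)`. -/
def refl0 (l : ℕ) : Matrix (Idx l) (Idx l) ℝ :=
  Matrix.diagonal fun i => if i = Sum.inl 0 then 1 else -1

theorem refl0_mul_self (l : ℕ) : refl0 l * refl0 l = 1 := by
  rw [refl0, diagonal_mul_diagonal, ← diagonal_one]
  congr 1
  funext i
  split_ifs <;> norm_num

theorem refl0_transpose (l : ℕ) : (refl0 l)ᵀ = refl0 l := by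
  simp [refl0]

theorem refl0_mul_eta (l : ℕ) : refl0 l * eta l = eta l * refl0 l := by
  simp only [refl0, eta, LieAlgebra.Orthogonal.indefiniteDiagonal, diagonal_mul_diagonal, mul_comm]

/-- `refl0` as an invertible matrix. -/
def refl0Unit (l : ℕ) : GL (Idx l) ℝ :=
  ⟨refl0 l, refl0 l, refl0_mul_self l, refl0_mul_self l⟩

/-- The involutive automorphism `σ` of `SO(2, l-1)`: conjugation by `diag(1, -1, …, -1)`. -/
def sigmaGroup (l : ℕ) : SO2 l →* SO2 l where
  toFun g := ⟨refl0Unit l * g * (refl0Unit l)⁻¹, by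
    obtain ⟨⟨g, g', h1, h2⟩, hg, hd⟩ := g
    change g.det = 1 at hd
    change gᵀ * eta l * g = eta l at hg
    constructor
    · change (refl0 l * g * refl0 l)ᵀ * eta l * (refl0 l * g * refl0 l) = eta l
      rw [transpose_mul, transpose_mul, refl0_transpose]
      calc refl0 l * (gᵀ * refl0 l) * eta l * (refl0 l * g * refl0 l)
          = refl0 l * gᵀ * (refl0 l * eta l) * refl0 l * g * refl0 l := by
            simp only [Matrix.mul_assoc]
        _ = refl0 l * gᵀ * eta l * (refl0 l * refl0 l) * g * refl0 l := by
            rw [refl0_mul_eta]; simp only [Matrix.mul_assoc]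
        _ = refl0 l * (gᵀ * eta l * g) * refl0 l := by
            rw [refl0_mul_self, Matrix.mul_one]; simp only [Matrix.mul_assoc]
        _ = eta l := by
            rw [hg, refl0_mul_eta, Matrix.mul_assoc, refl0_mul_self, Matrix.mul_one]
    · change (refl0 l * g * refl0 l).det = 1
      have h := congrArg Matrix.det (refl0_mul_self l)
      rw [det_mul, det_one] at h
      rw [det_mul, det_mul, hd, mul_one, h]⟩
  map_one' := by
    apply Subtype.ext
    simp
  map_mul' := by
    intro a b
    apply Subtype.ext
    simp [mul_assoc]

/-- The differential of `σ` at the identity, an involution of `so(2, l-1)`. -/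
def sigma (l : ℕ) : so2 l →ₗ[ℝ] so2 l where
  toFun X := ⟨refl0 l * X.1 * refl0 l, by
    have hX : X.1ᵀ * eta l = eta l * (-X.1) := mem_so2.mp X.2
    refine mem_so2.mpr ?_
    rw [transpose_mul, transpose_mul, refl0_transpose]
    calc refl0 l * (X.1ᵀ * refl0 l) * eta l
        = refl0 l * (X.1ᵀ * (refl0 l * eta l)) := by simp only [Matrix.mul_assoc]
      _ = refl0 l * (X.1ᵀ * eta l) * refl0 l := by
          rw [refl0_mul_eta]; simp only [Matrix.mul_assoc]
      _ = (refl0 l * eta l) * (-X.1) * refl0 l := by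
          rw [hX]; simp only [Matrix.mul_assoc]
      _ = eta l * (-(refl0 l * X.1 * refl0 l)) := by
          rw [refl0_mul_eta]
          simp only [Matrix.mul_assoc, Matrix.neg_mul, Matrix.mul_neg]⟩
  map_add' X Y := by
    apply Subtype.ext
    simp [Matrix.mul_add, Matrix.add_mul]
  map_smul' c X := by
    apply Subtype.ext
    simp

/-! ### Causal structure

`AdS_l` carries the Lorentzian metric that the form of `ℝ^{2, l-1}` induces on the hyperboloid.
Up to a positive factor this is minus the homogeneous metric given by the Killing form; that this
is so is one of the clauses of `IsCausalSymmetricSpace`. Time-like vectors have positive norm. -/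

/-- The tangent space at `x`, as a subspace of the ambient space. -/
noncomputable def tangent {l : ℕ} (x : AdS l) : Set (Ambient l) := {v | form l v (emb x) = 0}

/-- The generator `q₀ = E₁₂ - E₂₁` of the rotations of the `(u, t)`-plane. -/
def q0 (l : ℕ) : Matrix (Idx l) (Idx l) ℝ :=
  Matrix.single (Sum.inl 0) (Sum.inl 1) 1 - Matrix.single (Sum.inl 1) (Sum.inl 0) 1

/-- The time-like vector field on `AdS_l` generated by `q₀`, which defines the time orientation. -/
def timeField {l : ℕ} (x : AdS l) : Ambient l := q0 l *ᵥ emb x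

/-- Future directed light-like tangent vectors. -/
def IsFutureLightlike {l : ℕ} (x : AdS l) (v : Ambient l) : Prop :=
  v ∈ tangent x ∧ form l v v = 0 ∧ 0 < form l v (timeField x)

/-- (Complete, affinely parametrised) geodesics: smooth curves whose acceleration in `ℝ^{2, l-1}`
is everywhere normal to the hyperboloid, so that their covariant acceleration for the Levi-Civita
connection of the hyperboloid vanishes. -/
def IsGeodesic {l : ℕ} (c : ℝ → AdS l) : Prop :=
  ContDiff ℝ ∞ (fun s => emb (c s)) ∧
    ∀ s, ∀ v ∈ tangent (c s), form l (deriv (deriv fun r => emb (c r)) s) v = 0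

/-- Future directed light rays: geodesics whose velocity is everywhere light-like and future
directed. -/
def IsFutureLightRay {l : ℕ} (c : ℝ → AdS l) : Prop :=
  IsGeodesic c ∧ ∀ s, IsFutureLightlike (c s) (deriv (fun r => emb (c r)) s)

/-- `AdS_l` is a causal symmetric space: a symmetric space for the involution `σ`, with an invariant
Lorentzian metric given by the Killing form, and with a time orientation that is invariant under the
identity component of `SO(2, l-1)`. -/
structure IsCausalSymmetricSpace (l : ℕ) : Prop where
  sigma_involutive : ∀ g, sigmaGroup l (sigmaGroup l g) = g
  /-- `SO(1, l-1)` is an open subgroup of the group of the fixed points of `σ`. -/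
  sigma_fixes : ∀ h ∈ SO1 l, sigmaGroup l h = h
  fixed_near_one : ∃ U ∈ 𝓝 (1 : SO2 l), ∀ g ∈ U, sigmaGroup l g = g → g ∈ SO1 l
  /-- The metric on `T_{[g]} AdS_l = {g X (1, 0, …, 0) | X ∈ so(2, l-1), σ X = -X}` is a negative
  multiple of the translated Killing form. -/
  tangent_eq : ∀ g : SO2 l, tangent (g : AdS l) =
    {v | ∃ X : so2 l, sigma l X = -X ∧ v = toMat g *ᵥ (X.1 *ᵥ e0 l)}
  metric_eq : ∃ κ : ℝ, 0 < κ ∧ ∀ (g : SO2 l) (X Y : so2 l), sigma l X = -X → sigma l Y = -Y →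
    κ * form l (toMat g *ᵥ (X.1 *ᵥ e0 l)) (toMat g *ᵥ (Y.1 *ᵥ e0 l)) = -killingForm ℝ (so2 l) X Y
  /-- The metric is Lorentzian, with `timeField` time-like. -/
  timeField_tangent : ∀ x : AdS l, timeField x ∈ tangent x
  timeField_timelike : ∀ x : AdS l, 0 < form l (timeField x) (timeField x)
  lorentzian : ∀ x : AdS l, ∀ v ∈ tangent x, form l v (timeField x) = 0 → v ≠ 0 → form l v v < 0
  future_invariant : ∀ g ∈ Subgroup.connectedComponentOfOne (SO2 l), ∀ (x : AdS l) (v : Ambient l),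
    IsFutureLightlike x v → IsFutureLightlike (g • x) (toMat g *ᵥ v)

/-! ### Black holes -/

/-- The interior region of a singularity `S`: the points all of whose future light rays reach `S`
within a finite time. -/
def blackHole {l : ℕ} (S : Set (AdS l)) : Set (AdS l) :=
  {x | ∀ c : ℝ → AdS l, IsFutureLightRay c → c 0 = x → ∃ s : ℝ, 0 ≤ s ∧ c s ∈ S}

/-- The event horizon: the boundary of the interior region. -/
def horizon {l : ℕ} (S : Set (AdS l)) : Set (AdS l) := frontier (blackHole S)

/-! ### Iwasawa groups -/

/-- Cartan involutions of `so(2, l-1)`. -/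
structure IsCartanInvolution {l : ℕ} (θ : so2 l ≃ₗ⁅ℝ⁆ so2 l) : Prop where
  involutive : ∀ X, θ (θ X) = X
  pos : ∀ X, X ≠ 0 → 0 < -killingForm ℝ (so2 l) X (θ X)

/-- `𝔞` is an abelian subalgebra contained in the `-1`-eigenspace `𝔭` of `θ`. -/
structure IsAbelianIn {l : ℕ} (θ : so2 l ≃ₗ⁅ℝ⁆ so2 l) (𝔞 : Submodule ℝ (so2 l)) : Prop where
  le : ∀ X ∈ 𝔞, θ X = -X
  abelian : ∀ X ∈ 𝔞, ∀ Y ∈ 𝔞, ⁅X, Y⁆ = 0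

/-- `𝔞` is a maximal abelian subalgebra of `𝔭`. -/
def IsMaximalAbelianIn {l : ℕ} (θ : so2 l ≃ₗ⁅ℝ⁆ so2 l) (𝔞 : Submodule ℝ (so2 l)) : Prop :=
  Maximal (IsAbelianIn θ) 𝔞

/-- A notion of positivity on a real vector space. -/
structure IsPositivity {V : Type*} [AddCommGroup V] [Module ℝ V] (P : Set V) : Prop where
  xor_neg : ∀ v, v ≠ 0 → Xor (v ∈ P) (-v ∈ P)
  add : ∀ v ∈ P, ∀ w ∈ P, v + w ∈ P
  smul : ∀ r : ℝ, 0 < r → ∀ v ∈ P, r • v ∈ P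

/-- The space `𝔤_λ = {X | [H, X] = λ(H) X for all H ∈ 𝔞}`. -/
def rootSpace {l : ℕ} (𝔞 : Submodule ℝ (so2 l)) (lam : Module.Dual ℝ 𝔞) :
    Submodule ℝ (so2 l) where
  carrier := {X | ∀ H : 𝔞, ⁅(H : so2 l), X⁆ = lam H • X}
  add_mem' := by
    intro X Y hX hY H
    rw [lie_add, hX H, hY H, smul_add]
  zero_mem' := by
    intro H
    rw [lie_zero, smul_zero]
  smul_mem' := by
    intro r X hX H
    rw [lie_smul, hX H, smul_comm]

/-- The sum `𝔫` of the root spaces of the positive restricted roots. -/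
def nilpotentPart {l : ℕ} (𝔞 : Submodule ℝ (so2 l)) (P : Set (Module.Dual ℝ 𝔞)) :
    Submodule ℝ (so2 l) :=
  ⨆ lam ∈ {lam : Module.Dual ℝ 𝔞 | lam ≠ 0 ∧ rootSpace 𝔞 lam ≠ ⊥ ∧ lam ∈ P}, rootSpace 𝔞 lam

/-- The analytic subgroup of `SO(2, l-1)` with Lie algebra `𝔯`: the subgroup generated by the
exponentials of the elements of `𝔯`. -/
def analyticSubgroup {l : ℕ} (𝔯 : Submodule ℝ (so2 l)) : Subgroup (SO2 l) :=
  Subgroup.closure {g | ∃ X ∈ 𝔯, toMat g = NormedSpace.exp X.1}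

/-- The Iwasawa group `R = AN`. -/
def iwasawaGroup {l : ℕ} (𝔞 : Submodule ℝ (so2 l)) (P : Set (Module.Dual ℝ 𝔞)) :
    Subgroup (SO2 l) :=
  analyticSubgroup (𝔞 ⊔ nilpotentPart 𝔞 P)

/-- The Cartan conjugate `A N̄` of `AN`, with Lie algebra `𝔞 ⊕ θ(𝔫)`. -/
def iwasawaGroupBar {l : ℕ} (θ : so2 l ≃ₗ⁅ℝ⁆ so2 l) (𝔞 : Submodule ℝ (so2 l))
    (P : Set (Module.Dual ℝ 𝔞)) : Subgroup (SO2 l) :=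
  analyticSubgroup (𝔞 ⊔ (nilpotentPart 𝔞 P).map (θ : so2 l →ₗ[ℝ] so2 l))

/-! ### Orbits and the singularity -/

/-- The set of the orbits of a subgroup `R` in `AdS_l`. -/
def orbits {l : ℕ} (R : Subgroup (SO2 l)) : Set (Set (AdS l)) :=
  Set.range fun x : AdS l => MulAction.orbit R x

/-- The set of the closed orbits of `R`. -/
def closedOrbits {l : ℕ} (R : Subgroup (SO2 l)) : Set (Set (AdS l)) :=
  {O | O ∈ orbits R ∧ IsClosed O}

/-- The set of the open orbits of `R`. -/
def openOrbits {l : ℕ} (R : Subgroup (SO2 l)) : Set (Set (AdS l)) :=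
  {O | O ∈ orbits R ∧ IsOpen O}

/-- The singularity: the union of the closed orbits of `AN` and `A N̄`. -/
def singularity {l : ℕ} (θ : so2 l ≃ₗ⁅ℝ⁆ so2 l) (𝔞 : Submodule ℝ (so2 l))
    (P : Set (Module.Dual ℝ 𝔞)) : Set (AdS l) :=
  ⋃₀ closedOrbits (iwasawaGroup 𝔞 P) ∪ ⋃₀ closedOrbits (iwasawaGroupBar θ 𝔞 P)

/-- `R` has exactly four orbits, two of them open and the two others closed. -/
structure HasFourOrbits {l : ℕ} (R : Subgroup (SO2 l)) : Prop where
  card : (orbits R).ncard = 4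
  card_open : (openOrbits R).ncard = 2
  card_closed : (closedOrbits R).ncard = 2
  open_xor_closed : ∀ O ∈ orbits R, Xor (IsOpen O) (IsClosed O)

end AntiDeSitter

namespace AntiDeSitter

section

variable {l : ℕ}

/-! ### The ambient bilinear form -/

/-! Everything is read off from one null frame of the ambient space: two orthogonal pairs of null
vectors `p, p'` and `q, q'` with `⟨p,p'⟩ = ⟨q,q'⟩ = 1/2` and negative definite complement,
consisting of weight vectors of `𝔞` of weights `a, -a, b, -b` (and `0` on the complement), with `a`,
`b` and `a - b` positive.

Orbits. Positive root vectors kill `p` and send `q` into the line of `p`. Hence `AN` multiplies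
`⟨p,·⟩` by positive numbers and does the same to `⟨q,·⟩` on the wall `⟨p,·⟩ = 0` (`mem_scale`).
Boosts and null translations show that it is transitive on each set with prescribed signs
(`exists_smul_eq`, `exists_smul_eq_of_orthogonal`). As `⟨q,·⟩` has no zero on the wall
(`form_q_ne_zero`), there are two open orbits `±⟨p,·⟩ > 0`, and the wall is the union of two closed
ones. `A N̄` is the Iwasawa group of the opposite positivity, with `p', q'` in place of `p, q`. So
the singularity is `{⟨p,x⟩ = 0} ∪ {⟨p',x⟩ = 0}`.

Black hole. Light rays are affine lines `x + sk`, so hitting the singularity is a linear condition.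
From `p + p'` the ray along `q` or `-q`, whichever is future directed, keeps `⟨p,·⟩` and `⟨p',·⟩`
constant and escapes (`notMem_blackHole`). From `(p + p' + q + q')/√2`, with the sign of `q, q'`
chosen by the time orientation, each future light-like `k` satisfies `⟨p,k⟩ + ⟨p',k⟩ < 0`, so one of
two positive linear functions decreases to zero (`exists_mem_blackHole`). A curve from an escaping
point to the wall must cross the horizon.

Existence of the frame for an abstract Cartan involution. For `H` in `𝔭`, `ad H` is symmetric for
the inner product `-B(·, θ·)`. Through bivectors `v ∧ w`, on which `H` acts by the sum of
eigenvalues, this forces `H` itself to have real, semisimple eigenvalues on the ambient space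
(`im_eq_zero`, `mulVec_eq_smul`), so `𝔞` is simultaneously diagonalisable. By maximality `𝔞`
contains every boost commuting with it (`mem_of_commute`). This yields one hyperbolic pair of weight
vectors, then a second in the orthogonal complement of the first (`exists_weight_pair`,
`exists_weightFrame`). -/

theorem form_apply (v w : Ambient l) : form l v w =
    v (Sum.inl 0) * w (Sum.inl 0) + v (Sum.inl 1) * w (Sum.inl 1)
      - ∑ i, v (Sum.inr i) * w (Sum.inr i) := by
  simp [form, LieAlgebra.Orthogonal.indefiniteDiagonal, dotProduct, mulVec_diagonal,
    Fin.sum_univ_two, sub_eq_add_neg]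

theorem form_comm (v w : Ambient l) : form l v w = form l w v := by
  simp only [form_apply, mul_comm]

theorem form_add_right (u v w : Ambient l) : form l u (v + w) = form l u v + form l u w := by
  simp [form, mulVec_add, dotProduct_add]

theorem form_add_left (u v w : Ambient l) : form l (u + v) w = form l u w + form l v w := by
  simp [form, add_dotProduct]

theorem form_smul_right (r : ℝ) (v w : Ambient l) : form l v (r • w) = r * form l v w := by
  simp [form, mulVec_smul]

theorem form_smul_left (r : ℝ) (v w : Ambient l) : form l (r • v) w = r * form l v w := by
  simp [form]

theorem form_neg_right (v w : Ambient l) : form l v (-w) = -form l v w := by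
  simp [form, mulVec_neg]

theorem form_neg_left (v w : Ambient l) : form l (-v) w = -form l v w := by
  simp [form]

theorem form_sub_right (u v w : Ambient l) : form l u (v - w) = form l u v - form l u w := by
  simp [form, mulVec_sub]

theorem form_sub_left (u v w : Ambient l) : form l (u - v) w = form l u w - form l v w := by
  simp [form]

@[simp] theorem form_zero_right (v : Ambient l) : form l v 0 = 0 := by simp [form]

@[simp] theorem form_zero_left (v : Ambient l) : form l 0 v = 0 := by simp [form]

theorem continuous_form : Continuous fun z : Ambient l × Ambient l => form l z.1 z.2 := by
  simp only [form_apply]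
  fun_prop

theorem eta_transpose : (eta l)ᵀ = eta l := by
  simp [LieAlgebra.Orthogonal.indefiniteDiagonal]

theorem eta_mul_self : eta l * eta l = 1 := by
  simp only [eta, LieAlgebra.Orthogonal.indefiniteDiagonal, diagonal_mul_diagonal]
  rw [← diagonal_one]
  congr 1
  funext i
  rcases i with i | i <;> simp

theorem eq_zero_of_form_eq_zero {v : Ambient l} (h : ∀ w, form l v w = 0) : v = 0 := by
  have h1 : ∀ w, v ⬝ᵥ w = 0 := by
    intro w
    have := h (eta l *ᵥ w)
    rwa [form, mulVec_mulVec, eta_mul_self, one_mulVec] at this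
  exact dotProduct_eq_zero _ h1

theorem form_mulVec (X : Matrix (Idx l) (Idx l) ℝ) (v w : Ambient l) :
    form l (X *ᵥ v) w = v ⬝ᵥ ((Xᵀ * eta l) *ᵥ w) := by
  rw [form, ← mulVec_mulVec, dotProduct_mulVec v, vecMul_transpose]

theorem form_toMat (g : SO2 l) (v w : Ambient l) :
    form l (toMat g *ᵥ v) (toMat g *ᵥ w) = form l v w := by
  have h : (toMat g)ᵀ * eta l * toMat g = eta l := g.2.1
  rw [form_mulVec, mulVec_mulVec, h, form]

theorem form_so2 (X : so2 l) (v w : Ambient l) : form l (X.1 *ᵥ v) w = -form l v (X.1 *ᵥ w) := by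
  rw [form_mulVec, mem_so2.mp X.2, form, mul_neg, neg_mulVec, dotProduct_neg, mulVec_mulVec]

theorem form_so2_self (X : so2 l) (v : Ambient l) : form l (X.1 *ᵥ v) v = 0 := by
  have := form_so2 X v v
  rw [form_comm v] at this
  linarith

/-- A vector without component in the two positive directions has negative norm. -/
theorem form_self_neg {v : Ambient l} (h0 : v (Sum.inl 0) = 0) (h1 : v (Sum.inl 1) = 0)
    (hv : v ≠ 0) : form l v v < 0 := by
  rw [form_apply, h0, h1]
  have h : ∃ i, v (Sum.inr i) ≠ 0 := by
    by_contra! h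
    apply hv
    funext i
    rcases i with i | i
    · fin_cases i <;> assumption
    · exact h i
  obtain ⟨i, hi⟩ := h
  have : 0 < ∑ i, v (Sum.inr i) * v (Sum.inr i) :=
    Finset.sum_pos' (fun i _ => mul_self_nonneg _) ⟨i, Finset.mem_univ _, mul_self_pos.mpr hi⟩
  linarith

/-- There is no three-dimensional subspace on which the form is positive semidefinite. -/
theorem exists_form_self_neg {a b c : Ambient l} (h : LinearIndependent ℝ ![a, b, c]) :
    ∃ r : Fin 3 → ℝ, form l (∑ i, r i • ![a, b, c] i) (∑ i, r i • ![a, b, c] i) < 0 := by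
  -- `f` reads off the two positive coordinates of a combination. Three coefficients against two
  -- equations leave a non-zero kernel, whose image has only negative coordinates.
  let f : (Fin 3 → ℝ) →ₗ[ℝ] (Fin 2 → ℝ) :=
    { toFun := fun r j => (∑ i, r i • ![a, b, c] i) (Sum.inl j)
      map_add' := by
        intro r s; ext j
        simp [add_smul, Finset.sum_add_distrib]
      map_smul' := by
        intro r s; ext j
        simp [Finset.mul_sum, mul_assoc] }
  have hf : LinearMap.ker f ≠ ⊥ := LinearMap.ker_ne_bot_of_finrank_lt (by simp)
  obtain ⟨r, hr, hr0⟩ := Submodule.exists_mem_ne_zero_of_ne_bot hf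
  refine ⟨r, form_self_neg (congrFun hr 0) (congrFun hr 1) fun h0 => hr0 ?_⟩
  funext i
  exact Fintype.linearIndependent_iff.mp h r h0 i

/-! ### Bivectors -/

/-- The element `u ↦ ⟨w, u⟩ v - ⟨v, u⟩ w` of `so(2, l-1)`. -/
noncomputable def wedge (v w : Ambient l) : so2 l :=
  ⟨vecMulVec v (eta l *ᵥ w) - vecMulVec w (eta l *ᵥ v), by
    refine mem_so2.mpr ?_
    rw [transpose_sub, transpose_vecMulVec, transpose_vecMulVec, sub_mul, mul_neg, mul_sub,
      vecMulVec_mul, vecMulVec_mul, mul_vecMulVec, mul_vecMulVec, ← mulVec_transpose,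
      ← mulVec_transpose, eta_transpose]
    abel⟩

theorem wedge_mulVec (v w u : Ambient l) :
    (wedge v w).1 *ᵥ u = form l w u • v - form l v u • w := by
  have h (w : Ambient l) : (eta l *ᵥ w) ⬝ᵥ u = form l w u := by
    rw [form_comm, form, dotProduct_comm]
  simp only [wedge, sub_mulVec, vecMulVec_mulVec, h, op_smul_eq_smul]

theorem so2_ext {X Y : so2 l} (h : ∀ u, X.1 *ᵥ u = Y.1 *ᵥ u) : X = Y :=
  Subtype.ext (Matrix.ext_of_mulVec_single fun _ => h _)

theorem lie_mulVec (X Y : so2 l) (u : Ambient l) :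
    ⁅X, Y⁆.1 *ᵥ u = X.1 *ᵥ (Y.1 *ᵥ u) - Y.1 *ᵥ (X.1 *ᵥ u) := by
  rw [LieSubalgebra.coe_bracket, LieRing.of_associative_ring_bracket, sub_mulVec, mulVec_mulVec,
    mulVec_mulVec]

/-- The adjoint representation is the exterior square of the ambient one. Consequently eigenvalues
on vectors add up to eigenvalues of `ad X`, in both directions of use: spectra of elements of `𝔭`,
and roots from weights. -/
theorem lie_wedge (X : so2 l) (v w : Ambient l) :
    ⁅X, wedge v w⁆ = wedge (X.1 *ᵥ v) w + wedge v (X.1 *ᵥ w) := by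
  apply so2_ext
  intro u
  change _ = ((wedge (X.1 *ᵥ v) w).1 + (wedge v (X.1 *ᵥ w)).1) *ᵥ u
  rw [lie_mulVec, add_mulVec]
  simp only [wedge_mulVec, mulVec_sub, mulVec_smul, form_so2]
  module

theorem trace_mul_wedge (X : Matrix (Idx l) (Idx l) ℝ) (v w : Ambient l) :
    (X * (wedge v w).1).trace = form l w (X *ᵥ v) - form l v (X *ᵥ w) := by
  have h (v w : Ambient l) : (eta l *ᵥ w) ⬝ᵥ v = form l w v := by
    rw [form_comm, form, dotProduct_comm]
  simp only [wedge, mul_sub, mul_vecMulVec, trace_sub, trace_vecMulVec]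
  rw [dotProduct_comm, h, dotProduct_comm, h]

/-! ### The embedding in the ambient space -/

@[simp] theorem emb_mk (g : SO2 l) : emb (g : AdS l) = toMat g *ᵥ e0 l := rfl

theorem emb_smul (g : SO2 l) (x : AdS l) : emb (g • x) = toMat g *ᵥ emb x := by
  induction x using QuotientGroup.induction_on with
  | H h => rw [MulAction.Quotient.smul_coe, emb_mk, emb_mk, smul_eq_mul, toMat_mul, mulVec_mulVec]

theorem form_e0_e0 : form l (e0 l) (e0 l) = 1 := by
  simp [form_apply, e0]

theorem form_emb (x : AdS l) : form l (emb x) (emb x) = 1 := by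
  induction x using QuotientGroup.induction_on with
  | H g => rw [emb_mk, form_toMat, form_e0_e0]

theorem emb_injective : Function.Injective (emb : AdS l → Ambient l) := by
  intro x y
  induction x using QuotientGroup.induction_on with
  | H g =>
    induction y using QuotientGroup.induction_on with
    | H h =>
      intro hgh
      rw [emb_mk, emb_mk] at hgh
      refine QuotientGroup.eq.mpr ?_
      change toMat (g⁻¹ * h) *ᵥ e0 l = e0 l
      rw [toMat_mul, ← mulVec_mulVec, ← hgh, mulVec_mulVec, ← toMat_mul, inv_mul_cancel,
        toMat_one, one_mulVec]

theorem continuous_toMat : Continuous (toMat : SO2 l → Matrix (Idx l) (Idx l) ℝ) :=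
  Units.continuous_val.comp continuous_subtype_val

theorem continuous_emb : Continuous (emb : AdS l → Ambient l) :=
  continuous_quot_lift _ (continuous_toMat.matrix_mulVec continuous_const)

/-- A matrix preserving the form, with its inverse. -/
noncomputable def unitOfIsometry (M : Matrix (Idx l) (Idx l) ℝ) (h : Mᵀ * eta l * M = eta l) :
    GL (Idx l) ℝ :=
  ⟨M, eta l * Mᵀ * eta l, by
    rw [mul_eq_one_comm, Matrix.mul_assoc, Matrix.mul_assoc, ← Matrix.mul_assoc Mᵀ, h,
      eta_mul_self], by
    rw [Matrix.mul_assoc, Matrix.mul_assoc, ← Matrix.mul_assoc Mᵀ, h, eta_mul_self]⟩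

theorem isometry_of_form {M : Matrix (Idx l) (Idx l) ℝ}
    (h : ∀ v w, form l (M *ᵥ v) (M *ᵥ w) = form l v w) : Mᵀ * eta l * M = eta l := by
  refine Matrix.ext_of_mulVec_single fun i => ?_
  refine dotProduct_eq _ _ fun v => ?_
  have := h v (Pi.single i 1)
  rw [form_mulVec, mulVec_mulVec, form] at this
  rw [dotProduct_comm, this, dotProduct_comm]

/-- The element of `SO(2, l-1)` given by the square of an isometry. -/
noncomputable def sqIsometry (M : Matrix (Idx l) (Idx l) ℝ) (h : Mᵀ * eta l * M = eta l) : SO2 l :=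
  ⟨unitOfIsometry M h * unitOfIsometry M h, by
    have hM : (M * M)ᵀ * eta l * (M * M) = eta l := by
      calc (M * M)ᵀ * eta l * (M * M) = Mᵀ * (Mᵀ * eta l * M) * M := by
            simp only [transpose_mul, Matrix.mul_assoc]
        _ = eta l := by rw [h, h]
    refine ⟨hM, ?_⟩
    -- An isometry has determinant `±1`, so its square has determinant `1`. Applied to `exp (X/2)`,
    -- this places `exp X` in the special orthogonal group.
    have hd := congrArg Matrix.det h
    have he := congrArg Matrix.det (eta_mul_self (l := l))
    rw [det_mul, det_mul, det_transpose] at hd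
    rw [det_mul, det_one] at he
    change (M * M).det = 1
    rw [det_mul]
    linear_combination (eta l).det * hd + (1 - M.det * M.det) * he⟩

/-! ### The Killing form of `so(2, l-1)` -/

section Trace

variable {n : Type*} [Fintype n] [DecidableEq n]

theorem trace_eq_sum_single (f : Matrix n n ℝ →ₗ[ℝ] Matrix n n ℝ) :
    LinearMap.trace ℝ _ f = ∑ i, ∑ j, f (Matrix.single i j 1) i j := by
  rw [LinearMap.trace_eq_matrix_trace ℝ (Matrix.stdBasis ℝ n n), Matrix.trace,
    Fintype.sum_prod_type]
  refine Finset.sum_congr rfl fun i _ => Finset.sum_congr rfl fun j _ => ?_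
  rw [diag_apply, LinearMap.toMatrix_apply, Matrix.stdBasis_eq_single]
  rfl

/-- The map `M ↦ A M B`. -/
def sandwich (A B : Matrix n n ℝ) : Matrix n n ℝ →ₗ[ℝ] Matrix n n ℝ :=
  LinearMap.mulLeft ℝ A ∘ₗ LinearMap.mulRight ℝ B

theorem sandwich_apply (A B M : Matrix n n ℝ) : sandwich A B M = A * (M * B) := rfl

theorem mul_single_mul_apply (A B : Matrix n n ℝ) (i j k m : n) :
    (A * ((Matrix.single i j 1 : Matrix n n ℝ) * B) : Matrix n n ℝ) k m = A k i * B j m := by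
  rw [Matrix.mul_apply, Finset.sum_eq_single i]
  · simp
  · intro b _ hb
    rw [Matrix.single_mul_apply_of_ne _ _ _ _ _ hb, mul_zero]
  · simp

theorem trace_sandwich (A B : Matrix n n ℝ) :
    LinearMap.trace ℝ _ (sandwich A B) = A.trace * B.trace := by
  rw [trace_eq_sum_single, Matrix.trace, Matrix.trace, Finset.sum_mul_sum]
  simp only [sandwich_apply, mul_single_mul_apply, diag_apply]

theorem trace_sandwich_transpose (A B : Matrix n n ℝ) :
    LinearMap.trace ℝ _ (sandwich A B ∘ₗ (Matrix.transposeLinearEquiv n n ℝ ℝ).toLinearMap) =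
      (A * Bᵀ).trace := by
  rw [trace_eq_sum_single, Matrix.trace]
  refine Finset.sum_congr rfl fun i _ => ?_
  rw [diag_apply, Matrix.mul_apply]
  refine Finset.sum_congr rfl fun j _ => ?_
  change (A * ((Matrix.single i j (1 : ℝ))ᵀ * B)) i j = _
  rw [Matrix.transpose_single, mul_single_mul_apply, transpose_apply]

end Trace

theorem so2_transpose (X : so2 l) : X.1ᵀ = -(eta l * X.1 * eta l) := by
  have h := congrArg (· * eta l) (mem_so2.mp X.2)
  simp only [Matrix.mul_assoc, eta_mul_self, Matrix.mul_one] at h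
  rw [h]
  simp [Matrix.mul_assoc]

theorem trace_so2 (X : so2 l) : X.1.trace = 0 := by
  have h := Matrix.trace_transpose X.1
  rw [so2_transpose, trace_neg, trace_mul_comm, ← Matrix.mul_assoc, eta_mul_self,
    Matrix.one_mul] at h
  linarith

/-- The projection of the matrices onto `so(2, l-1)`. -/
noncomputable def projSo2 (l : ℕ) : Matrix (Idx l) (Idx l) ℝ →ₗ[ℝ] so2 l where
  toFun M := ⟨(2⁻¹ : ℝ) • (M - eta l * (Mᵀ * eta l)), by
    refine mem_so2.mpr ?_
    simp only [transpose_smul, transpose_sub, transpose_mul, transpose_transpose, eta_transpose,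
      smul_mul_assoc, mul_neg, mul_smul_comm, sub_mul, mul_sub, Matrix.mul_assoc, eta_mul_self,
      Matrix.mul_one]
    rw [← Matrix.mul_assoc (eta l) (eta l), eta_mul_self, Matrix.one_mul, ← smul_neg, neg_sub]⟩
  map_add' M N := by
    apply Subtype.ext
    change (2⁻¹ : ℝ) • (M + N - eta l * ((M + N)ᵀ * eta l)) =
      (2⁻¹ : ℝ) • (M - eta l * (Mᵀ * eta l)) + (2⁻¹ : ℝ) • (N - eta l * (Nᵀ * eta l))
    simp only [transpose_add, add_mul, mul_add]
    module
  map_smul' r M := by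
    apply Subtype.ext
    change (2⁻¹ : ℝ) • (r • M - eta l * ((r • M)ᵀ * eta l)) =
      r • (2⁻¹ : ℝ) • (M - eta l * (Mᵀ * eta l))
    simp only [transpose_smul, smul_mul_assoc, mul_smul_comm]
    module

theorem projSo2_coe (X : so2 l) : projSo2 l X.1 = X := by
  apply Subtype.ext
  change (2⁻¹ : ℝ) • (X.1 - eta l * (X.1ᵀ * eta l)) = X.1
  rw [mem_so2.mp X.2, ← Matrix.mul_assoc, eta_mul_self, Matrix.one_mul]
  module

/-- `ad X ad Y` is the restriction of an operator `T` on all matrices, so its trace is that of `T`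
composed with the projection `(1 - E)/2`, `E M = η Mᵀ η`. With `n = 2 + (l - 1)` and traceless `X,
Y`, the trace of `T` is `2n tr(XY)` and that of `T E` is `4 tr(XY)`, giving the factor `n - 2`. -/
theorem killingForm_so2 (X Y : so2 l) :
    killingForm ℝ (so2 l) X Y = ((l - 1 : ℕ) : ℝ) * (X.1 * Y.1).trace := by
  let T : Matrix (Idx l) (Idx l) ℝ →ₗ[ℝ] Matrix (Idx l) (Idx l) ℝ :=
    sandwich (X.1 * Y.1) 1 - sandwich X.1 Y.1 - sandwich Y.1 X.1 + sandwich 1 (Y.1 * X.1)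
  let E : Matrix (Idx l) (Idx l) ℝ →ₗ[ℝ] Matrix (Idx l) (Idx l) ℝ := sandwich (eta l) (eta l) ∘ₗ
    (Matrix.transposeLinearEquiv (Idx l) (Idx l) ℝ ℝ).toLinearMap
  let ι : so2 l →ₗ[ℝ] Matrix (Idx l) (Idx l) ℝ := (so2 l).toSubmodule.subtype
  have hT (M) : T M = X.1 * Y.1 * M - X.1 * M * Y.1 - Y.1 * M * X.1 + M * Y.1 * X.1 := by
    simp [T, sandwich_apply, Matrix.mul_assoc]
  have h1 : LieAlgebra.ad ℝ (so2 l) X ∘ₗ LieAlgebra.ad ℝ (so2 l) Y = projSo2 l ∘ₗ (T ∘ₗ ι) := by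
    refine LinearMap.ext fun Z => ?_
    have : T Z.1 = (⁅X, ⁅Y, Z⁆⁆ : so2 l).1 := by
      rw [hT]
      simp only [LieSubalgebra.coe_bracket, LieRing.of_associative_ring_bracket]
      noncomm_ring
    change ⁅X, ⁅Y, Z⁆⁆ = projSo2 l (T Z.1)
    rw [this, projSo2_coe]
  have h2 : (T ∘ₗ ι) ∘ₗ projSo2 l = (2⁻¹ : ℝ) • (T - T ∘ₗ E) := by
    refine LinearMap.ext fun M => ?_
    change T ((2⁻¹ : ℝ) • (M - eta l * (Mᵀ * eta l))) = (2⁻¹ : ℝ) • (T M - T (eta l * (Mᵀ * eta l)))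
    rw [map_smul, map_sub]
  have h3 : T ∘ₗ E = (sandwich (X.1 * Y.1 * eta l) (eta l) - sandwich (X.1 * eta l) (eta l * Y.1)
      - sandwich (Y.1 * eta l) (eta l * X.1) + sandwich (eta l) (eta l * (Y.1 * X.1))) ∘ₗ
      (Matrix.transposeLinearEquiv (Idx l) (Idx l) ℝ ℝ).toLinearMap := by
    refine LinearMap.ext fun M => ?_
    change T (eta l * (Mᵀ * eta l)) = _
    rw [hT]
    simp [sandwich_apply, Matrix.mul_assoc]
  rw [killingForm_apply_apply, h1, LinearMap.trace_comp_comm', h2, h3]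
  simp only [map_smul, map_sub, map_add, T, LinearMap.add_comp, LinearMap.sub_comp, trace_sandwich,
    trace_sandwich_transpose, trace_so2, transpose_mul, eta_transpose, so2_transpose, trace_one]
  have hc : ((Fintype.card (Idx l) : ℕ) : ℝ) = 2 + ((l - 1 : ℕ) : ℝ) := by simp
  have e1 : (X.1 * Y.1 * eta l * eta l).trace = (X.1 * Y.1).trace := by
    rw [Matrix.mul_assoc, eta_mul_self, Matrix.mul_one]
  have e2 (A B : Matrix (Idx l) (Idx l) ℝ) :
      (A * eta l * (-(eta l * B * eta l) * eta l)).trace = -(A * B).trace := by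
    rw [← trace_neg]
    congr 1
    simp only [neg_mul, mul_neg, neg_inj, Matrix.mul_assoc, eta_mul_self, Matrix.mul_one]
    rw [← Matrix.mul_assoc (eta l), eta_mul_self, Matrix.one_mul]
  have e3 : (eta l * (-(eta l * X.1 * eta l) * -(eta l * Y.1 * eta l) * eta l)).trace =
      (X.1 * Y.1).trace := by
    congr 1
    simp only [neg_mul, mul_neg, neg_neg, Matrix.mul_assoc, eta_mul_self, Matrix.mul_one]
    rw [← Matrix.mul_assoc (eta l), eta_mul_self, Matrix.one_mul, ← Matrix.mul_assoc (eta l),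
      eta_mul_self, Matrix.one_mul]
  rw [e1, e2, e2, e3, hc, trace_mul_comm Y.1 X.1, smul_eq_mul]
  ring

/-! ### The Lorentzian structure -/

theorem q0_mulVec (x : Ambient l) : q0 l *ᵥ x =
    x (Sum.inl 1) • Pi.single (Sum.inl 0) 1 - x (Sum.inl 0) • Pi.single (Sum.inl 1) 1 := by
  rw [q0, sub_mulVec]
  ext i
  simp [Matrix.single_mulVec, Function.update_apply, Pi.single_apply]

theorem form_q0 (v x : Ambient l) : form l v (q0 l *ᵥ x) =
    v (Sum.inl 0) * x (Sum.inl 1) - v (Sum.inl 1) * x (Sum.inl 0) := by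
  simp [form_apply, q0_mulVec, sub_eq_add_neg]

theorem form_q0_swap (v x : Ambient l) : form l v (q0 l *ᵥ x) = -form l x (q0 l *ᵥ v) := by
  rw [form_q0, form_q0]
  ring

/-- Orthogonality to `q₀x` makes the `(u,t)`-parts of `v` and `x` parallel, and orthogonality to `x`
equates the products of these parts and of the remaining parts. Cauchy–Schwarz for the remaining
parts then concludes, since that of `x` is shorter than its `(u,t)`-part by `⟨x,x⟩ = 1`. -/
theorem form_neg_of_orthogonal {x v : Ambient l} (hx : form l x x = 1) (hvx : form l v x = 0)
    (hvt : form l v (q0 l *ᵥ x) = 0) (hv : v ≠ 0) : form l v v < 0 := by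
  rw [form_q0] at hvt
  have hcs := Finset.sum_mul_sq_le_sq_mul_sq Finset.univ (fun i => v (Sum.inr i))
    (fun i => x (Sum.inr i))
  have hS : ∑ i, x (Sum.inr i) ^ 2 =
      x (Sum.inl 0) ^ 2 + x (Sum.inl 1) ^ 2 - 1 := by
    rw [form_apply] at hx
    simp only [pow_two]
    linarith
  have hR : ∑ i, v (Sum.inr i) * x (Sum.inr i) =
      v (Sum.inl 0) * x (Sum.inl 0) + v (Sum.inl 1) * x (Sum.inl 1) := by
    rw [form_apply] at hvx
    linarith
  have hS0 : 0 ≤ ∑ i, x (Sum.inr i) ^ 2 := Finset.sum_nonneg fun i _ => sq_nonneg _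
  have hQ : form l v v = v (Sum.inl 0) ^ 2 + v (Sum.inl 1) ^ 2 - ∑ i, v (Sum.inr i) ^ 2 := by
    rw [form_apply]
    simp only [pow_two]
  have hQ0 : 0 ≤ ∑ i, v (Sum.inr i) ^ 2 := Finset.sum_nonneg fun i _ => sq_nonneg _
  rw [hR, hS] at hcs
  rw [hS] at hS0
  rw [hQ]
  rcases hQ0.lt_or_eq with h | h
  · by_contra! hneg
    nlinarith
  · rw [← h] at hcs hQ
    have h2 : v (Sum.inl 0) ^ 2 + v (Sum.inl 1) ^ 2 ≤ 0 := by nlinarith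
    refine absurd (form_self_neg (l := l) ?_ ?_ hv) ?_
    · nlinarith [sq_nonneg (v (Sum.inl 0)), sq_nonneg (v (Sum.inl 1))]
    · nlinarith [sq_nonneg (v (Sum.inl 0)), sq_nonneg (v (Sum.inl 1))]
    · rw [hQ]
      nlinarith [sq_nonneg (v (Sum.inl 0)), sq_nonneg (v (Sum.inl 1))]

/-- In a Lorentzian tangent space, a future directed light-like vector and a future directed
time-like vector have positive product. -/
theorem form_pos_of_future {x m k : Ambient l} (hx : form l x x = 1) (hmx : form l m x = 0)
    (hm : 0 < form l m m) (hmt : 0 < form l m (q0 l *ᵥ x)) (hkx : form l k x = 0)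
    (hk : form l k k = 0) (hkt : 0 < form l k (q0 l *ᵥ x)) : 0 < form l k m := by
  have hc : 0 < form l m (q0 l *ᵥ x) / form l k (q0 l *ᵥ x) := div_pos hmt hkt
  -- With this `c`, `m - c k` is orthogonal to `q₀x`, hence of non-positive norm. As `k` is null,
  -- this reads `⟨m,m⟩ ≤ 2c⟨k,m⟩`.
  obtain ⟨c, hc'⟩ : ∃ c, c = form l m (q0 l *ᵥ x) / form l k (q0 l *ᵥ x) := ⟨_, rfl⟩
  rw [← hc'] at hc
  have h1 : form l (m - c • k) (m - c • k) ≤ 0 := by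
    by_cases h0 : m - c • k = 0
    · simp [h0]
    · refine (form_neg_of_orthogonal hx ?_ ?_ h0).le
      · rw [form_sub_left, form_smul_left, hmx, hkx]
        ring
      · rw [form_sub_left, form_smul_left, hc']
        field_simp
        ring
  simp only [form_sub_left, form_sub_right, form_smul_left, form_smul_right, hk,
    form_comm m k] at h1
  by_contra! h
  nlinarith

/-! ### Transitivity on the hyperboloid -/

/-- The reflection in the hyperplane orthogonal to `u`. -/
noncomputable def reflection (u : Ambient l) : Matrix (Idx l) (Idx l) ℝ :=
  1 - vecMulVec ((2 / form l u u) • u) (eta l *ᵥ u)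

theorem reflection_mulVec (u v : Ambient l) :
    reflection u *ᵥ v = v - (2 / form l u u * form l u v) • u := by
  have h : (eta l *ᵥ u) ⬝ᵥ v = form l u v := by
    rw [form_comm, form, dotProduct_comm]
  rw [reflection, sub_mulVec, one_mulVec, vecMulVec_mulVec, h, op_smul_eq_smul, smul_smul, mul_comm]

theorem reflection_isometry {u : Ambient l} (hu : form l u u ≠ 0) :
    (reflection u)ᵀ * eta l * reflection u = eta l := by
  refine isometry_of_form fun v w => ?_
  simp only [reflection_mulVec, form_sub_left, form_sub_right, form_smul_left, form_smul_right,
    form_comm v u]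
  field_simp
  ring

theorem det_reflection {u : Ambient l} (hu : form l u u ≠ 0) : (reflection u).det = -1 := by
  have h : (eta l *ᵥ u) ⬝ᵥ u = form l u u := by
    rw [form, dotProduct_comm]
  rw [reflection, sub_eq_add_neg, ← neg_vecMulVec, vecMulVec_eq Unit,
    det_one_add_replicateCol_mul_replicateRow, dotProduct_neg, dotProduct_smul, h, smul_eq_mul]
  field_simp
  ring

theorem exists_toMat {M : Matrix (Idx l) (Idx l) ℝ} (h : Mᵀ * eta l * M = eta l)
    (hd : M.det = 1) : ∃ g : SO2 l, toMat g = M :=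
  ⟨⟨unitOfIsometry M h, h, hd⟩, rfl⟩

theorem exists_toMat_reflection {u v : Ambient l} (hu : form l u u ≠ 0) (hv : form l v v ≠ 0) :
    ∃ g : SO2 l, toMat g = reflection u * reflection v := by
  refine exists_toMat (isometry_of_form fun a b => ?_) ?_
  · have h (u : Ambient l) (hu : form l u u ≠ 0) (a b : Ambient l) :
        form l (reflection u *ᵥ a) (reflection u *ᵥ b) = form l a b := by
      rw [form_mulVec, mulVec_mulVec, reflection_isometry hu, form]
    rw [← mulVec_mulVec, ← mulVec_mulVec, h _ hu, h _ hv]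
  · rw [det_mul, det_reflection hu, det_reflection hv]
    norm_num

/-- Two reflections suffice: the one in `v + e₀` sends `e₀` to `-v`, and the one in `v` sends `-v`
to `v`. If `v + e₀` is null, the reflection in the `t`-axis fixes `e₀` and the one in `v - e₀`, of
norm `4`, sends it to `v`. -/
theorem exists_emb_eq {v : Ambient l} (hv : form l v v = 1) : ∃ x : AdS l, emb x = v := by
  by_cases hp : form l v (e0 l) = -1
  · have h1 : form l (v - e0 l) (v - e0 l) = 4 := by
      simp only [form_sub_left, form_sub_right, hv, form_e0_e0, form_comm (e0 l) v, hp]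
      norm_num
    have h2 : form l (Pi.single (Sum.inl 1) 1) (Pi.single (Sum.inl 1) (1 : ℝ)) = 1 := by
      simp [form_apply]
    have h3 : form l (Pi.single (Sum.inl 1) 1) (e0 l) = 0 := by
      simp [form_apply, e0]
    obtain ⟨g, hg⟩ := exists_toMat_reflection (u := v - e0 l) (v := Pi.single (Sum.inl 1) 1)
      (by rw [h1]; norm_num) (by rw [h2]; norm_num)
    refine ⟨(g : AdS l), ?_⟩
    rw [emb_mk, hg, ← mulVec_mulVec, reflection_mulVec (Pi.single (Sum.inl 1) 1), h3, mul_zero,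
      zero_smul, sub_zero, reflection_mulVec, h1, form_sub_left, hp, form_e0_e0]
    module
  · have h1 : form l (v + e0 l) (v + e0 l) = 2 * form l (v + e0 l) (e0 l) := by
      simp only [form_add_left, form_add_right, hv, form_e0_e0, form_comm (e0 l) v]
      ring
    have h0 : form l (v + e0 l) (e0 l) ≠ 0 := by
      rw [form_add_left, form_e0_e0]
      contrapose! hp
      linarith
    obtain ⟨g, hg⟩ := exists_toMat_reflection (u := v) (v := v + e0 l)
      (by rw [hv]; norm_num) (by rw [h1]; simpa using h0)
    refine ⟨(g : AdS l), ?_⟩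
    have h2 : 2 / form l (v + e0 l) (v + e0 l) * form l (v + e0 l) (e0 l) = 1 := by
      rw [h1]
      field_simp
    rw [emb_mk, hg, ← mulVec_mulVec, reflection_mulVec (v + e0 l), h2, reflection_mulVec, hv]
    simp only [one_smul, form_sub_right, form_add_right, hv]
    module

/-! ### The causal symmetric structure -/

theorem refl0_mulVec (v : Ambient l) :
    refl0 l *ᵥ v = (2 * form l (e0 l) v) • e0 l - v := by
  have h0 : form l (e0 l) v = v (Sum.inl 0) := by simp [form_apply, e0]
  ext i
  rw [refl0, mulVec_diagonal, h0, e0, Pi.sub_apply, Pi.smul_apply, Pi.single_apply, smul_eq_mul]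
  split_ifs with h
  · subst h
    ring
  · ring

theorem refl0_mulVec_e0 : refl0 l *ᵥ e0 l = e0 l := by
  rw [refl0_mulVec, form_e0_e0]
  module

theorem sigmaGroup_eq_iff (g : SO2 l) :
    sigmaGroup l g = g ↔ refl0 l * toMat g = toMat g * refl0 l := by
  have h : sigmaGroup l g = g ↔ refl0 l * toMat g * refl0 l = toMat g := by
    rw [Subtype.ext_iff, Units.ext_iff]
    rfl
  rw [h]
  constructor
  · intro h
    conv_rhs => rw [← h]
    rw [Matrix.mul_assoc, Matrix.mul_assoc, refl0_mul_self, Matrix.mul_one]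
  · intro h
    rw [h, Matrix.mul_assoc, refl0_mul_self, Matrix.mul_one]

/-- Elements of the `-1`-eigenspace are determined by their value at `e₀`, which identifies that
eigenspace with the tangent space at the base point and makes the Killing form computable there. -/
theorem sigma_eq_neg_iff (X : so2 l) :
    sigma l X = -X ↔ X = wedge (X.1 *ᵥ e0 l) (e0 l) := by
  have h : sigma l X = -X ↔ refl0 l * X.1 * refl0 l = -X.1 := by
    rw [Subtype.ext_iff]
    rfl
  rw [h]
  constructor
  · intro h
    refine so2_ext fun u => ?_
    have hu := congrArg (· *ᵥ u) h
    simp only [← mulVec_mulVec, neg_mulVec] at hu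
    rw [refl0_mulVec, refl0_mulVec, mulVec_sub, mulVec_smul, form_sub_right, form_smul_right,
      form_comm (e0 l) (X.1 *ᵥ e0 l), form_so2_self] at hu
    rw [wedge_mulVec, form_so2, ← sub_eq_zero]
    have h2 : (2 : ℝ) • (X.1 *ᵥ u - (form l (e0 l) u • (X.1 *ᵥ e0 l)
        - -form l (e0 l) (X.1 *ᵥ u) • e0 l)) = 0 := by
      rw [← sub_eq_zero] at hu
      rw [← hu]
      module
    simpa using h2
  · intro h
    refine Matrix.ext_of_mulVec_single fun i => ?_
    rw [h]
    have h0 := form_so2_self X (e0 l)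
    rw [form_comm] at h0
    simp only [← mulVec_mulVec, neg_mulVec, refl0_mulVec, wedge_mulVec, form_e0_e0, mulVec_sub, mulVec_smul, form_so2_self, h0, form_comm (e0 l)]
    module

theorem form_q0_ne_zero {x v : Ambient l} (hx : form l x x = 1) (hvx : form l v x = 0)
    (hv : 0 ≤ form l v v) (hv0 : v ≠ 0) : form l v (q0 l *ᵥ x) ≠ 0 := fun h =>
  absurd (form_neg_of_orthogonal hx hvx h hv0) hv.not_gt

/-- The number `⟨kv, q₀kx⟩` depends continuously on `k` and never vanishes, because a non-zero null
tangent vector is not orthogonal to the time field. Its sign is therefore constant on the identity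
component. -/
theorem isFutureLightlike_smul {g : SO2 l} (hg : g ∈ Subgroup.connectedComponentOfOne (SO2 l))
    {x : AdS l} {v : Ambient l} (h : IsFutureLightlike x v) :
    IsFutureLightlike (g • x) (toMat g *ᵥ v) := by
  obtain ⟨h1, h2, h3⟩ := h
  have hne (k : SO2 l) : form l (toMat k *ᵥ v) (q0 l *ᵥ (toMat k *ᵥ emb x)) ≠ 0 := by
    refine form_q0_ne_zero ?_ ?_ ?_ ?_
    · rw [form_toMat, form_emb]
    · rw [form_toMat]; exact h1
    · rw [form_toMat, h2]
    · intro h0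
      have hv : v = 0 := by
        refine eq_zero_of_form_eq_zero fun w => ?_
        rw [← form_toMat k, h0, form_zero_left]
      rw [hv, form_zero_left] at h3
      exact lt_irrefl _ h3
  refine ⟨?_, ?_, ?_⟩
  · change form l _ _ = 0
    rw [emb_smul, form_toMat]
    exact h1
  · rw [form_toMat, h2]
  · rw [timeField, emb_smul]
    by_contra hneg
    have hc : Continuous fun k : SO2 l =>
        form l (toMat k *ᵥ v) (q0 l *ᵥ (toMat k *ᵥ emb x)) :=
      continuous_form.comp ((continuous_toMat.matrix_mulVec continuous_const).prodMk
        (continuous_const.matrix_mulVec (continuous_toMat.matrix_mulVec continuous_const)))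
    have hpc : IsPreconnected (connectedComponent (1 : SO2 l)) := isPreconnected_connectedComponent
    have himg := hpc.image _ hc.continuousOn
    have h0 := himg.ordConnected.out (Set.mem_image_of_mem _ hg)
      (Set.mem_image_of_mem _ mem_connectedComponent)
    obtain ⟨k, -, hk⟩ := h0 (show (0 : ℝ) ∈ Set.Icc _ _ from ⟨not_lt.mp hneg, by
      simp only [toMat_one, one_mulVec]
      exact h3.le⟩)
    exact hne k hk

theorem isCausalSymmetricSpace (hl : 2 ≤ l) : IsCausalSymmetricSpace l where
  sigma_involutive g := by
    apply Subtype.ext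
    apply Units.ext
    change refl0 l * (refl0 l * toMat g * refl0 l) * refl0 l = toMat g
    rw [Matrix.mul_assoc, Matrix.mul_assoc, refl0_mul_self, Matrix.mul_one, ← Matrix.mul_assoc,
      refl0_mul_self, Matrix.one_mul]
  sigma_fixes h hh := by
    rw [sigmaGroup_eq_iff]
    refine Matrix.ext_of_mulVec_single fun i => ?_
    have hh' : toMat h *ᵥ e0 l = e0 l := hh
    rw [← mulVec_mulVec, ← mulVec_mulVec, refl0_mulVec, refl0_mulVec, mulVec_sub, mulVec_smul, hh']
    conv_lhs => rw [← hh', form_toMat, hh']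
  fixed_near_one := by
    -- A fixed point of `σ` commutes with the reflection, so it sends `e₀` to `±e₀`; this
    -- neighbourhood excludes the minus sign.
    refine ⟨{g | 0 < form l (toMat g *ᵥ e0 l) (e0 l)}, ?_, ?_⟩
    · refine IsOpen.mem_nhds (isOpen_lt continuous_const (continuous_form.comp
        ((continuous_toMat.matrix_mulVec continuous_const).prodMk continuous_const))) ?_
      change 0 < form l (toMat 1 *ᵥ e0 l) (e0 l)
      rw [toMat_one, one_mulVec, form_e0_e0]
      exact one_pos
    · intro g hg hs
      have hg' : 0 < form l (toMat g *ᵥ e0 l) (e0 l) := hg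
      have h1 := congrArg (· *ᵥ e0 l) ((sigmaGroup_eq_iff g).mp hs)
      simp only [← mulVec_mulVec, refl0_mulVec_e0] at h1
      rw [refl0_mulVec, form_comm] at h1
      set c := form l (toMat g *ᵥ e0 l) (e0 l)
      have h2 : toMat g *ᵥ e0 l = c • e0 l := by
        have : (2 : ℝ) • (toMat g *ᵥ e0 l - c • e0 l) = 0 := by
          rw [← sub_eq_zero] at h1
          rw [← neg_eq_zero, ← h1]
          module
        rw [← sub_eq_zero]
        simpa using this
      have h3 : c * c = 1 := by
        have := form_toMat g (e0 l) (e0 l)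
        rw [h2, form_smul_left, form_smul_right, form_e0_e0, mul_one] at this
        exact this
      have h4 : c = 1 := by nlinarith
      change toMat g *ᵥ e0 l = e0 l
      rw [h2, h4, one_smul]
  tangent_eq g := by
    ext v
    change form l v (toMat g *ᵥ e0 l) = 0 ↔ _
    constructor
    · intro hv
      set w := toMat g⁻¹ *ᵥ v with hw
      have hgw : v = toMat g *ᵥ w := by
        rw [hw, mulVec_mulVec, ← toMat_mul, mul_inv_cancel, toMat_one, one_mulVec]
      rw [hgw, form_toMat] at hv
      have h1 : (wedge w (e0 l)).1 *ᵥ e0 l = w := by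
        rw [wedge_mulVec, form_e0_e0, hv]
        module
      exact ⟨wedge w (e0 l), by rw [sigma_eq_neg_iff, h1], by rw [h1, ← hgw]⟩
    · rintro ⟨X, -, rfl⟩
      rw [form_toMat, form_so2_self]
  metric_eq := by
    -- The factor `l - 1` comes from the Killing form, the `2` from `tr(XY) = -2⟨Xe₀, Ye₀⟩` on the
    -- `-1`-eigenspace.
    refine ⟨2 * ((l - 1 : ℕ) : ℝ), ?_, ?_⟩
    · have : 0 < l - 1 := by omega
      positivity
    · intro g X Y hX hY
      rw [killingForm_so2, form_toMat]
      conv_rhs => rw [(sigma_eq_neg_iff X).mp hX, Matrix.trace_mul_comm, trace_mul_wedge]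
      rw [form_comm (e0 l), form_so2 Y]
      ring
  timeField_tangent x := by
    change form l (q0 l *ᵥ emb x) (emb x) = 0
    rw [form_comm, form_q0]
    ring
  timeField_timelike x := by
    have h := form_emb x
    have hS : 0 ≤ ∑ i, emb x (Sum.inr i) * emb x (Sum.inr i) :=
      Finset.sum_nonneg fun i _ => mul_self_nonneg _
    rw [form_apply] at h
    rw [timeField, form_q0]
    simp [q0_mulVec]
    nlinarith
  lorentzian x v hv hvt hv0 := form_neg_of_orthogonal (form_emb x) hv hvt hv0
  future_invariant g hg x v h := isFutureLightlike_smul hg h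

/-! ### Exponentials -/

theorem hasSum_exp_mulVec (X : Matrix (Idx l) (Idx l) ℝ) (v : Ambient l) :
    HasSum (fun n : ℕ => ((n.factorial : ℝ)⁻¹) • (X ^ n *ᵥ v)) (NormedSpace.exp X *ᵥ v) := by
  open scoped Norms.Operator in
  have h := NormedSpace.exp_series_hasSum_exp' (𝕂 := ℝ) X
  have h2 := h.mapL (LinearMap.toContinuousLinearMap
    ((Matrix.mulVecBilin ℝ ℝ).flip v : Matrix (Idx l) (Idx l) ℝ →ₗ[ℝ] Ambient l))
  convert! h2 using 2 with n
  simp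

/-- Only the iterates of the single vector `v` are constrained, so the statement also covers
`⟨q,·⟩`, which scales on the wall but not on the whole space. -/
theorem map_exp_mulVec {X : Matrix (Idx l) (Idx l) ℝ} {v : Ambient l} (φ : Ambient l →ₗ[ℝ] ℝ) {c : ℝ}
    (h : ∀ n, φ (X ^ n *ᵥ v) = c ^ n * φ v) :
    φ (NormedSpace.exp X *ᵥ v) = Real.exp c * φ v := by
  have h1 := (hasSum_exp_mulVec X v).mapL (LinearMap.toContinuousLinearMap φ)
  have h2 := (NormedSpace.exp_series_hasSum_exp' (𝕂 := ℝ) c).mul_right (φ v)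
  rw [← Real.exp_eq_exp_ℝ] at h2
  refine h1.unique ?_
  convert! h2 using 2 with n
  simp [h, mul_assoc]

theorem exp_mulVec_of_cube_eq_zero {X : Matrix (Idx l) (Idx l) ℝ} {v : Ambient l}
    (h : X *ᵥ (X *ᵥ (X *ᵥ v)) = 0) :
    NormedSpace.exp X *ᵥ v = v + X *ᵥ v + (2⁻¹ : ℝ) • (X *ᵥ (X *ᵥ v)) := by
  have h1 := hasSum_exp_mulVec X v
  have h2 := hasSum_sum_of_ne_finset_zero (L := SummationFilter.unconditional ℕ)
    (f := fun n : ℕ => ((n.factorial : ℝ)⁻¹) • (X ^ n *ᵥ v)) (s := Finset.range 3) (by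
      intro n hn
      obtain ⟨m, rfl⟩ : ∃ m, n = m + 3 := ⟨n - 3, by simp at hn; omega⟩
      have : X ^ 3 *ᵥ v = 0 := by
        rw [pow_succ, pow_succ, pow_one, ← mulVec_mulVec, ← mulVec_mulVec, h]
      simp only [pow_add, ← mulVec_mulVec, this, mulVec_zero, smul_zero])
  rw [h1.unique h2]
  simp [Finset.sum_range_succ, pow_two, ← mulVec_mulVec]

theorem exp_isometry (X : so2 l) :
    (NormedSpace.exp X.1)ᵀ * eta l * NormedSpace.exp X.1 = eta l := by
  have hu : IsUnit (eta l) := ⟨⟨eta l, eta l, eta_mul_self, eta_mul_self⟩, rfl⟩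
  have hinv : (eta l)⁻¹ = eta l := Matrix.inv_eq_left_inv eta_mul_self
  have h1 : X.1ᵀ = eta l * (-X.1) * (eta l)⁻¹ := by
    rw [so2_transpose, hinv]
    simp
  have h2 : NormedSpace.exp (-X.1) * NormedSpace.exp X.1 = 1 := by
    rw [← Matrix.exp_add_of_commute _ _ (Commute.refl X.1).neg_left, neg_add_cancel,
      NormedSpace.exp_zero]
  rw [← Matrix.exp_transpose, h1, Matrix.exp_conj _ _ hu, hinv,
    Matrix.mul_assoc (eta l * _), eta_mul_self, Matrix.mul_one, Matrix.mul_assoc, h2, Matrix.mul_one]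

/-- The exponential of an element of `so(2, l-1)` as an element of `SO(2, l-1)`. -/
noncomputable def expSO (X : so2 l) : SO2 l :=
  sqIsometry (NormedSpace.exp ((2⁻¹ : ℝ) • X : so2 l).1) (exp_isometry _)

theorem toMat_expSO (X : so2 l) : toMat (expSO X) = NormedSpace.exp X.1 := by
  change NormedSpace.exp ((2⁻¹ : ℝ) • X.1) * NormedSpace.exp ((2⁻¹ : ℝ) • X.1) = _
  rw [← Matrix.exp_add_of_commute _ _ (Commute.refl _)]
  congr 1
  module

theorem expSO_mem {𝔯 : Submodule ℝ (so2 l)} {X : so2 l} (h : X ∈ 𝔯) :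
    expSO X ∈ analyticSubgroup 𝔯 :=
  Subgroup.subset_closure ⟨X, h, toMat_expSO X⟩

theorem toMat_inv (g : SO2 l) : toMat g⁻¹ = eta l * (toMat g)ᵀ * eta l := by
  have h : (toMat g)ᵀ * eta l * toMat g = eta l := g.2.1
  have h1 : toMat g * toMat g⁻¹ = 1 := by rw [← toMat_mul, mul_inv_cancel, toMat_one]
  calc toMat g⁻¹ = eta l * ((toMat g)ᵀ * eta l * toMat g) * toMat g⁻¹ := by
        rw [h, eta_mul_self, Matrix.one_mul]
    _ = eta l * (toMat g)ᵀ * eta l * (toMat g * toMat g⁻¹) := by simp only [Matrix.mul_assoc]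
    _ = _ := by rw [h1, Matrix.mul_one]

theorem continuous_of_toMat {α : Type*} [TopologicalSpace α] {f : α → SO2 l}
    (h : Continuous fun a => toMat (f a)) : Continuous f := by
  refine Continuous.subtype_mk (Units.continuous_iff.mpr ⟨h, ?_⟩) _
  have h2 : Continuous fun a => toMat (f a)⁻¹ := by
    simp only [toMat_inv]
    exact (continuous_const.matrix_mul h.matrix_transpose).matrix_mul continuous_const
  exact h2

theorem continuous_expSO_smul (X : so2 l) (x : AdS l) :
    Continuous fun t : ℝ => expSO (t • X) • x := by
  induction x using QuotientGroup.induction_on with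
  | H g =>
    have h1 : Continuous fun t : ℝ => toMat (expSO (t • X)) := by
      simp only [toMat_expSO]
      open scoped Norms.Operator in
      exact NormedSpace.exp_continuous.comp (continuous_id.smul continuous_const)
    have h2 : Continuous fun t : ℝ => expSO (t • X) * g := by
      refine continuous_of_toMat ?_
      simp only [toMat_mul]
      exact h1.matrix_mul continuous_const
    exact QuotientGroup.continuous_mk.comp h2

theorem expSO_zero : expSO (0 : so2 l) = 1 := by
  apply Subtype.ext
  apply Units.ext
  change toMat (expSO 0) = 1
  rw [toMat_expSO]
  exact NormedSpace.exp_zero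

/-- The translations generated by a null vector. -/
theorem expSO_wedge_mulVec {p w : Ambient l} (hp : form l p p = 0) (hpw : form l p w = 0)
    (x : Ambient l) : toMat (expSO (wedge p w)) *ᵥ x = x + form l w x • p - form l p x • w
      - (2⁻¹ * (form l p x * form l w w)) • p := by
  rw [toMat_expSO, exp_mulVec_of_cube_eq_zero]
  · simp only [wedge_mulVec, form_sub_right, form_smul_right, hp, hpw, form_comm w p]
    module
  · simp only [wedge_mulVec, form_sub_right, form_smul_right, hp, hpw, form_comm w p]
    module

/-! ### Null frames -/

/-- Two orthogonal hyperbolic pairs of null vectors, with negative definite complement. -/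
structure IsNullFrame (p p' q q' : Ambient l) : Prop where
  pp : form l p p = 0
  pp' : form l p' p' = 0
  qq : form l q q = 0
  qq' : form l q' q' = 0
  p_p' : form l p p' = 2⁻¹
  q_q' : form l q q' = 2⁻¹
  p_q : form l p q = 0
  p_q' : form l p q' = 0
  p'_q : form l p' q = 0
  p'_q' : form l p' q' = 0
  neg : ∀ w, form l p w = 0 → form l p' w = 0 → form l q w = 0 → form l q' w = 0 → w ≠ 0 →
    form l w w < 0

namespace IsNullFrame

variable {p p' q q' : Ambient l}

theorem symm (F : IsNullFrame p p' q q') : IsNullFrame p' p q' q where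
  pp := F.pp'
  pp' := F.pp
  qq := F.qq'
  qq' := F.qq
  p_p' := by rw [form_comm, F.p_p']
  q_q' := by rw [form_comm, F.q_q']
  p_q := F.p'_q'
  p_q' := F.p'_q
  p'_q := F.p_q'
  p'_q' := F.p_q
  neg w h1 h2 h3 h4 := F.neg w h2 h1 h4 h3

theorem neg_right (F : IsNullFrame p p' q q') : IsNullFrame p p' (-q) (-q') where
  pp := F.pp
  pp' := F.pp'
  qq := by rw [form_neg_left, form_neg_right, F.qq]; simp
  qq' := by rw [form_neg_left, form_neg_right, F.qq']; simp
  p_p' := F.p_p'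
  q_q' := by rw [form_neg_left, form_neg_right, F.q_q', neg_neg]
  p_q := by rw [form_neg_right, F.p_q, neg_zero]
  p_q' := by rw [form_neg_right, F.p_q', neg_zero]
  p'_q := by rw [form_neg_right, F.p'_q, neg_zero]
  p'_q' := by rw [form_neg_right, F.p'_q', neg_zero]
  neg w h1 h2 h3 h4 := F.neg w h1 h2 (by rwa [form_neg_left, neg_eq_zero] at h3)
    (by rwa [form_neg_left, neg_eq_zero] at h4)

theorem swap (F : IsNullFrame p p' q q') : IsNullFrame q q' p p' where
  pp := F.qq
  pp' := F.qq'
  qq := F.pp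
  qq' := F.pp'
  p_p' := F.q_q'
  q_q' := F.p_p'
  p_q := by rw [form_comm, F.p_q]
  p_q' := by rw [form_comm, F.p'_q]
  p'_q := by rw [form_comm, F.p_q']
  p'_q' := by rw [form_comm, F.p'_q']
  neg w h1 h2 h3 h4 := F.neg w h3 h4 h1 h2

theorem swap_left (F : IsNullFrame p p' q q') : IsNullFrame p' p q q' where
  pp := F.pp'
  pp' := F.pp
  qq := F.qq
  qq' := F.qq'
  p_p' := by rw [form_comm, F.p_p']
  q_q' := F.q_q'
  p_q := F.p'_q
  p_q' := F.p'_q'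
  p'_q := F.p_q
  p'_q' := F.p_q'
  neg w h1 h2 h3 h4 := F.neg w h2 h1 h3 h4

/-- The orthogonal of the totally null plane spanned by `p, q` is negative semidefinite. If `x` lay
in it, removing its components along `p` and `q` would give a vector of the negative definite
complement with norm still `1`. -/
theorem form_q_ne_zero (F : IsNullFrame p p' q q') {x : Ambient l} (hx : form l x x = 1)
    (h : form l p x = 0) : form l q x ≠ 0 := by
  intro hq
  have h1 : form l (x - (2 * form l p' x) • p - (2 * form l q' x) • q)
      (x - (2 * form l p' x) • p - (2 * form l q' x) • q) = 1 := by
    simp only [form_sub_left, form_sub_right, form_smul_left, form_smul_right, form_comm x p,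
      form_comm x q, form_comm q p, F.pp, F.qq, F.p_q, h, hq, hx]
    ring
  have h2 := F.neg (x - (2 * form l p' x) • p - (2 * form l q' x) • q)
    (by simp [form_sub_right, form_smul_right, F.pp, F.p_q, h])
    (by simp [form_sub_right, form_smul_right, form_comm p' p, F.p_p', F.p'_q]; ring)
    (by simp [form_sub_right, form_smul_right, form_comm q p, F.qq, F.p_q, hq])
    (by simp [form_sub_right, form_smul_right, form_comm q' p, form_comm q' q, F.q_q', F.p_q']; ring)
    (by intro h0; rw [h0] at h1; simp at h1)
  linarith

end IsNullFrame

/-- The Lie algebra of an Iwasawa group in terms of a null frame. -/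
structure IsIwasawaAlgebra (p p' q q' : Ambient l) (𝔯 : Submodule ℝ (so2 l)) : Prop where
  boost_p : wedge p p' ∈ 𝔯
  boost_q : wedge q q' ∈ 𝔯
  wedge_p : ∀ w, form l p w = 0 → form l p' w = 0 → wedge p w ∈ 𝔯
  wedge_q : ∀ w, form l p w = 0 → form l p' w = 0 → form l q w = 0 → form l q' w = 0 →
    wedge q w ∈ 𝔯
  mulVec_p : ∀ X ∈ 𝔯, ∃ a : ℝ, X.1 *ᵥ p = a • p
  mulVec_q : ∀ X ∈ 𝔯, ∃ b c : ℝ, X.1 *ᵥ q = b • q + c • p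

end

section

variable {l : ℕ} {p p' q q' : Ambient l} {𝔯 : Submodule ℝ (so2 l)}

/-! ### The orbits of an Iwasawa group -/

theorem form_pow_mulVec {X : so2 l} {v x : Ambient l} {a : ℝ} (h : X.1 *ᵥ v = a • v) (n : ℕ) :
    form l v (X.1 ^ n *ᵥ x) = (-a) ^ n * form l v x := by
  induction n with
  | zero => simp
  | succ n ih =>
    rw [pow_succ', ← mulVec_mulVec, form_comm, form_so2, form_comm, h, form_smul_left, ih]
    ring

/-- The linear form `⟨v, ·⟩`. -/
noncomputable def formLeft (v : Ambient l) : Ambient l →ₗ[ℝ] ℝ where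
  toFun x := form l v x
  map_add' := form_add_right v
  map_smul' r x := form_smul_right r v x

theorem form_expSO {X : so2 l} {v : Ambient l} {a : ℝ} (h : X.1 *ᵥ v = a • v) (x : Ambient l) :
    form l v (toMat (expSO X) *ᵥ x) = Real.exp (-a) * form l v x := by
  rw [toMat_expSO]
  exact map_exp_mulVec (formLeft v) (form_pow_mulVec h)

/-- The term `c • p` contributes `⟨p, Xⁿx⟩`, which stays zero along the wall. -/
theorem form_expSO_of_orthogonal {X : so2 l} {p q x : Ambient l} {a b c : ℝ}
    (hp : X.1 *ᵥ p = a • p) (hq : X.1 *ᵥ q = b • q + c • p) (hx : form l p x = 0) :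
    form l q (toMat (expSO X) *ᵥ x) = Real.exp (-b) * form l q x := by
  rw [toMat_expSO]
  refine map_exp_mulVec (formLeft q) fun n => ?_
  change form l q _ = _ * form l q x
  induction n with
  | zero => simp
  | succ n ih =>
    rw [pow_succ', ← mulVec_mulVec, form_comm, form_so2, form_comm, hq, form_add_left,
      form_smul_left, form_smul_left, ih, form_pow_mulVec hp, hx]
    ring

theorem expSO_eq {g : SO2 l} {X : so2 l} (h : toMat g = NormedSpace.exp X.1) : g = expSO X := by
  apply Subtype.ext
  apply Units.ext
  change toMat g = toMat (expSO X)
  rw [h, toMat_expSO]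

namespace IsIwasawaAlgebra

/-- The group preserves the flag spanned by `p`, then by `p` and `q`, and exponentials act on its
quotients by positive factors. The first claim keeps the wall invariant, which lets the second pass
to products and inverses. This bounds the orbits from above. -/
theorem mem_scale (I : IsIwasawaAlgebra p p' q q' 𝔯) {g : SO2 l} (hg : g ∈ analyticSubgroup 𝔯) :
    (∃ c : ℝ, 0 < c ∧ ∀ x, form l p (toMat g *ᵥ x) = c * form l p x) ∧
    ∃ d : ℝ, 0 < d ∧ ∀ x, form l p x = 0 → form l q (toMat g *ᵥ x) = d * form l q x := by
  induction hg using Subgroup.closure_induction with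
  | mem g hg =>
    obtain ⟨X, hX, hgX⟩ := hg
    obtain ⟨a, ha⟩ := I.mulVec_p X hX
    obtain ⟨b, c, hb⟩ := I.mulVec_q X hX
    rw [expSO_eq hgX]
    exact ⟨⟨_, Real.exp_pos _, form_expSO ha⟩,
      ⟨_, Real.exp_pos _, fun x hx => form_expSO_of_orthogonal ha hb hx⟩⟩
  | one => exact ⟨⟨1, one_pos, by simp [toMat_one]⟩, ⟨1, one_pos, by simp [toMat_one]⟩⟩
  | mul g h _ _ ihg ihh =>
    obtain ⟨⟨c, hc, hcx⟩, d, hd, hdx⟩ := ihg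
    obtain ⟨⟨c', hc', hcx'⟩, d', hd', hdx'⟩ := ihh
    refine ⟨⟨c * c', mul_pos hc hc', fun x => ?_⟩, ⟨d * d', mul_pos hd hd', fun x hx => ?_⟩⟩
    · rw [toMat_mul, ← mulVec_mulVec, hcx, hcx', mul_assoc]
    · rw [toMat_mul, ← mulVec_mulVec, hdx _ (by rw [hcx', hx, mul_zero]), hdx' _ hx, mul_assoc]
  | inv g _ ih =>
    obtain ⟨⟨c, hc, hcx⟩, d, hd, hdx⟩ := ih
    have hinv (x : Ambient l) : toMat g *ᵥ (toMat g⁻¹ *ᵥ x) = x := by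
      rw [mulVec_mulVec, ← toMat_mul, mul_inv_cancel, toMat_one, one_mulVec]
    have h1 (x : Ambient l) : form l p (toMat g⁻¹ *ᵥ x) = c⁻¹ * form l p x := by
      have := hcx (toMat g⁻¹ *ᵥ x)
      rw [hinv] at this
      rw [this]
      field_simp
    refine ⟨⟨c⁻¹, inv_pos.mpr hc, h1⟩, ⟨d⁻¹, inv_pos.mpr hd, fun x hx => ?_⟩⟩
    have := hdx (toMat g⁻¹ *ᵥ x) (by rw [h1, hx, mul_zero])
    rw [hinv] at this
    rw [this]
    field_simp

/-- A boost in the plane of `p, p'` matches the values of `⟨p,·⟩`, and a null translation along `p`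
then matches everything except the `p`-component. That component is fixed by the norm, because
`⟨p,y⟩ ≠ 0`. -/
theorem exists_smul_eq (F : IsNullFrame p p' q q') (I : IsIwasawaAlgebra p p' q q' 𝔯) {x y : AdS l}
    (h : 0 < form l p (emb x) * form l p (emb y)) : ∃ g ∈ analyticSubgroup 𝔯, g • x = y := by
  have hx0 : form l p (emb x) ≠ 0 := fun h0 => by rw [h0, zero_mul] at h; exact lt_irrefl _ h
  have hy0 : form l p (emb y) ≠ 0 := fun h0 => by rw [h0, mul_zero] at h; exact lt_irrefl _ h
  obtain ⟨a, ha⟩ : ∃ a, a = form l p (emb y) := ⟨_, rfl⟩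
  have hpos : 0 < a / form l p (emb x) := by
    have := div_pos h (mul_self_pos.mpr hx0)
    rw [ha]
    convert! this using 1
    field_simp
  -- The boost with parameter `t` multiplies `⟨p,·⟩` by `exp (-t/2)`.
  obtain ⟨t, ht⟩ : ∃ t, t = -(2 * Real.log (a / form l p (emb x))) := ⟨_, rfl⟩
  obtain ⟨x', hx'⟩ : ∃ x', x' = expSO (t • wedge p p') • x := ⟨_, rfl⟩
  have h1 : form l p (emb x') = a := by
    have he : (t • wedge p p').1 *ᵥ p = (t / 2) • p := by
      change (t • (wedge p p').1) *ᵥ p = _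
      rw [smul_mulVec, wedge_mulVec, F.pp, form_comm, F.p_p']
      module
    rw [hx', emb_smul, form_expSO he, ht, show -(-(2 * Real.log (a / form l p (emb x))) / 2) =
      Real.log (a / form l p (emb x)) by ring, Real.exp_log hpos]
    field_simp
  obtain ⟨d, hd⟩ : ∃ d, d = emb y - emb x' := ⟨_, rfl⟩
  have hpd : form l p d = 0 := by rw [hd, form_sub_right, h1, ha, sub_self]
  have ha0 : a ≠ 0 := ha ▸ hy0
  -- Modulo `p`, the translation shifts `x'` by `-a w`. The `p`-part of `d` is removed to make `w`
  -- orthogonal to `p'`.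
  obtain ⟨w, hw⟩ : ∃ w, w = -(a⁻¹) • (d - (2 * form l p' d) • p) := ⟨_, rfl⟩
  have hpw : form l p w = 0 := by
    simp [hw, form_neg_right, form_smul_right, form_sub_right, hpd, F.pp]
  have hpw' : form l p' w = 0 := by
    simp only [hw, form_smul_right, form_sub_right, form_comm p' p, F.p_p']
    ring
  refine ⟨expSO (wedge p w) * expSO (t • wedge p p'),
    mul_mem (expSO_mem (I.wedge_p w hpw hpw')) (expSO_mem (𝔯.smul_mem t I.boost_p)), ?_⟩
  rw [mul_smul, ← hx']
  apply emb_injective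
  obtain ⟨s, hs⟩ : ∃ s : ℝ, emb (expSO (wedge p w) • x') = emb y + s • p := by
    refine ⟨form l w (emb x') - 2⁻¹ * (a * form l w w) - 2 * form l p' d, ?_⟩
    rw [emb_smul, expSO_wedge_mulVec F.pp hpw, h1]
    have : a • w = -(d - (2 * form l p' d) • p) := by
      rw [hw, smul_smul, mul_neg, mul_inv_cancel₀ ha0, neg_one_smul]
    rw [this, show emb y = emb x' + d by rw [hd]; abel]
    module
  have hn := form_emb (expSO (wedge p w) • x')
  rw [hs] at hn ⊢
  simp only [form_add_left, form_add_right, form_smul_left, form_smul_right, form_emb, F.pp,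
    form_comm (emb y) p, ← ha] at hn
  have hs0 : s = 0 := by
    have : s * a = 0 := by linarith
    exact (mul_eq_zero.mp this).resolve_right ha0
  rw [hs0, zero_smul, add_zero]

/-- The same argument with `q` in the role of `p`, except that a `p`-component of the difference
survives. It is cancelled by a translation `p ∧ w` with `w` along `q`, which on the wall is just `z
↦ z + ⟨w,z⟩p`. -/
theorem exists_smul_eq_of_orthogonal (F : IsNullFrame p p' q q')
    (I : IsIwasawaAlgebra p p' q q' 𝔯) {x y : AdS l}
    (hx : form l p (emb x) = 0) (hy : form l p (emb y) = 0)
    (h : 0 < form l q (emb x) * form l q (emb y)) : ∃ g ∈ analyticSubgroup 𝔯, g • x = y := by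
  have hx0 : form l q (emb x) ≠ 0 := fun h0 => by rw [h0, zero_mul] at h; exact lt_irrefl _ h
  have hy0 : form l q (emb y) ≠ 0 := fun h0 => by rw [h0, mul_zero] at h; exact lt_irrefl _ h
  obtain ⟨a, ha⟩ : ∃ a, a = form l q (emb y) := ⟨_, rfl⟩
  have hpos : 0 < a / form l q (emb x) := by
    have := div_pos h (mul_self_pos.mpr hx0)
    rw [ha]
    convert! this using 1
    field_simp
  obtain ⟨t, ht⟩ : ∃ t, t = -(2 * Real.log (a / form l q (emb x))) := ⟨_, rfl⟩
  obtain ⟨x', hx'⟩ : ∃ x', x' = expSO (t • wedge q q') • x := ⟨_, rfl⟩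
  have h1 : form l q (emb x') = a := by
    have he : (t • wedge q q').1 *ᵥ q = (t / 2) • q := by
      change (t • (wedge q q').1) *ᵥ q = _
      rw [smul_mulVec, wedge_mulVec, F.qq, form_comm, F.q_q']
      module
    rw [hx', emb_smul, form_expSO he, ht, show -(-(2 * Real.log (a / form l q (emb x))) / 2) =
      Real.log (a / form l q (emb x)) by ring, Real.exp_log hpos]
    field_simp
  have h2 : form l p (emb x') = 0 := by
    have he : (t • wedge q q').1 *ᵥ p = (0 : ℝ) • p := by
      change (t • (wedge q q').1) *ᵥ p = _
      rw [smul_mulVec, wedge_mulVec, form_comm, F.p_q', form_comm, F.p_q]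
      module
    rw [hx', emb_smul, form_expSO he, hx, mul_zero]
  obtain ⟨d, hd⟩ : ∃ d, d = emb y - emb x' := ⟨_, rfl⟩
  have hpd : form l p d = 0 := by rw [hd, form_sub_right, h2, hy, sub_self]
  have hqd : form l q d = 0 := by rw [hd, form_sub_right, h1, ha, sub_self]
  have ha0 : a ≠ 0 := ha ▸ hy0
  obtain ⟨w, hw⟩ : ∃ w, w = -(a⁻¹) • (d - (2 * form l q' d) • q - (2 * form l p' d) • p) :=
    ⟨_, rfl⟩
  have hpw : form l p w = 0 := by
    simp [hw, form_neg_right, form_smul_right, form_sub_right, hpd, F.pp, F.p_q]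
  have hqw : form l q w = 0 := by
    simp [hw, form_neg_right, form_smul_right, form_sub_right, hqd, F.qq, F.p_q, form_comm q p]
  have hpw' : form l p' w = 0 := by
    simp only [hw, form_smul_right, form_sub_right, form_comm p' p, F.p_p', F.p'_q]
    ring
  have hqw' : form l q' w = 0 := by
    simp only [hw, form_smul_right, form_sub_right, form_comm q' p, form_comm q' q, F.p_q', F.q_q']
    ring
  -- `r` is the excess along `p` after the boost and the `q`-translation. Since `⟨q,y⟩ = a`, the
  -- vector `-(r/a) q` pairs with the intermediate point to `-r`.
  obtain ⟨r, hr⟩ : ∃ r, r = -(2 * form l p' d) := ⟨_, rfl⟩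
  refine ⟨expSO (wedge p (-(r / a) • q)) * (expSO (wedge q w) * expSO (t • wedge q q')),
    mul_mem (expSO_mem (I.wedge_p _ ?_ ?_)) (mul_mem (expSO_mem (I.wedge_q w hpw hpw' hqw hqw'))
      (expSO_mem (𝔯.smul_mem t I.boost_q))), ?_⟩
  · rw [form_smul_right, F.p_q, mul_zero]
  · rw [form_smul_right, F.p'_q, mul_zero]
  rw [mul_smul, mul_smul, ← hx']
  apply emb_injective
  obtain ⟨s, hs⟩ : ∃ s : ℝ, emb (expSO (wedge q w) • x') = emb y + r • p + s • q := by
    refine ⟨form l w (emb x') - 2⁻¹ * (a * form l w w) - 2 * form l q' d, ?_⟩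
    rw [emb_smul, expSO_wedge_mulVec F.qq hqw, h1]
    have : a • w = -(d - (2 * form l q' d) • q - (2 * form l p' d) • p) := by
      rw [hw, smul_smul, mul_neg, mul_inv_cancel₀ ha0, neg_one_smul]
    rw [this, show emb y = emb x' + d by rw [hd]; abel, hr]
    module
  have hn := form_emb (expSO (wedge q w) • x')
  have hs0 : s = 0 := by
    rw [hs] at hn
    simp only [form_add_left, form_add_right, form_smul_left, form_smul_right, form_emb, F.pp,
      F.qq, F.p_q, form_comm q p, form_comm (emb y) p, form_comm (emb y) q, ← ha, hy] at hn
    have : s * a = 0 := by linarith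
    exact (mul_eq_zero.mp this).resolve_right ha0
  rw [hs0, zero_smul, add_zero] at hs
  rw [emb_smul, hs, expSO_wedge_mulVec F.pp (by rw [form_smul_right, F.p_q, mul_zero])]
  simp only [form_add_right, form_smul_right, form_smul_left, F.pp, hy, F.qq, form_comm q p,
    F.p_q, ← ha]
  rw [show -(r / a) * a + r * (-(r / a) * 0) = -r by rw [neg_mul, div_mul_cancel₀ _ ha0]; ring]
  module

end IsIwasawaAlgebra

/-! ### Sign regions of the null frame and their topology -/

/-- The region where a linear form has a given sign `r`. -/
def halfSpace (r : ℝ) (p : Ambient l) : Set (AdS l) := {x | 0 < r * form l p (emb x)}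

/-- The part of the wall `⟨p, x⟩ = 0` where `⟨q, x⟩` has a given sign `r`. -/
def halfWall (r : ℝ) (p q : Ambient l) : Set (AdS l) :=
  {x | form l p (emb x) = 0 ∧ 0 < r * form l q (emb x)}

theorem continuous_form_emb (p : Ambient l) : Continuous fun x : AdS l => form l p (emb x) :=
  continuous_form.comp (continuous_const.prodMk continuous_emb)

theorem isOpen_halfSpace (r : ℝ) (p : Ambient l) : IsOpen (halfSpace r p) :=
  isOpen_lt continuous_const (continuous_const.mul (continuous_form_emb p))

namespace IsNullFrame

/-- On the wall `⟨q,·⟩` never vanishes, so the strict inequality may be replaced by the weak one. -/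
theorem isClosed_halfWall (F : IsNullFrame p p' q q') {r : ℝ} (hr : r ≠ 0) :
    IsClosed (halfWall r p q) := by
  have h : halfWall r p q = {x | form l p (emb x) = 0} ∩ {x | 0 ≤ r * form l q (emb x)} := by
    ext x
    refine and_congr_right fun hx => ⟨le_of_lt, fun h => lt_of_le_of_ne h ?_⟩
    exact (mul_ne_zero hr (F.form_q_ne_zero (form_emb x) hx)).symm
  rw [h]
  exact (isClosed_eq (continuous_form_emb p) continuous_const).inter
    (isClosed_le continuous_const (continuous_const.mul (continuous_form_emb q)))

theorem exists_emb_p (F : IsNullFrame p p' q q') : ∃ x : AdS l, emb x = p + p' :=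
  exists_emb_eq (by
    simp only [form_add_left, form_add_right, F.pp, F.pp', F.p_p', form_comm p' p]
    norm_num)

theorem exists_emb_smul_p (F : IsNullFrame p p' q q') {r : ℝ} (hr : r * r = 1) :
    ∃ x : AdS l, emb x = r • (p + p') :=
  exists_emb_eq (by
    simp only [form_smul_left, form_smul_right, form_add_left, form_add_right, F.pp, F.pp', F.p_p',
      form_comm p' p]
    linarith)

theorem halfSpace_nonempty (F : IsNullFrame p p' q q') {r : ℝ} (hr : r * r = 1) :
    (halfSpace r p).Nonempty := by
  obtain ⟨x, hx⟩ := F.exists_emb_smul_p hr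
  refine ⟨x, ?_⟩
  change 0 < r * form l p (emb x)
  rw [hx, form_smul_right, form_add_right, F.pp, F.p_p', ← mul_assoc, hr]
  norm_num

theorem halfWall_nonempty (F : IsNullFrame p p' q q') {r : ℝ} (hr : r * r = 1) :
    (halfWall r p q).Nonempty := by
  obtain ⟨x, hx⟩ := F.swap.exists_emb_smul_p hr
  refine ⟨x, ?_, ?_⟩
  · rw [hx, form_smul_right, form_add_right, F.p_q, F.p_q']
    norm_num
  · rw [hx, form_smul_right, form_add_right, F.qq, F.q_q', ← mul_assoc, hr]
    norm_num

/-- A curve that crosses the wall `⟨p, x⟩ = 0` with unit speed. -/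
theorem exists_crossing (F : IsNullFrame p p' q q') {x : AdS l} (hx : form l p (emb x) = 0) :
    ∃ γ : ℝ → AdS l, Continuous γ ∧ γ 0 = x ∧ ∀ t, form l p (emb (γ t)) = t := by
  have hq := F.form_q_ne_zero (form_emb x) hx
  -- This null translation adds `⟨w,x⟩⟨p,p'⟩` to `⟨p,·⟩`, where `w = t (2/⟨q,x⟩) q`; the factor
  -- `2/⟨q,x⟩` turns it into `t`. The quadratic term vanishes as `q` is null.
  refine ⟨fun t => expSO (t • wedge p' ((2 / form l q (emb x)) • q)) • x,
    continuous_expSO_smul _ _, by simp only [zero_smul, expSO_zero, one_smul], fun t => ?_⟩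
  have hw : t • wedge p' ((2 / form l q (emb x)) • q) =
      wedge p' ((t * (2 / form l q (emb x))) • q) := by
    refine so2_ext fun u => ?_
    change (t • (wedge _ _).1) *ᵥ u = _
    simp only [smul_mulVec, wedge_mulVec, form_smul_left]
    module
  rw [emb_smul, hw, expSO_wedge_mulVec F.pp' (by rw [form_smul_right, F.p'_q, mul_zero])]
  simp only [form_add_right, form_sub_right, form_smul_right, form_smul_left, F.p_p', F.p_q, F.qq,
    hx]
  field_simp
  ring

theorem not_isOpen_halfWall (F : IsNullFrame p p' q q') {r : ℝ} (hr : r * r = 1) :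
    ¬IsOpen (halfWall r p q) := by
  intro h
  obtain ⟨x, hx⟩ := F.halfWall_nonempty hr
  obtain ⟨γ, hγ, hγ0, hγt⟩ := F.exists_crossing hx.1
  have h1 : ∀ᶠ t in 𝓝 (0 : ℝ), γ t ∈ halfWall r p q :=
    (hγ.tendsto' 0 x hγ0).eventually (h.mem_nhds hx)
  have h2 : ∀ᶠ t in 𝓝[≠] (0 : ℝ), False := by
    filter_upwards [h1.filter_mono nhdsWithin_le_nhds, self_mem_nhdsWithin] with t ht ht0
    exact ht0 ((hγt t).symm.trans ht.1)
  exact (Filter.eventually_false_iff_eq_bot.mp h2 ▸ NormedField.nhdsNE_neBot (0 : ℝ)).ne rfl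

theorem not_isClosed_halfSpace (F : IsNullFrame p p' q q') {r : ℝ} (hr : r * r = 1) :
    ¬IsClosed (halfSpace r p) := by
  intro h
  obtain ⟨x, hx⟩ := F.halfWall_nonempty hr
  obtain ⟨γ, hγ, hγ0, hγt⟩ := F.exists_crossing hx.1
  have hr0 : r ≠ 0 := fun h0 => by simp [h0] at hr
  -- Rescaling the parameter by `r = ±1` makes the curve enter the half space of sign `r` for `t >
  -- 0`, with limit on the wall.
  have h1 : Continuous fun t : ℝ => γ (r * t) := hγ.comp (continuous_const.mul continuous_id)
  have h2 : Filter.Tendsto (fun t : ℝ => γ (r * t)) (𝓝[>] 0) (𝓝 x) :=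
    (h1.tendsto' 0 x (by rw [mul_zero, hγ0])).mono_left nhdsWithin_le_nhds
  have h3 : x ∈ halfSpace r p := by
    refine h.mem_of_tendsto h2 ?_
    filter_upwards [self_mem_nhdsWithin] with t ht
    change 0 < r * form l p (emb (γ (r * t)))
    rw [hγt, ← mul_assoc, hr, one_mul]
    exact ht
  have h4 : 0 < r * form l p (emb x) := h3
  rw [hx.1, mul_zero] at h4
  exact lt_irrefl _ h4

end IsNullFrame

/-! ### Classification of the orbits -/

namespace IsIwasawaAlgebra

theorem orbit_eq_halfSpace (F : IsNullFrame p p' q q') (I : IsIwasawaAlgebra p p' q q' 𝔯) {r : ℝ}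
    {x : AdS l} (hx : x ∈ halfSpace r p) :
    MulAction.orbit (analyticSubgroup 𝔯) x = halfSpace r p := by
  have hx' : 0 < r * form l p (emb x) := hx
  ext y
  constructor
  · rintro ⟨⟨g, hg⟩, rfl⟩
    obtain ⟨⟨c, hc, hcx⟩, -⟩ := I.mem_scale hg
    change 0 < r * form l p (emb (g • x))
    rw [emb_smul, hcx]
    calc 0 < c * (r * form l p (emb x)) := mul_pos hc hx'
      _ = _ := by ring
  · intro hy
    have hy' : 0 < r * form l p (emb y) := hy
    have h : 0 < form l p (emb x) * form l p (emb y) := by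
      have h1 := mul_pos hx' hy'
      by_contra! h2
      nlinarith [mul_self_nonneg r]
    obtain ⟨g, hg, hgx⟩ := exists_smul_eq F I h
    exact ⟨⟨g, hg⟩, hgx⟩

theorem orbit_eq_halfWall (F : IsNullFrame p p' q q') (I : IsIwasawaAlgebra p p' q q' 𝔯) {r : ℝ}
    {x : AdS l} (hx : x ∈ halfWall r p q) :
    MulAction.orbit (analyticSubgroup 𝔯) x = halfWall r p q := by
  obtain ⟨hx0, hx'⟩ := hx
  ext y
  constructor
  · rintro ⟨⟨g, hg⟩, rfl⟩
    obtain ⟨⟨c, hc, hcx⟩, d, hd, hdx⟩ := I.mem_scale hg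
    constructor
    · change form l p (emb (g • x)) = 0
      rw [emb_smul, hcx, hx0, mul_zero]
    · change 0 < r * form l q (emb (g • x))
      rw [emb_smul, hdx _ hx0]
      calc 0 < d * (r * form l q (emb x)) := mul_pos hd hx'
        _ = _ := by ring
  · rintro ⟨hy0, hy'⟩
    have h : 0 < form l q (emb x) * form l q (emb y) := by
      have h1 := mul_pos hx' hy'
      by_contra! h2
      nlinarith [mul_self_nonneg r]
    obtain ⟨g, hg, hgx⟩ := exists_smul_eq_of_orthogonal F I hx0 hy0 h
    exact ⟨⟨g, hg⟩, hgx⟩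

theorem orbits_eq (F : IsNullFrame p p' q q') (I : IsIwasawaAlgebra p p' q q' 𝔯) :
    orbits (analyticSubgroup 𝔯) =
      {halfSpace 1 p, halfSpace (-1) p, halfWall 1 p q, halfWall (-1) p q} := by
  ext O
  simp only [Set.mem_insert_iff, Set.mem_singleton_iff]
  constructor
  · rintro ⟨x, rfl⟩
    simp only
    rcases lt_trichotomy (form l p (emb x)) 0 with h | h | h
    · right; left
      exact orbit_eq_halfSpace F I (show 0 < -1 * form l p (emb x) by linarith)
    · rcases (F.form_q_ne_zero (form_emb x) h).lt_or_gt with h' | h'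
      · right; right; right
        exact orbit_eq_halfWall F I ⟨h, by linarith⟩
      · right; right; left
        exact orbit_eq_halfWall F I ⟨h, by linarith⟩
    · left
      exact orbit_eq_halfSpace F I (show 0 < 1 * form l p (emb x) by linarith)
  · rintro (rfl | rfl | rfl | rfl)
    · obtain ⟨x, hx⟩ := F.halfSpace_nonempty (r := 1) (by norm_num)
      exact ⟨x, orbit_eq_halfSpace F I hx⟩
    · obtain ⟨x, hx⟩ := F.halfSpace_nonempty (r := -1) (by norm_num)
      exact ⟨x, orbit_eq_halfSpace F I hx⟩
    · obtain ⟨x, hx⟩ := F.halfWall_nonempty (r := 1) (by norm_num)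
      exact ⟨x, orbit_eq_halfWall F I hx⟩
    · obtain ⟨x, hx⟩ := F.halfWall_nonempty (r := -1) (by norm_num)
      exact ⟨x, orbit_eq_halfWall F I hx⟩

theorem openOrbits_eq (F : IsNullFrame p p' q q') (I : IsIwasawaAlgebra p p' q q' 𝔯) :
    openOrbits (analyticSubgroup 𝔯) = {halfSpace 1 p, halfSpace (-1) p} := by
  ext O
  simp only [openOrbits, orbits_eq F I, Set.mem_ofPred_eq, Set.mem_insert_iff,
    Set.mem_singleton_iff]
  constructor
  · rintro ⟨rfl | rfl | rfl | rfl, hO⟩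
    · simp
    · simp
    · exact absurd hO (F.not_isOpen_halfWall (by norm_num))
    · exact absurd hO (F.not_isOpen_halfWall (by norm_num))
  · rintro (rfl | rfl)
    · exact ⟨by simp, isOpen_halfSpace _ _⟩
    · exact ⟨by simp, isOpen_halfSpace _ _⟩

theorem closedOrbits_eq (F : IsNullFrame p p' q q') (I : IsIwasawaAlgebra p p' q q' 𝔯) :
    closedOrbits (analyticSubgroup 𝔯) = {halfWall 1 p q, halfWall (-1) p q} := by
  ext O
  simp only [closedOrbits, orbits_eq F I, Set.mem_ofPred_eq, Set.mem_insert_iff,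
    Set.mem_singleton_iff]
  constructor
  · rintro ⟨rfl | rfl | rfl | rfl, hO⟩
    · exact absurd hO (F.not_isClosed_halfSpace (by norm_num))
    · exact absurd hO (F.not_isClosed_halfSpace (by norm_num))
    · simp
    · simp
  · rintro (rfl | rfl)
    · exact ⟨by simp, F.isClosed_halfWall (by norm_num)⟩
    · exact ⟨by simp, F.isClosed_halfWall (by norm_num)⟩

theorem sUnion_closedOrbits (F : IsNullFrame p p' q q') (I : IsIwasawaAlgebra p p' q q' 𝔯) :
    ⋃₀ closedOrbits (analyticSubgroup 𝔯) = {x | form l p (emb x) = 0} := by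
  rw [closedOrbits_eq F I, Set.sUnion_pair]
  ext x
  constructor
  · rintro (h | h) <;> exact h.1
  · intro h
    rcases (F.form_q_ne_zero (form_emb x) h).lt_or_gt with h' | h'
    · exact Or.inr ⟨h, by linarith⟩
    · exact Or.inl ⟨h, by linarith⟩

theorem finite_closedOrbits (F : IsNullFrame p p' q q') (I : IsIwasawaAlgebra p p' q q' 𝔯) :
    (closedOrbits (analyticSubgroup 𝔯)).Finite := by
  rw [closedOrbits_eq F I]
  simp

theorem hasFourOrbits (F : IsNullFrame p p' q q') (I : IsIwasawaAlgebra p p' q q' 𝔯) :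
    HasFourOrbits (analyticSubgroup 𝔯) := by
  have h1 : halfSpace 1 p ≠ halfSpace (-1) p := by
    intro h
    obtain ⟨x, hx⟩ := F.halfSpace_nonempty (r := 1) (by norm_num)
    have hx' : x ∈ halfSpace (-1) p := h ▸ hx
    have hx' : 0 < -1 * form l p (emb x) := hx'
    have hx2 : 0 < 1 * form l p (emb x) := hx
    linarith
  have h2 : halfWall 1 p q ≠ halfWall (-1) p q := by
    intro h
    obtain ⟨x, hx⟩ := F.halfWall_nonempty (r := 1) (by norm_num)
    have hx' : x ∈ halfWall (-1) p q := h ▸ hx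
    linarith [hx.2, hx'.2]
  have h3 (r : ℝ) (s : ℝ) (hs : s * s = 1) : halfSpace r p ≠ halfWall s p q := by
    intro h
    exact F.not_isOpen_halfWall hs (h ▸ isOpen_halfSpace r p)
  refine ⟨?_, ?_, ?_, ?_⟩
  · rw [orbits_eq F I, Set.ncard_insert_of_notMem, Set.ncard_insert_of_notMem, Set.ncard_pair h2]
    · simp [h3]
    · simp [h3, h1]
  · rw [openOrbits_eq F I, Set.ncard_pair h1]
  · rw [closedOrbits_eq F I, Set.ncard_pair h2]
  · intro O hO
    rw [orbits_eq F I] at hO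
    rcases hO with rfl | rfl | rfl | rfl
    · exact Or.inl ⟨isOpen_halfSpace _ _, F.not_isClosed_halfSpace (by norm_num)⟩
    · exact Or.inl ⟨isOpen_halfSpace _ _, F.not_isClosed_halfSpace (by norm_num)⟩
    · exact Or.inr ⟨F.isClosed_halfWall (by norm_num), F.not_isOpen_halfWall (by norm_num)⟩
    · exact Or.inr ⟨F.isClosed_halfWall (by norm_num), F.not_isOpen_halfWall (by norm_num)⟩

end IsIwasawaAlgebra

end

section

variable {l : ℕ} {p p' q q' : Ambient l}

/-! ### Light rays -/

/-- Light rays are straight lines of the ambient space. -/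
theorem IsFutureLightRay.emb_eq {c : ℝ → AdS l} (h : IsFutureLightRay c) (s : ℝ) :
    emb (c s) = emb (c 0) + s • deriv (fun r => emb (c r)) 0 := by
  obtain ⟨⟨hsm, hgeo⟩, hlight⟩ := h
  obtain ⟨γ, hγ⟩ : ∃ γ : ℝ → Ambient l, γ = fun r => emb (c r) := ⟨_, rfl⟩
  rw [← hγ] at hsm hgeo hlight ⊢
  have hγs (s : ℝ) : emb (c s) = γ s := by rw [hγ]
  have hd (s : ℝ) : HasDerivAt γ (deriv γ s) s :=
    ((hsm.differentiable (by norm_num)) s).hasDerivAt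
  have hd2 (s : ℝ) : HasDerivAt (deriv γ) (deriv (deriv γ) s) s := by
    have : ContDiff ℝ 1 (deriv γ) := (contDiff_infty_iff_deriv.mp hsm).2.of_le (by norm_cast)
    exact ((this.differentiable (by norm_num)) s).hasDerivAt
  have hform (f g f' g' : ℝ → Ambient l) (hf : ∀ s, HasDerivAt f (f' s) s)
      (hg : ∀ s, HasDerivAt g (g' s) s) (s : ℝ) :
      HasDerivAt (fun s => form l (f s) (g s)) (form l (f' s) (g s) + form l (f s) (g' s)) s := by
    simp only [form_apply]
    have hf' (i) := hasDerivAt_pi.mp (hf s) i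
    have hg' (i) := hasDerivAt_pi.mp (hg s) i
    have h1 := (((hf' (Sum.inl 0)).mul (hg' (Sum.inl 0))).add
      ((hf' (Sum.inl 1)).mul (hg' (Sum.inl 1)))).sub
      (HasDerivAt.fun_sum (u := Finset.univ)
        (fun i _ => (hf' (Sum.inr i)).mul (hg' (Sum.inr i))))
    convert! h1 using 1
    rw [Finset.sum_add_distrib]
    ring
  have h1 (s : ℝ) : form l (deriv γ s) (γ s) = 0 := by
    have := (hlight s).1
    rw [← hγs]
    exact this
  -- Differentiating `⟨γ',γ⟩ = 0` gives `⟨γ'',γ⟩ = -⟨γ',γ'⟩`, which is zero for a light-like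
  -- velocity. The acceleration, already normal to the hyperboloid, thus has no normal component
  -- either and vanishes.
  have h2 (s : ℝ) : form l (deriv (deriv γ) s) (γ s) = 0 := by
    have h3 := hform _ _ _ _ hd2 hd s
    have h4 : (fun s => form l (deriv γ s) (γ s)) = fun _ => 0 := funext h1
    rw [h4] at h3
    have h5 := h3.unique (hasDerivAt_const s (0 : ℝ))
    have h6 : form l (deriv γ s) (deriv γ s) = 0 := (hlight s).2.1
    linarith
  have h3 (s : ℝ) : deriv (deriv γ) s = 0 := by
    refine eq_zero_of_form_eq_zero fun w => ?_
    have hn : form l (γ s) (γ s) = 1 := by rw [← hγs, form_emb]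
    have h4 := hgeo s (w - form l w (γ s) • γ s) (by
      change form l _ (emb (c s)) = 0
      rw [hγs, form_sub_left, form_smul_left, hn]
      ring)
    rw [form_sub_right, form_smul_right, h2, mul_zero, sub_zero] at h4
    exact h4
  have h4 (s : ℝ) : deriv γ s = deriv γ 0 :=
    is_const_of_deriv_eq_zero (fun s => (hd2 s).differentiableAt) h3 s 0
  have h5 : ∀ s, HasDerivAt (fun s => γ s - s • deriv γ 0) 0 s := by
    intro s
    have := (hd s).sub ((hasDerivAt_id s).smul_const (deriv γ 0))
    rw [h4 s, one_smul, sub_self] at this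
    exact this
  have h6 := is_const_of_deriv_eq_zero (fun s => (h5 s).differentiableAt)
    (fun s => (h5 s).deriv) s 0
  simp only [zero_smul, sub_zero] at h6
  rw [hγs, hγs, ← h6]
  abel

/-- The line `x + sk` stays on the hyperboloid because `k` is null and orthogonal to `x`, and it
stays future directed because `⟨k, q₀k⟩ = 0`. -/
theorem exists_isFutureLightRay {x : AdS l} {k : Ambient l} (hk : IsFutureLightlike x k) :
    ∃ c : ℝ → AdS l, IsFutureLightRay c ∧ c 0 = x ∧ ∀ s, emb (c s) = emb x + s • k := by
  obtain ⟨h1, h2, h3⟩ := hk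
  have h1' : form l k (emb x) = 0 := h1
  have hex (s : ℝ) : ∃ y : AdS l, emb y = emb x + s • k := by
    refine exists_emb_eq ?_
    simp only [form_add_left, form_add_right, form_smul_left, form_smul_right, form_emb,
      form_comm (emb x) k, h1', h2]
    ring
  choose c hc using hex
  have hd : deriv (fun r => emb (c r)) = fun _ => k := by
    funext s
    simp only [hc]
    have := ((hasDerivAt_id s).smul_const k).const_add (emb x)
    rw [one_smul] at this
    exact this.deriv
  refine ⟨c, ⟨⟨?_, ?_⟩, ?_⟩, ?_, hc⟩
  · simp only [hc]
    fun_prop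
  · intro s v hv
    rw [hd, deriv_const, form_zero_left]
  · intro s
    rw [hd]
    refine ⟨?_, h2, ?_⟩
    · change form l k (emb (c s)) = 0
      rw [hc, form_add_right, form_smul_right, h1', h2]
      ring
    · have hkk : form l k (q0 l *ᵥ k) = 0 := by
        rw [form_q0]
        ring
      change 0 < form l k (q0 l *ᵥ emb (c s))
      rw [hc, mulVec_add, mulVec_smul, form_add_right, form_smul_right, hkk, mul_zero, add_zero]
      exact h3
  · apply emb_injective
    rw [hc, zero_smul, add_zero]

/-! ### The black hole -/

/-- The singularity attached to a null frame. -/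
def wall (p p' : Ambient l) : Set (AdS l) :=
  {x | form l p (emb x) = 0} ∪ {x | form l p' (emb x) = 0}

theorem subset_blackHole (S : Set (AdS l)) : S ⊆ blackHole S := by
  rintro x hx c - rfl
  exact ⟨0, le_rfl, hx⟩

theorem isFutureLightlike_or_neg {x : AdS l} {k : Ambient l} (h1 : form l k (emb x) = 0)
    (h2 : form l k k = 0) (h0 : k ≠ 0) : IsFutureLightlike x k ∨ IsFutureLightlike x (-k) := by
  rcases (form_q0_ne_zero (form_emb x) h1 h2.ge h0).lt_or_gt with h | h
  · refine Or.inr ⟨?_, ?_, ?_⟩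
    · change form l (-k) (emb x) = 0
      rw [form_neg_left, h1, neg_zero]
    · rw [form_neg_left, form_neg_right, h2]
      norm_num
    · rw [form_neg_left]
      exact neg_pos.mpr h
  · exact Or.inl ⟨h1, h2, h⟩

namespace IsNullFrame

theorem q_ne_zero (F : IsNullFrame p p' q q') : q ≠ 0 := by
  intro h
  have := F.q_q'
  rw [h, form_zero_left] at this
  norm_num at this

/-- One of `q, -q` is future directed at `p + p'`. Both are orthogonal to `p` and `p'`, so `⟨p,·⟩`
and `⟨p',·⟩` keep the value `1/2` along the ray. -/
theorem notMem_blackHole (F : IsNullFrame p p' q q') {x : AdS l} (hx : emb x = p + p') :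
    x ∉ blackHole (wall p p') := by
  intro hbh
  have key (k : Ambient l) (hk : IsFutureLightlike x k) (hpk : form l p k = 0)
      (hpk' : form l p' k = 0) : False := by
    obtain ⟨c, hc, hc0, hcs⟩ := exists_isFutureLightRay hk
    obtain ⟨s, -, hs | hs⟩ := hbh c hc hc0
    · have hs' : form l p (emb (c s)) = 0 := hs
      simp only [hcs, hx, form_add_right, form_smul_right, F.pp, F.p_p', hpk] at hs'
      norm_num at hs'
    · have hs' : form l p' (emb (c s)) = 0 := hs
      simp only [hcs, hx, form_add_right, form_smul_right, F.pp', form_comm p' p, F.p_p',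
        hpk'] at hs'
      norm_num at hs'
  have h1 : form l q (emb x) = 0 := by
    rw [hx, form_add_right, form_comm q p, form_comm q p', F.p_q, F.p'_q, add_zero]
  rcases isFutureLightlike_or_neg h1 F.qq F.q_ne_zero with h | h
  · exact key q h F.p_q F.p'_q
  · exact key (-q) h (by rw [form_neg_right, F.p_q, neg_zero])
      (by rw [form_neg_right, F.p'_q, neg_zero])

/-- A point outside the singularity all of whose future light rays reach it. -/
theorem exists_mem_blackHole (F : IsNullFrame p p' q q') :
    ∃ x ∈ blackHole (wall p p'), x ∉ wall p p' := by
  have hee : form l (p + p') (p + p') = 1 := by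
    simp only [form_add_left, form_add_right, F.pp, F.pp', F.p_p', form_comm p' p]
    norm_num
  have hff : form l (q + q') (q + q') = 1 := by
    simp only [form_add_left, form_add_right, F.qq, F.qq', F.q_q', form_comm q' q]
    norm_num
  have hfe : form l (q + q') (p + p') = 0 := by
    simp only [form_add_left, form_add_right, form_comm q p, form_comm q p', form_comm q' p,
      form_comm q' p', F.p_q, F.p_q', F.p'_q, F.p'_q']
    norm_num
  -- The wall involves only `p, p'`, so `q, q'` may be negated to make `q + q'` future directed at
  -- `p + p'`.
  wlog hpos : 0 < form l (q + q') (q0 l *ᵥ (p + p')) generalizing q q'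
  · refine this F.neg_right ?_ ?_ ?_
    · rw [← hff, ← neg_add, form_neg_left, form_neg_right, neg_neg]
    · rw [← neg_add, form_neg_left, hfe, neg_zero]
    · rw [← neg_add, form_neg_left]
      refine neg_pos.mpr (lt_of_le_of_ne (not_lt.mp hpos) ?_)
      refine form_q0_ne_zero hee hfe (by rw [hff]; norm_num) ?_
      intro h0
      rw [h0, form_zero_left] at hff
      norm_num at hff
  obtain ⟨r, hr0, hr⟩ : ∃ r : ℝ, 0 < r ∧ r * r = 2⁻¹ :=
    ⟨√2⁻¹, by positivity, Real.mul_self_sqrt (by norm_num)⟩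
  obtain ⟨e, he⟩ : ∃ e, e = p + p' := ⟨_, rfl⟩
  obtain ⟨f, hf⟩ : ∃ f, f = q + q' := ⟨_, rfl⟩
  rw [← he] at hee hfe hpos
  rw [← hf] at hff hfe hpos
  have hpe : form l p e = 2⁻¹ := by rw [he, form_add_right, F.pp, F.p_p', zero_add]
  have hpe' : form l p' e = 2⁻¹ := by
    rw [he, form_add_right, F.pp', form_comm, F.p_p', add_zero]
  have hpf : form l p f = 0 := by rw [hf, form_add_right, F.p_q, F.p_q', zero_add]
  have hpf' : form l p' f = 0 := by rw [hf, form_add_right, F.p'_q, F.p'_q', zero_add]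
  obtain ⟨x, hx⟩ : ∃ x : AdS l, emb x = r • (e + f) := exists_emb_eq (by
    simp only [form_add_left, form_add_right, form_smul_left, form_smul_right, hee, hff, hfe,
      form_comm e f]
    linarith)
  have hpx : form l p (emb x) = r / 2 := by
    rw [hx, form_smul_right, form_add_right, hpe, hpf]
    ring
  have hpx' : form l p' (emb x) = r / 2 := by
    rw [hx, form_smul_right, form_add_right, hpe', hpf']
    ring
  refine ⟨x, ?_, ?_⟩
  · intro c hc hc0
    obtain ⟨k, hk⟩ : ∃ k, k = deriv (fun s => emb (c s)) 0 := ⟨_, rfl⟩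
    obtain ⟨hk1, hk2, hk3⟩ := hc.2 0
    rw [← hk] at hk1 hk2 hk3
    rw [hc0] at hk1 hk3
    have hk1' : form l k (emb x) = 0 := hk1
    have hcs (s : ℝ) : emb (c s) = emb x + s • k := by rw [hc.emb_eq, hc0, hk]
    -- `f - e` is a future directed time-like tangent vector at `x = r(e + f)`. Since `k` is
    -- orthogonal to `e + f`, positivity of `⟨k, f - e⟩` forces `⟨k,e⟩ = ⟨p,k⟩ + ⟨p',k⟩ < 0`.
    have hpos' : 0 < form l k (f - e) := by
      refine form_pos_of_future (form_emb x) ?_ ?_ ?_ hk1' hk2 hk3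
      · simp only [hx, form_smul_right, form_sub_left, form_add_right, hee, hff, hfe,
          form_comm e f]
        ring
      · simp only [form_sub_left, form_sub_right, hee, hff, hfe, form_comm e f]
        norm_num
      · have h1 (v : Ambient l) : form l v (q0 l *ᵥ v) = 0 := by
          rw [form_q0]
          ring
        rw [hx, mulVec_smul, mulVec_add]
        simp only [form_smul_right, form_add_right, form_sub_left, h1, form_q0_swap e f]
        nlinarith
    have hsum : form l k e + form l k f = 0 := by
      rw [hx, form_smul_right, form_add_right] at hk1'
      exact (mul_eq_zero.mp hk1').resolve_left hr0.ne'
    have hneg : form l p k + form l p' k < 0 := by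
      rw [form_sub_right] at hpos'
      have : form l k e = form l p k + form l p' k := by
        rw [he, form_add_right, form_comm k p, form_comm k p']
      linarith
    have key (v : Ambient l) (hv : form l v (emb x) = r / 2) (hvk : form l v k < 0) :
        ∃ s : ℝ, 0 ≤ s ∧ form l v (emb (c s)) = 0 := by
      refine ⟨r / 2 / -form l v k, by have := neg_pos.mpr hvk; positivity, ?_⟩
      rw [hcs, form_add_right, form_smul_right, hv]
      have : form l v k ≠ 0 := hvk.ne
      field_simp
      ring
    rcases lt_or_ge (form l p k) 0 with h | h
    · obtain ⟨s, hs, hs0⟩ := key p hpx h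
      exact ⟨s, hs, Or.inl hs0⟩
    · obtain ⟨s, hs, hs0⟩ := key p' hpx' (by linarith)
      exact ⟨s, hs, Or.inr hs0⟩
  · rintro (h | h)
    · have h' : form l p (emb x) = 0 := h
      linarith
    · have h' : form l p' (emb x) = 0 := h
      linarith

theorem wall_ssubset_blackHole (F : IsNullFrame p p' q q') :
    wall p p' ⊂ blackHole (wall p p') := by
  obtain ⟨x, hx, hx'⟩ := F.exists_mem_blackHole
  exact (Set.ssubset_iff_of_subset (subset_blackHole _)).mpr ⟨x, hx, hx'⟩

theorem blackHole_ssubset_univ (F : IsNullFrame p p' q q') :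
    blackHole (wall p p') ⊂ Set.univ := by
  obtain ⟨x, hx⟩ := F.exists_emb_p
  exact Set.ssubset_univ_iff.mpr fun h => F.notMem_blackHole hx (h ▸ Set.mem_univ x)

theorem horizon_nonempty (F : IsNullFrame p p' q q') : (horizon (wall p p')).Nonempty := by
  obtain ⟨x, hx⟩ := F.exists_emb_p
  have hx0 := F.notMem_blackHole hx
  -- At `t = 2` this null translation takes `p + p'` to `p - (q + q')`, which is on the wall. With
  -- an empty frontier, the preimage of the black hole would be a clopen subset of `ℝ` containing
  -- `2` but not `0`.
  let γ : ℝ → AdS l := fun t => expSO (t • wedge p' (q + q')) • x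
  have hγ : Continuous γ := continuous_expSO_smul _ _
  have hγ0 : γ 0 = x := by simp only [γ, zero_smul, expSO_zero, one_smul]
  have hγ2 : γ 2 ∈ blackHole (wall p p') := by
    refine subset_blackHole _ (Or.inl ?_)
    have hw : (2 : ℝ) • wedge p' (q + q') = wedge p' ((2 : ℝ) • (q + q')) := by
      refine so2_ext fun u => ?_
      change ((2 : ℝ) • (wedge _ _).1) *ᵥ u = _
      simp only [smul_mulVec, wedge_mulVec, form_smul_left]
      module
    change form l p (emb (expSO ((2 : ℝ) • wedge p' (q + q')) • x)) = 0
    rw [emb_smul, hw, expSO_wedge_mulVec F.pp' (by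
      rw [form_smul_right, form_add_right, F.p'_q, F.p'_q']; norm_num), hx]
    simp only [form_add_right, form_sub_right, form_smul_right, form_smul_left, form_add_left,
      F.pp, F.pp', F.p_p', F.p_q, F.p_q', F.qq, F.qq', F.q_q', form_comm q' q, form_comm p' p,
      form_comm q p, form_comm q p', form_comm q' p, form_comm q' p', F.p'_q, F.p'_q']
    norm_num
  by_contra hne
  rw [Set.not_nonempty_iff_eq_empty] at hne
  have hclopen : IsClopen (blackHole (wall p p')) := isClopen_iff_frontier_eq_empty.mpr hne
  have h1 := (hclopen.preimage hγ)
  rcases isClopen_iff.mp h1 with h | h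
  · have h2 : (2 : ℝ) ∈ γ ⁻¹' blackHole (wall p p') := hγ2
    rw [h] at h2
    exact h2
  · have h2 : (0 : ℝ) ∈ γ ⁻¹' blackHole (wall p p') := h ▸ Set.mem_univ _
    exact hx0 (hγ0 ▸ h2)

end IsNullFrame

end

section

variable {l : ℕ}

/-! ### Complex eigenvalues of real matrices -/

section Spectrum

variable {n : Type*} [Fintype n]

/-- The complex number `μ` is an eigenvalue of the real matrix `H`. -/
def IsEigenvalue (H : Matrix n n ℝ) (μ : ℂ) : Prop :=
  ∃ v : n → ℂ, v ≠ 0 ∧ H.map Complex.ofReal *ᵥ v = μ • v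

theorem exists_mulVec_of_mem_spectrum [DecidableEq n] {A : Matrix n n ℂ} {μ : ℂ} (h : μ ∈ spectrum ℂ A) :
    ∃ v : n → ℂ, v ≠ 0 ∧ A *ᵥ v = μ • v := by
  rw [← Matrix.spectrum_toLin'] at h
  obtain ⟨v, hv⟩ := (Module.End.hasEigenvalue_iff_mem_spectrum.mpr h).exists_hasEigenvector
  exact ⟨v, hv.2, by simpa using hv.apply_eq_smul⟩

theorem isEigenvalue_of_mem_roots [DecidableEq n] {H : Matrix n n ℝ} {μ : ℂ}
    (h : μ ∈ (H.map Complex.ofReal).charpoly.roots) : IsEigenvalue H μ :=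
  exists_mulVec_of_mem_spectrum
    (Matrix.mem_spectrum_iff_isRoot_charpoly.mpr (Polynomial.isRoot_of_mem_roots h))

theorem IsEigenvalue.conj {H : Matrix n n ℝ} {μ : ℂ} (h : IsEigenvalue H μ) :
    IsEigenvalue H (starRingEnd ℂ μ) := by
  obtain ⟨v, hv, hvμ⟩ := h
  refine ⟨star v, by simpa using hv, ?_⟩
  funext i
  have := congrArg (starRingEnd ℂ) (congrFun hvμ i)
  simpa [mulVec, dotProduct] using this

theorem trace_map_ofReal (H : Matrix n n ℝ) : (H.map Complex.ofReal).trace = (H.trace : ℂ) := by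
  simp [Matrix.trace]

/-- The trace of `H²` is the sum of the squares of the complex eigenvalues. The factor `c` serves
both real spectra (`c = 1`) and purely imaginary ones (`c = -1`). -/
theorem mul_trace_sq_nonneg [DecidableEq n] {H : Matrix n n ℝ} (c : ℝ)
    (h : ∀ μ, IsEigenvalue H μ → 0 ≤ c * (μ ^ 2).re) : 0 ≤ c * (H * H).trace := by
  have h1 := Matrix.trace_eq_sum_roots_charpoly ((H * H).map Complex.ofReal)
  rw [trace_map_ofReal] at h1
  have h2 := congrArg Complex.reAddGroupHom h1
  rw [AddMonoidHom.map_multiset_sum] at h2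
  have h3 : (H * H).trace = _ := h2
  rw [h3, ← Multiset.sum_map_mul_left]
  refine Multiset.sum_nonneg fun x hx => ?_
  obtain ⟨ν, hν, rfl⟩ := Multiset.mem_map.mp hx
  have hsp := Matrix.mem_spectrum_iff_isRoot_charpoly.mpr (Polynomial.isRoot_of_mem_roots hν)
  have hsq : (H * H).map Complex.ofReal = (H.map Complex.ofReal) ^ 2 := by
    rw [pow_two]
    exact Matrix.map_mul (f := Complex.ofRealHom)
  rw [hsq, spectrum.map_pow_of_pos _ (by norm_num)] at hsp
  obtain ⟨μ, hμ, rfl⟩ := hsp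
  exact h μ (exists_mulVec_of_mem_spectrum hμ)

theorem trace_sq_nonneg [DecidableEq n] {H : Matrix n n ℝ}
    (h : ∀ μ, IsEigenvalue H μ → μ.im = 0) : 0 ≤ (H * H).trace := by
  have := mul_trace_sq_nonneg (H := H) 1 fun μ hμ => by
    have h0 := h μ hμ
    simp only [pow_two, Complex.mul_re, h0]
    nlinarith
  linarith

theorem trace_eq_of_re_eq [DecidableEq n] {H : Matrix n n ℝ} {r : ℝ} (h : ∀ μ, IsEigenvalue H μ → μ.re = r) :
    H.trace = Fintype.card n * r := by
  have h1 := Matrix.trace_eq_sum_roots_charpoly (H.map Complex.ofReal)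
  rw [trace_map_ofReal] at h1
  have h2 := congrArg Complex.reAddGroupHom h1
  rw [AddMonoidHom.map_multiset_sum] at h2
  have h3 : H.trace = _ := h2
  rw [h3, Multiset.map_congr rfl (fun μ hμ => show Complex.reAddGroupHom μ = r from
    h μ (isEigenvalue_of_mem_roots hμ)), Multiset.map_const', Multiset.sum_replicate, nsmul_eq_mul,
    ← (IsAlgClosed.splits (H.map Complex.ofReal).charpoly).natDegree_eq_card_roots,
    Matrix.charpoly_natDegree_eq_dim]

theorem mulVec_re {H : Matrix n n ℝ} {v : n → ℂ} {μ : ℂ}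
    (h : H.map Complex.ofReal *ᵥ v = μ • v) :
    H *ᵥ (fun i => (v i).re) = μ.re • (fun i => (v i).re) - μ.im • fun i => (v i).im := by
  funext i
  have := congrArg Complex.re (congrFun h i)
  simpa [mulVec, dotProduct] using this

theorem mulVec_im {H : Matrix n n ℝ} {v : n → ℂ} {μ : ℂ}
    (h : H.map Complex.ofReal *ᵥ v = μ • v) :
    H *ᵥ (fun i => (v i).im) = μ.im • (fun i => (v i).re) + μ.re • fun i => (v i).im := by
  funext i
  have := congrArg Complex.im (congrFun h i)
  simp [mulVec, dotProduct] at this ⊢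
  linarith

theorem IsEigenvalue.exists_real {H : Matrix n n ℝ} {μ : ℂ} (h : IsEigenvalue H μ)
    (him : μ.im = 0) : ∃ v : n → ℝ, v ≠ 0 ∧ H *ᵥ v = μ.re • v := by
  obtain ⟨v, hv, hvμ⟩ := h
  have h1 := mulVec_re hvμ
  have h2 := mulVec_im hvμ
  rw [him, zero_smul, sub_zero] at h1
  rw [him, zero_smul, zero_add] at h2
  by_cases h0 : (fun i => (v i).re) = 0
  · refine ⟨_, fun h0' => hv ?_, h2⟩
    funext i
    exact Complex.ext (congrFun h0 i) (congrFun h0' i)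
  · exact ⟨_, h0, h1⟩

/-- A real matrix with real and semisimple eigenvalues is diagonalisable. -/
theorem iSup_eigenspace_eq_top [DecidableEq n] {H : Matrix n n ℝ} (hreal : ∀ μ, IsEigenvalue H μ → μ.im = 0)
    (hss : ∀ (c : ℝ) (v : n → ℝ), H *ᵥ (H *ᵥ v - c • v) = c • (H *ᵥ v - c • v) →
      H *ᵥ v = c • v) :
    ⨆ c : ℝ, Module.End.eigenspace (Matrix.toLin' H) c = ⊤ := by
  -- On the span of the eigenvectors, `H - c` is invertible away from its kernel, so every vector
  -- there is in the image of `H - c` up to a `c`-eigenvector.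
  have hdiv (c : ℝ) (u : n → ℝ) (hu : u ∈ ⨆ c : ℝ, Module.End.eigenspace (Matrix.toLin' H) c) :
      ∃ s ∈ ⨆ c : ℝ, Module.End.eigenspace (Matrix.toLin' H) c, ∃ t : n → ℝ,
        H *ᵥ t = c • t ∧ u = (H *ᵥ s - c • s) + t := by
    induction hu using Submodule.iSup_induction' with
    | mem d x hx =>
      have hx' : H *ᵥ x = d • x := by
        have := Module.End.mem_eigenspace_iff.mp hx
        simpa using this
      by_cases hdc : d = c
      · exact ⟨0, zero_mem _, x, hdc ▸ hx', by simp⟩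
      · have hdc' : d - c ≠ 0 := sub_ne_zero.mpr hdc
        refine ⟨(d - c)⁻¹ • x, Submodule.smul_mem _ _ (Submodule.mem_iSup_of_mem d hx), 0,
          by simp, ?_⟩
        rw [mulVec_smul, hx', add_zero]
        have : (d - c)⁻¹ • d • x - c • (d - c)⁻¹ • x = ((d - c)⁻¹ * (d - c)) • x := by module
        rw [this, inv_mul_cancel₀ hdc', one_smul]
    | zero => exact ⟨0, zero_mem _, 0, by simp, by simp⟩
    | add x y _ _ ihx ihy =>
      obtain ⟨s, hs, t, ht, rfl⟩ := ihx
      obtain ⟨s', hs', t', ht', rfl⟩ := ihy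
      refine ⟨s + s', add_mem hs hs', t + t', ?_, ?_⟩
      · rw [mulVec_add, ht, ht', smul_add]
      · rw [mulVec_add]
        module
  -- Write `(H - c)v = (H - c)s + t`. Then `(H - c)²(v - s) = 0`, and semisimplicity makes `v - s`
  -- an eigenvector. Cayley–Hamilton starts the descent, one root of the characteristic polynomial
  -- at a time.
  have hstep (c : ℝ) (v : n → ℝ)
      (hv : H *ᵥ v - c • v ∈ ⨆ c : ℝ, Module.End.eigenspace (Matrix.toLin' H) c) :
      v ∈ ⨆ c : ℝ, Module.End.eigenspace (Matrix.toLin' H) c := by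
    obtain ⟨s, hs, t, ht, heq⟩ := hdiv c _ hv
    have h1 : H *ᵥ (v - s) = c • (v - s) := by
      apply hss
      have : H *ᵥ (v - s) - c • (v - s) = t := by
        rw [mulVec_sub, smul_sub, sub_sub_sub_comm, heq]
        abel
      rw [this, ht]
    have h2 : v - s ∈ ⨆ c : ℝ, Module.End.eigenspace (Matrix.toLin' H) c := by
      refine Submodule.mem_iSup_of_mem c (Module.End.mem_eigenspace_iff.mpr ?_)
      rw [Matrix.toLin'_apply, h1]
    simpa using add_mem h2 hs
  have hsplit : H.charpoly.Splits := by
    refine Polynomial.Splits.of_splits_map Complex.ofRealHom (IsAlgClosed.splits _) ?_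
    intro μ hμ
    have h1 : H.charpoly.map Complex.ofRealHom = (H.map Complex.ofReal).charpoly :=
      (Matrix.charpoly_map H Complex.ofRealHom).symm
    rw [h1] at hμ
    exact ⟨μ.re, Complex.ext rfl (hreal μ (isEigenvalue_of_mem_roots hμ)).symm⟩
  have hprod (s : Multiset ℝ) (v : n → ℝ)
      (hv : (Polynomial.aeval H (s.map fun c => Polynomial.X - Polynomial.C c).prod) *ᵥ v = 0) :
      v ∈ ⨆ c : ℝ, Module.End.eigenspace (Matrix.toLin' H) c := by
    induction s using Multiset.induction generalizing v with
    | empty =>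
      simp at hv
      rw [hv]
      exact zero_mem _
    | cons c s ih =>
      refine hstep c v (ih _ ?_)
      rw [Multiset.map_cons, Multiset.prod_cons, mul_comm, map_mul, ← mulVec_mulVec] at hv
      rw [← hv]
      congr 1
      simp [sub_mulVec, Matrix.algebraMap_eq_diagonal]
      ext i
      simp [mulVec_diagonal]
  refine eq_top_iff.mpr fun v _ => hprod H.charpoly.roots v ?_
  rw [← hsplit.eq_prod_roots_of_monic H.charpoly_monic, Matrix.aeval_self_charpoly, zero_mulVec]

end Spectrum

end

section

variable {l : ℕ} {θ : so2 l ≃ₗ⁅ℝ⁆ so2 l} {H : so2 l}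

/-! ### The `-1`-eigenspace of a Cartan involution -/

/-- Invariance of the Killing form and `θ H = -H` combine to make `ad H` symmetric for the inner
product `-B(·, θ·)`. -/
theorem killingForm_lie_symm (hH : θ H = -H) (Z Z' : so2 l) :
    killingForm ℝ (so2 l) ⁅H, Z⁆ (θ Z') = killingForm ℝ (so2 l) Z (θ ⁅H, Z'⁆) := by
  have h := LieModule.traceForm_apply_lie_apply' ℝ (so2 l) (so2 l) H Z (θ Z')
  rw [LieEquiv.map_lie, hH, neg_lie, map_neg]
  exact h

theorem trace_sq_pos (hθ : IsCartanInvolution θ) (hH : θ H = -H) (h0 : H ≠ 0) :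
    0 < (H.1 * H.1).trace := by
  have h := hθ.pos H h0
  rw [hH, map_neg, neg_neg, killingForm_so2] at h
  exact pos_of_mul_pos_right h (Nat.cast_nonneg _)

theorem trace_sq_neg (hθ : IsCartanInvolution θ) (hH : θ H = H) (h0 : H ≠ 0) :
    (H.1 * H.1).trace < 0 := by
  have h := hθ.pos H h0
  rw [hH, killingForm_so2, ← mul_neg] at h
  exact neg_pos.mp (pos_of_mul_pos_right h (Nat.cast_nonneg _))

theorem eq_zero_of_trace_sq_nonpos (hθ : IsCartanInvolution θ) (hH : θ H = -H)
    (h : (H.1 * H.1).trace ≤ 0) : H = 0 := by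
  by_contra h0
  exact (trace_sq_pos hθ hH h0).not_ge h

theorem eq_zero_of_killingForm (hθ : IsCartanInvolution θ) {Z : so2 l}
    (h : killingForm ℝ (so2 l) Z (θ Z) = 0) : Z = 0 := by
  by_contra h0
  have := hθ.pos Z h0
  rw [h] at this
  simp at this

theorem exists_form_eq_apply (j : Idx l) : ∃ x : Ambient l, ∀ v, form l v x = v j := by
  refine ⟨eta l *ᵥ Pi.single j 1, fun v => ?_⟩
  rw [form, mulVec_mulVec, eta_mul_self, one_mulVec, dotProduct_single, mul_one]

theorem wedge_eq_zero {v w : Ambient l} (h : wedge v w = 0) (i j : Idx l) :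
    v i * w j = w i * v j := by
  obtain ⟨x, hx⟩ := exists_form_eq_apply j
  have h1 : (wedge v w).1 *ᵥ x = 0 := by
    rw [h]
    exact zero_mulVec _
  rw [wedge_mulVec, hx, hx] at h1
  have := congrFun h1 i
  simp at this
  linarith

/-- Distinct complex eigenvalues of an element of `𝔭` have opposite imaginary parts. -/
theorem im_add_eq_zero (hθ : IsCartanInvolution θ) (hH : θ H = -H) {μ ν : ℂ}
    (hμ : IsEigenvalue H.1 μ) (hν : IsEigenvalue H.1 ν) (hne : μ ≠ ν) : μ.im + ν.im = 0 := by
  obtain ⟨v, hv0, hv⟩ := hμ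
  obtain ⟨w, hw0, hw⟩ := hν
  obtain ⟨a, ha⟩ : ∃ a : Ambient l, a = fun i => (v i).re := ⟨_, rfl⟩
  obtain ⟨b, hb⟩ : ∃ b : Ambient l, b = fun i => (v i).im := ⟨_, rfl⟩
  obtain ⟨c, hc⟩ : ∃ c : Ambient l, c = fun i => (w i).re := ⟨_, rfl⟩
  obtain ⟨d, hd⟩ : ∃ d : Ambient l, d = fun i => (w i).im := ⟨_, rfl⟩
  have ha' : H.1 *ᵥ a = μ.re • a - μ.im • b := by rw [ha, hb]; exact mulVec_re hv
  have hb' : H.1 *ᵥ b = μ.im • a + μ.re • b := by rw [ha, hb]; exact mulVec_im hv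
  have hc' : H.1 *ᵥ c = ν.re • c - ν.im • d := by rw [hc, hd]; exact mulVec_re hw
  have hd' : H.1 *ᵥ d = ν.im • c + ν.re • d := by rw [hc, hd]; exact mulVec_im hw
  -- `M + iN` is the complex bivector `v ∧ w`, multiplied by `μ + ν` under `ad H`; `h1` and `h2` are
  -- the real and imaginary parts of this relation.
  obtain ⟨M, hM⟩ : ∃ M, M = wedge a c - wedge b d := ⟨_, rfl⟩
  obtain ⟨N, hN⟩ : ∃ N, N = wedge a d + wedge b c := ⟨_, rfl⟩
  have hMu (u : Ambient l) : M.1 *ᵥ u = (form l c u • a - form l a u • c)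
      - (form l d u • b - form l b u • d) := by
    rw [hM, ← wedge_mulVec, ← wedge_mulVec, ← sub_mulVec]
    rfl
  have hNu (u : Ambient l) : N.1 *ᵥ u = (form l d u • a - form l a u • d)
      + (form l c u • b - form l b u • c) := by
    rw [hN, ← wedge_mulVec, ← wedge_mulVec, ← add_mulVec]
    rfl
  have h1 : ⁅H, M⁆ = (μ.re + ν.re) • M - (μ.im + ν.im) • N := by
    refine so2_ext fun u => ?_
    change _ = ((μ.re + ν.re) • M.1 - (μ.im + ν.im) • N.1) *ᵥ u
    rw [lie_mulVec, sub_mulVec, smul_mulVec, smul_mulVec, hMu, hMu, hNu]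
    simp only [mulVec_sub, mulVec_smul, ha', hb', hc', hd']
    have hs (x : Ambient l) : form l x (H.1 *ᵥ u) = -form l (H.1 *ᵥ x) u := by
      rw [form_so2, neg_neg]
    simp only [hs, ha', hb', hc', hd', form_sub_left, form_add_left, form_smul_left]
    module
  have h2 : ⁅H, N⁆ = (μ.im + ν.im) • M + (μ.re + ν.re) • N := by
    refine so2_ext fun u => ?_
    change _ = ((μ.im + ν.im) • M.1 + (μ.re + ν.re) • N.1) *ᵥ u
    rw [lie_mulVec, add_mulVec, smul_mulVec, smul_mulVec, hNu, hNu, hMu]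
    simp only [mulVec_sub, mulVec_add, mulVec_smul, ha', hb', hc', hd']
    have hs (x : Ambient l) : form l x (H.1 *ᵥ u) = -form l (H.1 *ᵥ x) u := by
      rw [form_so2, neg_neg]
    simp only [hs, ha', hb', hc', hd', form_sub_left, form_add_left, form_smul_left]
    module
  have h3 := killingForm_lie_symm hH M N
  rw [h1, h2] at h3
  simp only [map_sub, map_add, map_smul, LinearMap.sub_apply, LinearMap.smul_apply, smul_eq_mul]
    at h3
  have h4 : (μ.im + ν.im) * (killingForm ℝ (so2 l) M (θ M) + killingForm ℝ (so2 l) N (θ N)) = 0 := by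
    linarith
  rcases mul_eq_zero.mp h4 with h | h
  · exact h
  exfalso
  have hpos (Z : so2 l) : killingForm ℝ (so2 l) Z (θ Z) ≤ 0 := by
    by_cases hZ : Z = 0
    · simp [hZ]
    · linarith [hθ.pos Z hZ]
  have hM0 : M = 0 := eq_zero_of_killingForm hθ (by linarith [hpos M, hpos N])
  have hN0 : N = 0 := eq_zero_of_killingForm hθ (by linarith [hpos M, hpos N])
  -- The vanishing of `M` and `N` says `v ∧ w = 0`. The eigenvectors are then proportional, against
  -- `μ ≠ ν`.
  have hvw (i j : Idx l) : v i * w j = w i * v j := by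
    obtain ⟨x, hx⟩ := exists_form_eq_apply j
    have e1 := hMu x
    have e2 := hNu x
    rw [hM0] at e1
    rw [hN0] at e2
    have e1' := congrFun (e1.symm.trans (zero_mulVec _)) i
    have e2' := congrFun (e2.symm.trans (zero_mulVec _)) i
    simp [hx, ha, hb, hc, hd] at e1' e2'
    apply Complex.ext
    · simp only [Complex.mul_re]
      linarith
    · simp only [Complex.mul_im]
      linarith
  obtain ⟨j, hj⟩ := Function.ne_iff.mp hw0
  have hj' : w j ≠ 0 := hj
  have hvk : v = (v j / w j) • w := by
    funext i
    rw [Pi.smul_apply, smul_eq_mul, div_mul_eq_mul_div, eq_div_iff hj', hvw, mul_comm]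
  have h5 : (μ - ν) • v = 0 := by
    rw [sub_smul, ← hv]
    conv_lhs => rw [hvk]
    rw [mulVec_smul, hw, smul_comm ν, sub_self]
  rcases smul_eq_zero.mp h5 with h | h
  · exact hne (sub_eq_zero.mp h)
  · exact hv0 h

theorem IsEigenvalue.ne_zero_of_ne {μ : ℂ} (h : IsEigenvalue H.1 μ) (hμ : μ ≠ 0) : H ≠ 0 := by
  rintro rfl
  obtain ⟨v, hv, hvμ⟩ := h
  have h0 : ((0 : so2 l).1).map Complex.ofReal = 0 := by
    ext i j
    simp
  rw [h0, zero_mulVec] at hvμ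
  exact hv ((smul_eq_zero.mp hvμ.symm).resolve_left hμ)

theorem re_eq_zero_of_forall {r : ℝ} (h : ∀ μ, IsEigenvalue H.1 μ → μ.re = r) : r = 0 := by
  have h1 := trace_eq_of_re_eq h
  rw [trace_so2] at h1
  refine (mul_eq_zero.mp h1.symm).resolve_left ?_
  simp
  positivity

/-- The elements of `𝔭` have real eigenvalues. -/
theorem im_eq_zero (hθ : IsCartanInvolution θ) (hH : θ H = -H) {μ : ℂ}
    (hμ : IsEigenvalue H.1 μ) : μ.im = 0 := by
  by_contra him
  -- An eigenvalue different from `μ` and from its conjugate would have imaginary part both `-im μ`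
  -- and `im μ`. So all real parts agree, and tracelessness makes them zero; then `tr(H²) ≤ 0`,
  -- which forces `H = 0`.
  have hall (ν : ℂ) (hν : IsEigenvalue H.1 ν) : ν.re = μ.re := by
    by_cases h1 : μ = ν
    · rw [h1]
    by_cases h2 : (starRingEnd ℂ) μ = ν
    · rw [← h2, Complex.conj_re]
    have e1 := im_add_eq_zero hθ hH hμ hν h1
    have e2 := im_add_eq_zero hθ hH hμ.conj hν h2
    rw [Complex.conj_im] at e2
    exact absurd (by linarith) him
  have hre := re_eq_zero_of_forall hall
  have h0 : H = 0 := by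
    refine eq_zero_of_trace_sq_nonpos hθ hH ?_
    have := mul_trace_sq_nonneg (H := H.1) (-1) fun ν hν => by
      have e := hall ν hν
      rw [hre] at e
      simp only [pow_two, Complex.mul_re, e]
      nlinarith
    linarith
  exact hμ.ne_zero_of_ne (fun h => him (by rw [h, Complex.zero_im])) h0

theorem isEigenvalue_ofReal {c : ℝ} {v : Ambient l} (hv : v ≠ 0) (h : H.1 *ᵥ v = c • v) :
    IsEigenvalue H.1 c := by
  refine ⟨fun i => (v i : ℂ), fun h0 => hv ?_, ?_⟩
  · funext i
    exact Complex.ofReal_eq_zero.mp (congrFun h0 i)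
  · funext i
    have := congrArg Complex.ofReal (congrFun h i)
    simpa [mulVec, dotProduct] using this

/-- The elements of `𝔭` have semisimple eigenvalues. -/
theorem mulVec_eq_smul (hθ : IsCartanInvolution θ) (hH : θ H = -H) (c : ℝ) (v : Ambient l)
    (h : H.1 *ᵥ (H.1 *ᵥ v - c • v) = c • (H.1 *ᵥ v - c • v)) : H.1 *ᵥ v = c • v := by
  by_contra hne
  obtain ⟨w, hw⟩ : ∃ w, w = H.1 *ᵥ v - c • v := ⟨_, rfl⟩
  have hw0 : w ≠ 0 := by rw [hw]; exact sub_ne_zero.mpr hne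
  rw [← hw] at h
  have hcw := isEigenvalue_ofReal hw0 h
  by_cases hall : ∀ ν, IsEigenvalue H.1 ν → ν.re = c
  · have hc := re_eq_zero_of_forall hall
    have h0 : H = 0 := by
      refine eq_zero_of_trace_sq_nonpos hθ hH ?_
      have := mul_trace_sq_nonneg (H := H.1) (-1) fun ν hν => by
        have e := hall ν hν
        rw [hc] at e
        simp only [pow_two, Complex.mul_re, e]
        nlinarith
      linarith
    apply hw0
    rw [hw, hc, h0, zero_smul, sub_zero]
    exact zero_mulVec _
  · push Not at hall
    obtain ⟨ν, hν, hνc⟩ := hall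
    obtain ⟨u, hu0, hu⟩ := hν.exists_real (im_eq_zero hθ hH hν)
    obtain ⟨d, hd⟩ : ∃ d, d = ν.re := ⟨_, rfl⟩
    rw [← hd] at hu hνc
    have hv : H.1 *ᵥ v = c • v + w := by rw [hw]; abel
    -- An eigenvector `u` for another eigenvalue `d` turns the Jordan block `v, w` of `H` into a
    -- Jordan block `u ∧ v, u ∧ w` of the symmetric operator `ad H`. Hence `u ∧ w = 0`, impossible
    -- for different eigenvalues.
    have h1 : ⁅H, wedge u v⁆ = (d + c) • wedge u v + wedge u w := by
      rw [lie_wedge, hu, hv]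
      refine so2_ext fun x => ?_
      change ((wedge _ _).1 + (wedge _ _).1) *ᵥ x = ((d + c) • (wedge _ _).1 + (wedge _ _).1) *ᵥ x
      simp only [add_mulVec, smul_mulVec, wedge_mulVec, form_add_left, form_smul_left]
      module
    have h2 : ⁅H, wedge u w⁆ = (d + c) • wedge u w := by
      rw [lie_wedge, hu, h]
      refine so2_ext fun x => ?_
      change ((wedge _ _).1 + (wedge _ _).1) *ᵥ x = ((d + c) • (wedge _ _).1) *ᵥ x
      simp only [add_mulVec, smul_mulVec, wedge_mulVec, form_smul_left]
      module
    have h3 := killingForm_lie_symm hH (wedge u v) (wedge u w)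
    rw [h1, h2] at h3
    simp only [map_add, map_smul, LinearMap.add_apply, LinearMap.smul_apply, smul_eq_mul] at h3
    have h4 : wedge u w = 0 := eq_zero_of_killingForm hθ (by linarith)
    obtain ⟨j, hj⟩ := Function.ne_iff.mp hw0
    have hj' : w j ≠ 0 := hj
    have huk : u = (u j / w j) • w := by
      funext i
      rw [Pi.smul_apply, smul_eq_mul, div_mul_eq_mul_div, eq_div_iff hj', wedge_eq_zero h4, mul_comm]
    have h5 : (d - c) • u = 0 := by
      rw [sub_smul, ← hu]
      conv_lhs => rw [huk]
      rw [mulVec_smul, h, smul_comm c, sub_self]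
    rcases smul_eq_zero.mp h5 with h | h
    · exact hνc (sub_eq_zero.mp h)
    · exact hu0 h

theorem iSup_eigenspace_eq_top_of_neg (hθ : IsCartanInvolution θ) (hH : θ H = -H) :
    ⨆ c : ℝ, Module.End.eigenspace (Matrix.toLin' H.1) c = ⊤ :=
  iSup_eigenspace_eq_top (fun _ hμ => im_eq_zero hθ hH hμ) (mulVec_eq_smul hθ hH)

end

section

variable {l : ℕ} {θ : so2 l ≃ₗ⁅ℝ⁆ so2 l} {𝔞 : Submodule ℝ (so2 l)}

/-! ### Weights of a maximal abelian subspace of `𝔭` -/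

/-- The joint eigenspaces of `𝔞` in the ambient space. -/
def weightSpace (𝔞 : Submodule ℝ (so2 l)) (χ : 𝔞 → ℝ) : Submodule ℝ (Ambient l) where
  carrier := {v | ∀ H : 𝔞, H.1.1 *ᵥ v = χ H • v}
  add_mem' := by
    intro v w hv hw H
    rw [mulVec_add, hv H, hw H, smul_add]
  zero_mem' := by
    intro H
    rw [mulVec_zero, smul_zero]
  smul_mem' := by
    intro r v hv H
    rw [mulVec_smul, hv H, smul_comm]

theorem mulVec_comm_of_lie_eq_zero {X Y : so2 l} (h : ⁅X, Y⁆ = 0) (v : Ambient l) :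
    X.1 *ᵥ (Y.1 *ᵥ v) = Y.1 *ᵥ (X.1 *ᵥ v) := by
  rw [← sub_eq_zero, ← lie_mulVec, h]
  exact zero_mulVec _

theorem maxGenEigenspace_le (hθ : IsCartanInvolution θ) {H : so2 l} (hH : θ H = -H) (c : ℝ) :
    Module.End.maxGenEigenspace (Matrix.toLin' H.1) c ≤
      Module.End.eigenspace (Matrix.toLin' H.1) c := by
  intro v hv
  obtain ⟨k, hk⟩ := (Module.End.mem_maxGenEigenspace _ _ _).mp hv
  obtain ⟨T, hT⟩ : ∃ T, T = Matrix.toLin' H.1 - c • 1 := ⟨_, rfl⟩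
  have hTv (u : Ambient l) : T u = H.1 *ᵥ u - c • u := by simp [hT]
  rw [← hT] at hk
  have key : T v = 0 := by
    induction k with
    | zero =>
      have : v = 0 := by simpa using hk
      rw [this, map_zero]
    | succ k ih =>
      rcases k with _ | k
      · simpa using hk
      · refine ih ?_
        rw [pow_succ', pow_succ', Module.End.mul_apply, Module.End.mul_apply] at hk
        rw [pow_succ', Module.End.mul_apply]
        have := mulVec_eq_smul hθ hH c ((T ^ k) v) (by
          rw [← sub_eq_zero, ← hTv, ← hTv]
          exact hk)
        rw [hTv, this, sub_self]
  rw [hTv, sub_eq_zero] at key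
  exact Module.End.mem_eigenspace_iff.mpr (by rw [Matrix.toLin'_apply, key])

theorem iSup_weightSpace (hθ : IsCartanInvolution θ) (h𝔞 : IsAbelianIn θ 𝔞) :
    ⨆ χ, weightSpace 𝔞 χ = ⊤ := by
  have h := Module.End.iSup_iInf_maxGenEigenspace_eq_top_of_iSup_maxGenEigenspace_eq_top_of_commute
    (fun H : 𝔞 => Matrix.toLin' H.1.1) (fun H H' _ => by
      refine LinearMap.ext fun v => ?_
      change Matrix.toLin' H.1.1 (Matrix.toLin' H'.1.1 v) =
        Matrix.toLin' H'.1.1 (Matrix.toLin' H.1.1 v)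
      simp only [Matrix.toLin'_apply]
      exact mulVec_comm_of_lie_eq_zero (h𝔞.abelian _ H.2 _ H'.2) v) (fun H => by
      refine eq_top_iff.mpr ?_
      rw [← iSup_eigenspace_eq_top_of_neg hθ (h𝔞.le _ H.2)]
      exact iSup_mono fun c => Module.End.eigenspace_le_maxGenEigenspace)
  refine eq_top_iff.mpr (h ▸ iSup_mono fun χ v hv H => ?_)
  have h1 := maxGenEigenspace_le hθ (h𝔞.le _ H.2) (χ H) ((Submodule.mem_iInf _).mp hv H)
  have h2 := Module.End.mem_eigenspace_iff.mp h1
  rwa [Matrix.toLin'_apply] at h2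

/-- `A` preserves the eigenspaces of `Y - A`, so there is a common eigenvector. On it `A` is real,
and `Y` takes one of the real values `0, c, -c`. -/
theorem isEigenvalue_im_eq_zero_of_sub {Y A : so2 l} {c : ℝ} (hθ : IsCartanInvolution θ)
    (hA : θ A = -A) (hYA : ⁅A, Y⁆ = 0)
    (hY : ∀ v : Ambient l, Y.1 *ᵥ (Y.1 *ᵥ (Y.1 *ᵥ v)) = c ^ 2 • (Y.1 *ᵥ v)) {μ : ℂ}
    (hμ : IsEigenvalue (Y - A : so2 l).1 μ) : μ.im = 0 := by
  obtain ⟨v, hv0, hv⟩ := hμ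
  obtain ⟨B, hB⟩ : ∃ B, B = A.1.map Complex.ofReal := ⟨_, rfl⟩
  obtain ⟨Z, hZ⟩ : ∃ Z, Z = Y.1.map Complex.ofReal := ⟨_, rfl⟩
  have hmul (M N : Matrix (Idx l) (Idx l) ℝ) :
      (M * N).map Complex.ofReal = M.map Complex.ofReal * N.map Complex.ofReal :=
    Matrix.map_mul (f := Complex.ofRealHom)
  have hsub : (Y - A : so2 l).1.map Complex.ofReal = Z - B := by
    rw [hZ, hB]
    ext i j
    exact Complex.ofReal_sub _ _
  have hBZ : B * Z = Z * B := by
    have : A.1 * Y.1 = Y.1 * A.1 := by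
      refine Matrix.ext_of_mulVec_single fun i => ?_
      rw [← mulVec_mulVec, ← mulVec_mulVec, mulVec_comm_of_lie_eq_zero hYA]
    rw [hB, hZ, ← hmul, ← hmul, this]
  have hZ3 : Z * (Z * Z) = ((c : ℂ) ^ 2) • Z := by
    have : Y.1 * (Y.1 * Y.1) = c ^ 2 • Y.1 := by
      refine Matrix.ext_of_mulVec_single fun i => ?_
      rw [← mulVec_mulVec, ← mulVec_mulVec, hY, smul_mulVec]
    rw [hZ, ← hmul, ← hmul, this]
    ext i j
    simp
  rw [hsub] at hv
  let E := Module.End.eigenspace (Matrix.toLin' (Z - B)) μ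
  have hmap : ∀ u ∈ E, Matrix.toLin' B u ∈ E := by
    intro u hu
    have hu' := Module.End.mem_eigenspace_iff.mp hu
    rw [Matrix.toLin'_apply] at hu'
    refine Module.End.mem_eigenspace_iff.mpr ?_
    rw [Matrix.toLin'_apply, Matrix.toLin'_apply, mulVec_mulVec, sub_mul, ← hBZ, ← mul_sub,
      ← mulVec_mulVec, hu', mulVec_smul]
  have hvE : v ∈ E := Module.End.mem_eigenspace_iff.mpr (by rw [Matrix.toLin'_apply, hv])
  have : Nontrivial E := ⟨⟨⟨v, hvE⟩, 0, fun h => hv0 (congrArg Subtype.val h)⟩⟩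
  obtain ⟨ν, hν⟩ := Module.End.exists_eigenvalue ((Matrix.toLin' B).restrict hmap)
  obtain ⟨⟨u, huE⟩, hu⟩ := hν.exists_hasEigenvector
  have hu0 : u ≠ 0 := fun h => hu.2 (Subtype.ext h)
  have huν : B *ᵥ u = ν • u := by
    have := congrArg Subtype.val hu.apply_eq_smul
    simpa using this
  have huμ : (Z - B) *ᵥ u = μ • u := by
    have := Module.End.mem_eigenspace_iff.mp huE
    rwa [Matrix.toLin'_apply] at this
  have hνim : ν.im = 0 := im_eq_zero hθ hA ⟨u, hu0, by rw [← hB]; exact huν⟩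
  have huZ : Z *ᵥ u = (μ + ν) • u := by
    have : Z = (Z - B) + B := by abel
    rw [this, add_mulVec, huμ, huν, add_smul]
  have h3 := congrArg (· *ᵥ u) hZ3
  simp only [← mulVec_mulVec, smul_mulVec, huZ, mulVec_smul] at h3
  have h4 : ((μ + ν) * ((μ + ν - c) * (μ + ν + c))) • u = 0 := by
    rw [← sub_eq_zero] at h3
    rw [← h3]
    module
  have h5 := (smul_eq_zero.mp h4).resolve_right hu0
  have h6 : (μ + ν).im = 0 := by
    rcases mul_eq_zero.mp h5 with h | h
    · rw [h, Complex.zero_im]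
    · rcases mul_eq_zero.mp h with h | h
      · rw [sub_eq_zero.mp h, Complex.ofReal_im]
      · rw [eq_neg_of_add_eq_zero_left h, Complex.neg_im, Complex.ofReal_im, neg_zero]
  rw [Complex.add_im, hνim, add_zero] at h6
  exact h6

/-- The `𝔭`-part `A` of `Y` commutes with `𝔞`, so it lies in `𝔞` by maximality. The remainder `Y -
A` is fixed by `θ` and has real eigenvalues, so the trace of its square is non-negative. The trace
form is negative definite on the fixed space, hence `Y = A`. -/
theorem mem_of_commute (hθ : IsCartanInvolution θ) (h𝔞 : IsMaximalAbelianIn θ 𝔞) {Y : so2 l} {c : ℝ}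
    (hY𝔞 : ∀ H ∈ 𝔞, ⁅H, Y⁆ = 0)
    (hY : ∀ v : Ambient l, Y.1 *ᵥ (Y.1 *ᵥ (Y.1 *ᵥ v)) = c ^ 2 • (Y.1 *ᵥ v)) : Y ∈ 𝔞 := by
  obtain ⟨A, hA⟩ : ∃ A, A = (2⁻¹ : ℝ) • (Y - θ Y) := ⟨_, rfl⟩
  have hθA : θ A = -A := by
    rw [hA, map_smul, map_sub, hθ.involutive]
    module
  have hA𝔞 (H : so2 l) (hH : H ∈ 𝔞) : ⁅H, A⁆ = 0 := by
    have h1 : ⁅H, θ Y⁆ = 0 := by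
      have h2 : ⁅θ H, θ Y⁆ = 0 := by rw [← LieEquiv.map_lie, hY𝔞 H hH, map_zero]
      rwa [h𝔞.prop.le H hH, neg_lie, neg_eq_zero] at h2
    rw [hA, lie_smul, lie_sub, hY𝔞 H hH, h1, sub_zero, smul_zero]
  have hAmem : A ∈ 𝔞 := by
    have habel : IsAbelianIn θ (𝔞 ⊔ Submodule.span ℝ {A}) := by
      constructor
      · intro X hX
        obtain ⟨H, hH, Z, hZ, rfl⟩ := Submodule.mem_sup.mp hX
        obtain ⟨r, rfl⟩ := Submodule.mem_span_singleton.mp hZ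
        rw [map_add, map_smul, h𝔞.prop.le H hH, hθA, smul_neg, neg_add]
      · intro X hX X' hX'
        obtain ⟨H, hH, Z, hZ, rfl⟩ := Submodule.mem_sup.mp hX
        obtain ⟨r, rfl⟩ := Submodule.mem_span_singleton.mp hZ
        obtain ⟨H', hH', Z', hZ', rfl⟩ := Submodule.mem_sup.mp hX'
        obtain ⟨r', rfl⟩ := Submodule.mem_span_singleton.mp hZ'
        have h1 : ⁅A, H'⁆ = 0 := by rw [← lie_skew, hA𝔞 H' hH', neg_zero]
        simp only [add_lie, lie_add, smul_lie, lie_smul, hA𝔞 H hH, h1, lie_self,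
          h𝔞.prop.abelian H hH H' hH', smul_zero, add_zero]
    exact h𝔞.2 habel le_sup_left
      (Submodule.mem_sup_right (Submodule.mem_span_singleton_self A))
  have hK : θ (Y - A) = Y - A := by
    rw [map_sub, hθA, hA]
    module
  have htr := trace_sq_nonneg fun μ hμ =>
    isEigenvalue_im_eq_zero_of_sub hθ hθA (hY𝔞 A hAmem) hY hμ
  have h0 : Y - A = 0 := by
    by_contra h0
    exact (trace_sq_neg hθ hK h0).not_ge htr
  rw [sub_eq_zero.mp h0]
  exact hAmem

/-- The boost acts by `1/2` on `u`, by `-1/2` on `v` and by `0` on their orthogonal; this is the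
input of `mem_of_commute`. -/
theorem wedge_cube {u v : Ambient l} (hu : form l u u = 0) (hv : form l v v = 0)
    (huv : form l u v = 2⁻¹) (x : Ambient l) :
    (wedge u v).1 *ᵥ ((wedge u v).1 *ᵥ ((wedge u v).1 *ᵥ x)) =
      (2⁻¹ : ℝ) ^ 2 • ((wedge u v).1 *ᵥ x) := by
  simp only [wedge_mulVec, form_sub_right, form_smul_right, hu, hv, huv, form_comm v u]
  module

theorem form_eq_zero_of_weight {χ ψ : 𝔞 → ℝ} {v w : Ambient l} (hv : v ∈ weightSpace 𝔞 χ)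
    (hw : w ∈ weightSpace 𝔞 ψ) {H : 𝔞} (h : χ H + ψ H ≠ 0) : form l v w = 0 := by
  have h1 := form_so2 H.1 v w
  rw [hv H, hw H, form_smul_left, form_smul_right] at h1
  have h2 : (χ H + ψ H) * form l v w = 0 := by linarith
  exact (mul_eq_zero.mp h2).resolve_left h

/-- A hyperbolic pair in a subspace containing positive and negative vectors. -/
theorem exists_hyperbolic_pair {U : Submodule ℝ (Ambient l)} {f g : Ambient l} (hfU : f ∈ U)
    (hgU : g ∈ U) (hf : 0 < form l f f) (hg : form l g g < 0) :
    ∃ u ∈ U, ∃ v ∈ U, form l u u = 0 ∧ form l v v = 0 ∧ form l u v = 2⁻¹ := by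
  obtain ⟨a, ha⟩ : ∃ a, a = (√(form l f f))⁻¹ := ⟨_, rfl⟩
  have ha2 : a * a * form l f f = 1 := by
    rw [ha, ← mul_inv, Real.mul_self_sqrt hf.le, inv_mul_cancel₀ hf.ne']
  obtain ⟨h, hh⟩ : ∃ h, h = g - (form l g f / form l f f) • f := ⟨_, rfl⟩
  have hhU : h ∈ U := hh ▸ sub_mem hgU (U.smul_mem _ hfU)
  have hhf : form l h f = 0 := by
    rw [hh, form_sub_left, form_smul_left]
    field_simp
    ring
  have hhh : form l h h < 0 := by
    have : form l h h = form l g g - (form l g f) ^ 2 / form l f f := by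
      simp only [hh, form_sub_left, form_sub_right, form_smul_left, form_smul_right, form_comm f g]
      field_simp
      ring
    rw [this]
    have : 0 ≤ (form l g f) ^ 2 / form l f f := by positivity
    linarith
  obtain ⟨b, hb⟩ : ∃ b, b = (√(-form l h h))⁻¹ := ⟨_, rfl⟩
  have hb2 : b * b * form l h h = -1 := by
    rw [hb, ← mul_inv, Real.mul_self_sqrt (by linarith), inv_neg, neg_mul, inv_mul_cancel₀ hhh.ne]
  refine ⟨(2⁻¹ : ℝ) • (a • f + b • h), U.smul_mem _ (add_mem (U.smul_mem _ hfU) (U.smul_mem _ hhU)),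
    (2⁻¹ : ℝ) • (a • f - b • h), U.smul_mem _ (sub_mem (U.smul_mem _ hfU) (U.smul_mem _ hhU)),
    ?_, ?_, ?_⟩
  all_goals
    simp only [form_add_left, form_add_right, form_sub_left, form_sub_right, form_smul_left,
      form_smul_right, hhf, form_comm f h]
    linarith

/-- A hyperbolic pair of weight vectors in the image of an equivariant projection. -/
theorem exists_weight_pair (hθ : IsCartanInvolution θ) (h𝔞 : IsMaximalAbelianIn θ 𝔞)
    (π : Ambient l →ₗ[ℝ] Ambient l) (hπ : ∀ v w, form l (π v) w = form l v (π w))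
    (hππ : ∀ v, π (π v) = π v) (hπ𝔞 : ∀ H ∈ 𝔞, ∀ v, H.1 *ᵥ π v = π (H.1 *ᵥ v))
    (hpos : ∃ f, 0 < form l (π f) (π f)) (hneg : ∃ g, form l (π g) (π g) < 0) :
    ∃ χ : 𝔞 → ℝ, ∃ p ∈ weightSpace 𝔞 χ, ∃ p' ∈ weightSpace 𝔞 (-χ), π p = p ∧ π p' = p' ∧
      form l p p = 0 ∧ form l p' p' = 0 ∧ form l p p' = 2⁻¹ ∧ wedge p p' ∈ 𝔞 := by
  have hsup := iSup_weightSpace hθ h𝔞.prop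
  have hπw {χ : 𝔞 → ℝ} {v : Ambient l} (hv : v ∈ weightSpace 𝔞 χ) : π v ∈ weightSpace 𝔞 χ := by
    intro H
    rw [hπ𝔞 _ H.2, hv H, map_smul]
  -- Otherwise `𝔞` kills the range of `π`. A boost in a hyperbolic plane of that range then commutes
  -- with `𝔞` and belongs to it, although it does not act by zero.
  obtain ⟨χ, hχ, v, hv, hπv⟩ : ∃ χ : 𝔞 → ℝ, χ ≠ 0 ∧ ∃ v ∈ weightSpace 𝔞 χ, π v ≠ 0 := by
    by_contra! hcon
    have hzero (v : Ambient l) : π v ∈ weightSpace 𝔞 0 := by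
      have hv : v ∈ ⨆ χ, weightSpace 𝔞 χ := hsup ▸ Submodule.mem_top
      induction hv using Submodule.iSup_induction' with
      | mem χ x hx =>
        by_cases hχ : χ = 0
        · exact hχ ▸ hπw hx
        · rw [hcon χ hχ x hx]
          exact zero_mem _
      | zero => rw [map_zero]; exact zero_mem _
      | add x y _ _ hx hy => rw [map_add]; exact add_mem hx hy
    obtain ⟨f, hf⟩ := hpos
    obtain ⟨g, hg⟩ := hneg
    obtain ⟨u, ⟨u', rfl⟩, w, ⟨w', rfl⟩, huu, hww, huw⟩ := exists_hyperbolic_pair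
      (U := LinearMap.range π) ⟨f, rfl⟩ ⟨g, rfl⟩ hf hg
    have hmem : wedge (π u') (π w') ∈ 𝔞 := by
      refine mem_of_commute hθ h𝔞 (fun H hH => ?_) (wedge_cube huu hww huw)
      refine so2_ext fun x => ?_
      rw [lie_wedge, hzero u' ⟨H, hH⟩, hzero w' ⟨H, hH⟩]
      change ((wedge _ _).1 + (wedge _ _).1) *ᵥ x = (0 : Matrix _ _ ℝ) *ᵥ x
      simp [add_mulVec, wedge_mulVec]
    have h1 := hzero u' ⟨_, hmem⟩
    rw [wedge_mulVec, huu, form_comm, huw] at h1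
    have h2 : π u' = 0 := by simpa using h1
    rw [h2, form_zero_left] at huw
    norm_num at huw
  obtain ⟨H, hH⟩ := Function.ne_iff.mp hχ
  have hH' : χ H ≠ 0 := hH
  have hp := hπw hv
  -- Weight vectors span and the form is non-degenerate, so some weight vector pairs with `π v`.
  -- Invariance of the form forces its weight to be `-χ`.
  obtain ⟨ψ, w, hw, hvw⟩ : ∃ ψ : 𝔞 → ℝ, ∃ w ∈ weightSpace 𝔞 ψ, form l (π v) w ≠ 0 := by
    by_contra! hcon
    refine hπv (eq_zero_of_form_eq_zero fun x => ?_)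
    have hx : x ∈ ⨆ χ, weightSpace 𝔞 χ := hsup ▸ Submodule.mem_top
    induction hx using Submodule.iSup_induction' with
    | mem χ x hx => exact hcon χ x hx
    | zero => exact form_zero_right _
    | add x y _ _ hx hy => rw [form_add_right, hx, hy, add_zero]
  have hψ : ψ = -χ := by
    funext K
    by_contra hne
    refine hvw (form_eq_zero_of_weight hp hw (H := K) fun h => hne ?_)
    rw [Pi.neg_apply]
    linarith
  rw [hψ] at hw
  have hp' := hπw hw
  have hpp' : form l (π v) (π w) = form l (π v) w := by rw [← hπ, hππ]
  obtain ⟨r, hr⟩ : ∃ r, r = (2 * form l (π v) w)⁻¹ := ⟨_, rfl⟩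
  have hpr : r • π w ∈ weightSpace 𝔞 (-χ) := Submodule.smul_mem _ _ hp'
  have h1 : form l (π v) (π v) = 0 :=
    form_eq_zero_of_weight hp hp (H := H) (by
      intro h
      apply hH'
      linarith)
  have h2 : form l (r • π w) (r • π w) = 0 :=
    form_eq_zero_of_weight hpr hpr (H := H) (by
      rw [Pi.neg_apply]
      intro h
      apply hH'
      linarith)
  have h3 : form l (π v) (r • π w) = 2⁻¹ := by
    rw [form_smul_right, hpp', hr]
    field_simp
  refine ⟨χ, π v, hp, r • π w, hpr, hππ v, by rw [map_smul, hππ], h1, h2, h3, ?_⟩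
  refine mem_of_commute hθ h𝔞 (fun K hK => so2_ext fun x => ?_) (wedge_cube h1 h2 h3)
  rw [lie_wedge, hp ⟨K, hK⟩, hpr ⟨K, hK⟩]
  change ((wedge _ _).1 + (wedge _ _).1) *ᵥ x = (0 : Matrix _ _ ℝ) *ᵥ x
  simp only [add_mulVec, wedge_mulVec, form_smul_left, zero_mulVec, Pi.neg_apply]
  module

/-! ### Null frames of weight vectors -/

/-- A null frame of weight vectors for `𝔞`, of weights `a`, `-a`, `b`, `-b`, with complement of
weight `0`. -/
structure IsWeightFrame (𝔞 : Submodule ℝ (so2 l)) (a b : Module.Dual ℝ 𝔞)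
    (p p' q q' : Ambient l) : Prop extends IsNullFrame p p' q q' where
  boost_p : wedge p p' ∈ 𝔞
  boost_q : wedge q q' ∈ 𝔞
  mulVec_p : ∀ H : 𝔞, H.1.1 *ᵥ p = a H • p
  mulVec_p' : ∀ H : 𝔞, H.1.1 *ᵥ p' = -a H • p'
  mulVec_q : ∀ H : 𝔞, H.1.1 *ᵥ q = b H • q
  mulVec_q' : ∀ H : 𝔞, H.1.1 *ᵥ q' = -b H • q'
  mulVec_orthogonal : ∀ H : 𝔞, ∀ w, form l p w = 0 → form l p' w = 0 → form l q w = 0 →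
    form l q' w = 0 → H.1.1 *ᵥ w = 0

theorem wedge_swap (v w : Ambient l) : wedge w v = -wedge v w := by
  refine so2_ext fun u => ?_
  change _ = (-(wedge v w).1) *ᵥ u
  rw [neg_mulVec, wedge_mulVec, wedge_mulVec]
  abel

theorem wedge_add_right (u v w : Ambient l) : wedge u (v + w) = wedge u v + wedge u w := by
  refine so2_ext fun x => ?_
  change _ = ((wedge u v).1 + (wedge u w).1) *ᵥ x
  rw [add_mulVec, wedge_mulVec, wedge_mulVec, wedge_mulVec, form_add_left]
  module

theorem wedge_smul_right (r : ℝ) (v w : Ambient l) : wedge v (r • w) = r • wedge v w := by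
  refine so2_ext fun x => ?_
  change _ = (r • (wedge v w).1) *ᵥ x
  rw [smul_mulVec, wedge_mulVec, wedge_mulVec, form_smul_left]
  module

namespace IsWeightFrame

variable {a b : Module.Dual ℝ 𝔞} {p p' q q' : Ambient l}

theorem swap' (F : IsWeightFrame 𝔞 a b p p' q q') : IsWeightFrame 𝔞 b a q q' p p' where
  toIsNullFrame := F.toIsNullFrame.swap
  boost_p := F.boost_q
  boost_q := F.boost_p
  mulVec_p := F.mulVec_q
  mulVec_p' := F.mulVec_q'
  mulVec_q := F.mulVec_p
  mulVec_q' := F.mulVec_p'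
  mulVec_orthogonal H w h1 h2 h3 h4 := F.mulVec_orthogonal H w h3 h4 h1 h2

theorem swap_left' (F : IsWeightFrame 𝔞 a b p p' q q') : IsWeightFrame 𝔞 (-a) b p' p q q' where
  toIsNullFrame := F.toIsNullFrame.swap_left
  boost_p := by rw [wedge_swap]; exact neg_mem F.boost_p
  boost_q := F.boost_q
  mulVec_p := F.mulVec_p'
  mulVec_p' H := by rw [LinearMap.neg_apply, neg_neg]; exact F.mulVec_p H
  mulVec_q := F.mulVec_q
  mulVec_q' := F.mulVec_q'
  mulVec_orthogonal H w h1 h2 h3 h4 := F.mulVec_orthogonal H w h2 h1 h3 h4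

theorem swap_right' (F : IsWeightFrame 𝔞 a b p p' q q') : IsWeightFrame 𝔞 a (-b) p p' q' q :=
  F.swap'.swap_left'.swap'

theorem p_ne_zero (F : IsWeightFrame 𝔞 a b p p' q q') : p ≠ 0 :=
  F.toIsNullFrame.swap.q_ne_zero

/-- Evaluation on the boost of `p, p'` distinguishes `a` from `b`, so that `a`, `a + b` and `a - b`
are non-zero and can be classified by sign. -/
theorem apply_boost_p (F : IsWeightFrame 𝔞 a b p p' q q') :
    a ⟨_, F.boost_p⟩ = 2⁻¹ ∧ b ⟨_, F.boost_p⟩ = 0 := by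
  have h1 := F.mulVec_p ⟨_, F.boost_p⟩
  have h2 := F.mulVec_q ⟨_, F.boost_p⟩
  rw [wedge_mulVec, F.pp, form_comm, F.p_p', zero_smul, sub_zero] at h1
  rw [wedge_mulVec, F.p'_q, F.p_q, zero_smul, zero_smul, sub_zero] at h2
  refine ⟨?_, (smul_eq_zero.mp h2.symm).resolve_right F.toIsNullFrame.q_ne_zero⟩
  rw [← sub_eq_zero, ← sub_smul] at h1
  have := (smul_eq_zero.mp h1).resolve_right F.p_ne_zero
  linarith

theorem left_add_ne_zero (F : IsWeightFrame 𝔞 a b p p' q q') {c : Module.Dual ℝ 𝔞}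
    (hc : c ⟨_, F.boost_p⟩ = 0) : a + c ≠ 0 := by
  intro h
  have h1 := LinearMap.congr_fun h ⟨_, F.boost_p⟩
  rw [LinearMap.add_apply, F.apply_boost_p.1, hc, add_zero, LinearMap.zero_apply] at h1
  norm_num at h1

theorem left_ne_zero (F : IsWeightFrame 𝔞 a b p p' q q') : a ≠ 0 := by
  simpa using F.left_add_ne_zero (LinearMap.zero_apply _)

theorem left_sub_ne_zero (F : IsWeightFrame 𝔞 a b p p' q q') : a - b ≠ 0 := by
  rw [sub_eq_add_neg]
  refine F.left_add_ne_zero ?_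
  rw [LinearMap.neg_apply, F.apply_boost_p.2, neg_zero]

theorem mem_rootSpace {ψ : Module.Dual ℝ 𝔞} {v w : Ambient l}
    (F : IsWeightFrame 𝔞 a b p p' q q') (hw : ∀ H : 𝔞, H.1.1 *ᵥ w = ψ H • w)
    (hv : v = p) : wedge v w ∈ rootSpace 𝔞 (a + ψ) := by
  subst hv
  intro H
  rw [lie_wedge, F.mulVec_p, hw]
  refine so2_ext fun x => ?_
  change ((wedge _ _).1 + (wedge _ _).1) *ᵥ x = ((a H + ψ H) • (wedge _ _).1) *ᵥ x
  simp only [add_mulVec, smul_mulVec, wedge_mulVec, form_smul_left]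
  module

theorem form_p_eq_zero (F : IsWeightFrame 𝔞 a b p p' q q') {ψ : Module.Dual ℝ 𝔞} {v : Ambient l}
    (hv : ∀ H : 𝔞, H.1.1 *ᵥ v = ψ H • v) (h : a + ψ ≠ 0) : form l p v = 0 := by
  by_contra h0
  apply h
  ext H
  have h1 := form_so2 H.1 p v
  rw [F.mulVec_p, hv, form_smul_left, form_smul_right] at h1
  have h2 : (a H + ψ H) * form l p v = 0 := by linarith
  exact (mul_eq_zero.mp h2).resolve_right h0

/-- Here `w` is meant as the component of `v` in the complement of the frame. Since `𝔞` kills `w`,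
invariance gives `ψ(H)⟨w,v⟩ = 0`, while `⟨w,v⟩ = ⟨w,w⟩` is negative unless `w = 0`. -/
theorem eq_zero_of_orthogonal (F : IsWeightFrame 𝔞 a b p p' q q') {ψ : Module.Dual ℝ 𝔞}
    {v w : Ambient l} (hv : ∀ H : 𝔞, H.1.1 *ᵥ v = ψ H • v) (hψ : ψ ≠ 0)
    (h1 : form l p w = 0) (h2 : form l p' w = 0) (h3 : form l q w = 0) (h4 : form l q' w = 0)
    (hwv : form l w v = form l w w) : w = 0 := by
  by_contra h0
  apply hψ
  ext H
  have h5 := form_so2 H.1 w v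
  rw [F.mulVec_orthogonal H w h1 h2 h3 h4, hv, form_zero_left, form_smul_right, hwv] at h5
  exact (mul_eq_zero.mp (neg_eq_zero.mp h5.symm)).resolve_right (F.neg w h1 h2 h3 h4 h0).ne

end IsWeightFrame

/-! ### Iwasawa algebras -/

section Positivity

variable {V : Type*} [AddCommGroup V] [Module ℝ V] {P : Set V}

theorem IsPositivity.ne_zero_of_neg_mem (hP : IsPositivity P) {v : V} (hv : v ∈ P)
    (hnv : -v ∈ P) : v = 0 := by
  by_contra h0
  rcases hP.xor_neg v h0 with h | h
  · exact h.2 hnv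
  · exact h.2 hv

theorem IsPositivity.mem_or_neg_mem (hP : IsPositivity P) {v : V} (hv : v ≠ 0) :
    v ∈ P ∨ -v ∈ P :=
  (hP.xor_neg v hv).or

theorem IsPositivity.neg (hP : IsPositivity P) : IsPositivity {v | -v ∈ P} where
  xor_neg v hv := hP.xor_neg (-v) (neg_ne_zero.mpr hv)
  add v hv w hw := by
    change -(v + w) ∈ P
    rw [neg_add]
    exact hP.add _ hv _ hw
  smul r hr v hv := by
    change -(r • v) ∈ P
    rw [← smul_neg]
    exact hP.smul r hr _ hv

end Positivity

theorem mem_nilpotentPart {P : Set (Module.Dual ℝ 𝔞)} {lam : Module.Dual ℝ 𝔞} (h0 : lam ≠ 0)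
    (hP : lam ∈ P) {X : so2 l} (hX : X ∈ rootSpace 𝔞 lam) : X ∈ nilpotentPart 𝔞 P := by
  by_cases hX0 : X = 0
  · rw [hX0]
    exact zero_mem _
  · exact Submodule.mem_iSup_of_mem lam (Submodule.mem_iSup_of_mem
      ⟨h0, fun h => hX0 ((Submodule.mem_bot ℝ).mp (h ▸ hX)), hP⟩ hX)

theorem mulVec_rootSpace {lam ψ : Module.Dual ℝ 𝔞} {X : so2 l} (hX : X ∈ rootSpace 𝔞 lam)
    {v : Ambient l} (hv : ∀ H : 𝔞, H.1.1 *ᵥ v = ψ H • v) (H : 𝔞) :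
    H.1.1 *ᵥ (X.1 *ᵥ v) = (ψ + lam) H • (X.1 *ᵥ v) := by
  have h1 := lie_mulVec H.1 X v
  have h2 : ⁅H.1, X⁆.1 = lam H • X.1 := congrArg Subtype.val (hX H)
  rw [h2, hv, smul_mulVec, mulVec_smul, eq_sub_iff_add_eq] at h1
  rw [← h1, LinearMap.add_apply]
  module

/-- The positive root vectors annihilate `p` and map `q` to multiples of `p`. -/
theorem IsWeightFrame.nilpotentPart_le {a b : Module.Dual ℝ 𝔞} {p p' q q' : Ambient l}
    (F : IsWeightFrame 𝔞 a b p p' q q') {P : Set (Module.Dual ℝ 𝔞)} (hP : IsPositivity P)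
    (ha : a ∈ P) (hb : b ∈ P) (hab : a - b ∈ P) {X : so2 l} (hX : X ∈ nilpotentPart 𝔞 P) :
    X.1 *ᵥ p = 0 ∧ ∃ c : ℝ, X.1 *ᵥ q = c • p := by
  let S : Submodule ℝ (so2 l) :=
    { carrier := {X | X.1 *ᵥ p = 0 ∧ ∃ c : ℝ, X.1 *ᵥ q = c • p}
      add_mem' := by
        rintro X Y ⟨hX, c, hc⟩ ⟨hY, d, hd⟩
        refine ⟨?_, c + d, ?_⟩
        · change (X.1 + Y.1) *ᵥ p = 0
          rw [add_mulVec, hX, hY, add_zero]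
        · change (X.1 + Y.1) *ᵥ q = _
          rw [add_mulVec, hc, hd, add_smul]
      zero_mem' := ⟨zero_mulVec _, 0, by rw [zero_smul]; exact zero_mulVec _⟩
      smul_mem' := by
        rintro r X ⟨hX, c, hc⟩
        refine ⟨?_, r * c, ?_⟩
        · change (r • X.1) *ᵥ p = 0
          rw [smul_mulVec, hX, smul_zero]
        · change (r • X.1) *ᵥ q = _
          rw [smul_mulVec, hc, smul_smul] }
  suffices h : nilpotentPart 𝔞 P ≤ S from h hX
  refine iSup₂_le ?_
  rintro lam ⟨h0, -, hlam⟩ X hX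
  have hneg (μ : Module.Dual ℝ 𝔞) (hμ : μ ∈ P) : μ + lam ≠ 0 := by
    intro h
    refine h0 (hP.ne_zero_of_neg_mem hlam ?_)
    rwa [← eq_neg_of_add_eq_zero_left h]
  have haa := hP.add _ ha _ ha
  have hbb := hP.add _ hb _ hb
  have hapb := hP.add _ ha _ hb
  have hp := mulVec_rootSpace hX F.mulVec_p
  have hq := mulVec_rootSpace hX F.mulVec_q
  constructor
  -- `X p` has weight `a + λ`. Pairing non-trivially with `p, p', q, q'` would require `2a + λ`,
  -- `λ`, `a + b + λ` or `a - b + λ` to vanish, but all four are non-zero, three as sums of positive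
  -- elements and `λ` as a root.
  · refine F.eq_zero_of_orthogonal hp (hneg a ha) (F.form_p_eq_zero hp ?_)
      (F.swap_left'.form_p_eq_zero hp ?_) (F.swap'.form_p_eq_zero hp ?_)
      (F.swap'.swap_left'.form_p_eq_zero hp ?_) rfl
    · rw [← add_assoc]
      exact hneg _ haa
    · rwa [neg_add_cancel_left]
    · rw [← add_assoc, add_comm b a]
      exact hneg _ hapb
    · rw [← add_assoc, neg_add_eq_sub]
      exact hneg _ hab
  · have h1 : form l p (X.1 *ᵥ q) = 0 := F.form_p_eq_zero hq (by
      rw [← add_assoc]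
      exact hneg _ hapb)
    have h2 : form l q (X.1 *ᵥ q) = 0 := F.swap'.form_p_eq_zero hq (by
      rw [← add_assoc]
      exact hneg _ hbb)
    have h3 : form l q' (X.1 *ᵥ q) = 0 := F.swap'.swap_left'.form_p_eq_zero hq (by
      rwa [neg_add_cancel_left])
    -- Pairing `X q` with `p'` is the only case not excluded, as `λ = a - b` is positive. It yields
    -- the coefficient of `p`, with the `2` compensating `⟨p,p'⟩ = 1/2`.
    refine ⟨2 * form l p' (X.1 *ᵥ q), sub_eq_zero.mp ?_⟩
    refine F.eq_zero_of_orthogonal hq (hneg b hb) ?_ ?_ ?_ ?_ ?_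
    · rw [form_sub_right, form_smul_right, h1, F.pp]
      ring
    · rw [form_sub_right, form_smul_right, form_comm p' p, F.p_p']
      ring
    · rw [form_sub_right, form_smul_right, h2, form_comm q p, F.p_q]
      ring
    · rw [form_sub_right, form_smul_right, h3, form_comm q' p, F.p_q']
      ring
    · simp only [form_sub_left, form_sub_right, form_smul_left, form_smul_right, F.pp,
        form_comm _ p, h1]
      ring

theorem IsWeightFrame.isIwasawaAlgebra {a b : Module.Dual ℝ 𝔞} {p p' q q' : Ambient l}
    (F : IsWeightFrame 𝔞 a b p p' q q') {P : Set (Module.Dual ℝ 𝔞)} (hP : IsPositivity P)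
    (ha : a ∈ P) (hb : b ∈ P) (hab : a - b ∈ P) :
    IsIwasawaAlgebra p p' q q' (𝔞 ⊔ nilpotentPart 𝔞 P) := by
  have hzero (w : Ambient l) (h1 : form l p w = 0) (h2 : form l p' w = 0) (h3 : form l q w = 0)
      (h4 : form l q' w = 0) (H : 𝔞) : H.1.1 *ᵥ w = (0 : Module.Dual ℝ 𝔞) H • w := by
    rw [F.mulVec_orthogonal H w h1 h2 h3 h4, LinearMap.zero_apply, zero_smul]
  refine ⟨Submodule.mem_sup_left F.boost_p, Submodule.mem_sup_left F.boost_q, ?_, ?_, ?_, ?_⟩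
  · intro w h1 h2
    -- Splitting `w` along the complement, `q` and `q'` splits `p ∧ w` into root vectors for `a`, `a
    -- + b` and `a - b`, all positive.
    obtain ⟨v, hv⟩ : ∃ v, v = w - (2 * form l q' w) • q - (2 * form l q w) • q' := ⟨_, rfl⟩
    have hw : w = v + ((2 * form l q' w) • q + (2 * form l q w) • q') := by rw [hv]; abel
    have hv0 := hzero v
      (by simp [hv, form_sub_right, form_smul_right, h1, F.p_q, F.p_q'])
      (by simp [hv, form_sub_right, form_smul_right, h2, F.p'_q, F.p'_q'])
      (by simp only [hv, form_sub_right, form_smul_right, F.qq, F.q_q']; ring)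
      (by simp only [hv, form_sub_right, form_smul_right, F.qq', form_comm q' q, F.q_q']; ring)
    refine Submodule.mem_sup_right ?_
    rw [hw, wedge_add_right, wedge_add_right, wedge_smul_right, wedge_smul_right]
    refine add_mem ?_ (add_mem (Submodule.smul_mem _ _ ?_) (Submodule.smul_mem _ _ ?_))
    · refine mem_nilpotentPart (lam := a + 0) ?_ ?_ (F.mem_rootSpace hv0 rfl)
      · rw [add_zero]; exact F.left_ne_zero
      · rwa [add_zero]
    · exact mem_nilpotentPart (F.left_add_ne_zero F.apply_boost_p.2) (hP.add _ ha _ hb)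
        (F.mem_rootSpace F.mulVec_q rfl)
    · refine mem_nilpotentPart F.left_sub_ne_zero hab ?_
      rw [sub_eq_add_neg]
      exact F.mem_rootSpace F.mulVec_q' rfl
  · intro w h1 h2 h3 h4
    refine Submodule.mem_sup_right ?_
    refine mem_nilpotentPart (lam := b + 0) ?_ ?_
      (F.swap'.mem_rootSpace (hzero w h1 h2 h3 h4) rfl)
    · rw [add_zero]; exact F.swap'.left_ne_zero
    · rwa [add_zero]
  · intro X hX
    obtain ⟨H, hH, Z, hZ, rfl⟩ := Submodule.mem_sup.mp hX
    refine ⟨a ⟨H, hH⟩, ?_⟩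
    change (H.1 + Z.1) *ᵥ p = _
    rw [add_mulVec, F.mulVec_p ⟨H, hH⟩, (F.nilpotentPart_le hP ha hb hab hZ).1, add_zero]
  · intro X hX
    obtain ⟨H, hH, Z, hZ, rfl⟩ := Submodule.mem_sup.mp hX
    obtain ⟨c, hc⟩ := (F.nilpotentPart_le hP ha hb hab hZ).2
    refine ⟨b ⟨H, hH⟩, c, ?_⟩
    change (H.1 + Z.1) *ᵥ q = _
    rw [add_mulVec, F.mulVec_q ⟨H, hH⟩, hc]

/-- As `θ` is `-1` on `𝔞`, it carries the root space of `λ` to that of `-λ`. -/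
theorem map_nilpotentPart_le (h𝔞 : IsAbelianIn θ 𝔞)
    (P : Set (Module.Dual ℝ 𝔞)) :
    (nilpotentPart 𝔞 P).map (θ : so2 l →ₗ[ℝ] so2 l) ≤ nilpotentPart 𝔞 {v | -v ∈ P} := by
  rw [Submodule.map_le_iff_le_comap]
  refine iSup₂_le ?_
  rintro lam ⟨h0, -, hlam⟩ X hX
  change θ X ∈ nilpotentPart 𝔞 {v | -v ∈ P}
  refine mem_nilpotentPart (lam := -lam) (neg_ne_zero.mpr h0) (by simpa using hlam) ?_
  intro H
  have h1 := congrArg θ (hX H)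
  rw [LieEquiv.map_lie, h𝔞.le _ H.2, map_smul, neg_lie] at h1
  rw [LinearMap.neg_apply, neg_smul, ← h1, neg_neg]

theorem map_nilpotentPart (hθ : IsCartanInvolution θ) (h𝔞 : IsAbelianIn θ 𝔞)
    (P : Set (Module.Dual ℝ 𝔞)) :
    (nilpotentPart 𝔞 P).map (θ : so2 l →ₗ[ℝ] so2 l) = nilpotentPart 𝔞 {v | -v ∈ P} := by
  refine le_antisymm (map_nilpotentPart_le h𝔞 P) fun X hX => ?_
  have h1 := map_nilpotentPart_le h𝔞 {v | -v ∈ P} (Submodule.mem_map_of_mem hX)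
  have h2 : {v : Module.Dual ℝ 𝔞 | -v ∈ {v | -v ∈ P}} = P := by
    ext v
    simp
  rw [h2] at h1
  exact ⟨θ X, h1, hθ.involutive X⟩

/-! ### Existence of a weight frame -/

theorem exists_combination_eq_zero (x y : ℝ) : ∃ s t : ℝ, s * x + t * y = 0 ∧ 0 < s * s + t * t := by
  by_cases hx : x = 0
  · exact ⟨1, 0, by rw [hx]; ring, by norm_num⟩
  · exact ⟨-y, x, by ring, by nlinarith [mul_self_pos.mpr hx, mul_self_nonneg y]⟩

/-- The projection onto the orthogonal complement of a hyperbolic pair. -/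
noncomputable def hypProj (p p' : Ambient l) : Ambient l →ₗ[ℝ] Ambient l :=
  LinearMap.id - (2 : ℝ) • ((formLeft p').smulRight p) - (2 : ℝ) • ((formLeft p).smulRight p')

theorem hypProj_apply (p p' v : Ambient l) :
    hypProj p p' v = v - (2 * form l p' v) • p - (2 * form l p v) • p' := by
  rw [mul_smul, mul_smul]
  rfl

/-- A positive and a negative vector of `ℝ^{2, l-1}` orthogonal to `v` and `w`, respectively. -/
theorem exists_pos_neg (hl : 3 ≤ l) (v w : Ambient l) :
    (∃ f, 0 < form l f f ∧ form l v f = 0) ∧ ∃ g, form l g g < 0 ∧ form l w g = 0 := by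
  constructor
  · obtain ⟨s, t, hst, hpos⟩ := exists_combination_eq_zero (v (Sum.inl 0)) (v (Sum.inl 1))
    refine ⟨s • Pi.single (Sum.inl 0) 1 + t • Pi.single (Sum.inl 1) 1, ?_, ?_⟩
    · simpa [form_apply] using hpos
    · simp [form_apply]
      linarith
  -- `l ≥ 3` provides two negative axes, one more than the single orthogonality condition.
  · obtain ⟨i, j, hij⟩ : ∃ i j : Fin (l - 1), i ≠ j :=
      ⟨⟨0, by omega⟩, ⟨1, by omega⟩, by simp⟩
    obtain ⟨s, t, hst, hpos⟩ := exists_combination_eq_zero (w (Sum.inr i)) (w (Sum.inr j))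
    refine ⟨s • Pi.single (Sum.inr i) 1 + t • Pi.single (Sum.inr j) 1, ?_, ?_⟩
    · have h1 (a b : Fin (l - 1)) : form l (Pi.single (Sum.inr a) 1) (Pi.single (Sum.inr b) (1 : ℝ))
          = if a = b then -1 else 0 := by
        rw [form_apply]
        by_cases hab : a = b
        · simp [Pi.single_apply, hab]
        · simp [Pi.single_apply, hab, Ne.symm hab]
      simp only [form_add_left, form_add_right, form_smul_left, form_smul_right, h1, if_neg hij,
        if_neg hij.symm]
      simp only [if_true]
      linarith
    · have h1 (a : Fin (l - 1)) : form l w (Pi.single (Sum.inr a) 1) = -w (Sum.inr a) := by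
        rw [form_apply]
        simp [Pi.single_apply]
      rw [form_add_right, form_smul_right, form_smul_right, h1, h1]
      linarith

/-- Otherwise `e, f, w` would span a three-dimensional positive semidefinite subspace. -/
theorem form_neg_of_orthogonal_frame {e f w : Ambient l} (he : form l e e = 1)
    (hf : form l f f = 1) (hef : form l e f = 0) (hew : form l e w = 0) (hfw : form l f w = 0)
    (hw : w ≠ 0) : form l w w < 0 := by
  by_contra! h
  have hfe : form l f e = 0 := by rw [form_comm, hef]
  have hwe : form l w e = 0 := by rw [form_comm, hew]
  have hwf : form l w f = 0 := by rw [form_comm, hfw]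
  have hli : LinearIndependent ℝ ![e, f, w] := by
    refine Fintype.linearIndependent_iff.mpr fun r hr => ?_
    simp only [Fin.sum_univ_three, Matrix.cons_val_zero, Matrix.cons_val_one,
      Matrix.cons_val] at hr
    have h0 := congrArg (form l e) hr
    have h1 := congrArg (form l f) hr
    simp only [form_add_right, form_smul_right, he, hf, hef, hew, hfw, hfe, form_zero_right] at h0 h1
    have h0' : r 0 = 0 := by linarith
    have h1' : r 1 = 0 := by linarith
    rw [h0', h1', zero_smul, zero_smul, zero_add, zero_add] at hr
    have h2' := (smul_eq_zero.mp hr).resolve_right hw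
    intro i
    fin_cases i
    · exact h0'
    · exact h1'
    · exact h2'
  obtain ⟨r, hr⟩ := exists_form_self_neg hli
  simp only [Fin.sum_univ_three, Matrix.cons_val_zero, Matrix.cons_val_one, Matrix.cons_val,
    form_add_left, form_add_right, form_smul_left, form_smul_right, he, hf, hef, hew, hfw, hfe,
    hwe, hwf] at hr
  nlinarith [mul_self_nonneg (r 0), mul_self_nonneg (r 1), mul_nonneg (mul_self_nonneg (r 2)) h]

theorem exists_weightFrame (hl : 3 ≤ l) (hθ : IsCartanInvolution θ)
    (h𝔞 : IsMaximalAbelianIn θ 𝔞) :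
    ∃ (a b : Module.Dual ℝ 𝔞) (p p' q q' : Ambient l), IsWeightFrame 𝔞 a b p p' q q' := by
  obtain ⟨χ, p, hp, p', hp', -, -, hpp, hpp', hp_p', hpmem⟩ := exists_weight_pair hθ h𝔞
    LinearMap.id (fun _ _ => rfl) (fun _ => rfl) (fun _ _ _ => rfl)
    (by obtain ⟨⟨f, hf, -⟩, -⟩ := exists_pos_neg hl 0 0; exact ⟨f, hf⟩)
    (by obtain ⟨-, g, hg, -⟩ := exists_pos_neg hl 0 0; exact ⟨g, hg⟩)
  have hp'_p : form l p' p = 2⁻¹ := by rw [form_comm, hp_p']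
  have hsa {u u' : Ambient l} {ψ : 𝔞 → ℝ} (hu : u ∈ weightSpace 𝔞 ψ)
      (hu' : u' ∈ weightSpace 𝔞 (-ψ)) (H : 𝔞) (v : Ambient l) :
      H.1.1 *ᵥ hypProj u u' v = hypProj u u' (H.1.1 *ᵥ v) := by
    have h1 (x : Ambient l) : form l x (H.1.1 *ᵥ v) = -form l (H.1.1 *ᵥ x) v := by
      rw [form_so2, neg_neg]
    rw [hypProj_apply, hypProj_apply, mulVec_sub, mulVec_sub, mulVec_smul, mulVec_smul, h1, h1,
      hu H, hu' H, form_smul_left, form_smul_left, Pi.neg_apply]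
    module
  have hpproj : form l p (hypProj p p' p') = 0 := by
    rw [hypProj_apply]
    simp only [form_sub_right, form_smul_right, hpp, hp_p', hpp']
    ring
  have hproj (u : Ambient l) (v : Ambient l) :
      form l (hypProj p p' u) (hypProj p p' v) = form l u v - 2 * form l p u * form l p' v
        - 2 * form l p' u * form l p v := by
    rw [hypProj_apply, hypProj_apply]
    simp only [form_sub_left, form_sub_right, form_smul_left, form_smul_right, hpp, hpp', hp_p',
      form_comm _ p, form_comm u p']
    ring
  obtain ⟨ψ, q, hq, q', hq', hqπ, hqπ', hqq, hqq', hq_q', hqmem⟩ := exists_weight_pair hθ h𝔞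
    (hypProj p p') (fun v w => by
      simp only [hypProj_apply, form_sub_left, form_sub_right, form_smul_left, form_smul_right,
        form_comm v p, form_comm v p']
      ring) (fun v => by
      simp only [hypProj_apply, form_sub_right, form_smul_right, hpp, hpp', hp_p', hp'_p]
      module) (fun H hH v => hsa hp hp' ⟨H, hH⟩ v)
    -- Choosing `f` orthogonal to `p + p'` gives `⟨p',f⟩ = -⟨p,f⟩`, so projecting adds `4⟨p,f⟩²` to
    -- the norm. Choosing `g` orthogonal to `p - p'` subtracts `4⟨p,g⟩²`. Both signs survive the
    -- projection.
    (by
      obtain ⟨⟨f, hf, hf0⟩, -⟩ := exists_pos_neg hl (p + p') 0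
      refine ⟨f, ?_⟩
      rw [form_add_left] at hf0
      rw [hproj, eq_neg_of_add_eq_zero_right hf0]
      nlinarith [mul_self_nonneg (form l p f)])
    (by
      obtain ⟨-, g, hg, hg0⟩ := exists_pos_neg hl 0 (p - p')
      refine ⟨g, ?_⟩
      rw [form_sub_left] at hg0
      rw [hproj, ← sub_eq_zero.mp hg0]
      nlinarith [mul_self_nonneg (form l p g)])
  have horth {v : Ambient l} (hv : hypProj p p' v = v) : form l p v = 0 ∧ form l p' v = 0 := by
    rw [← hv, hypProj_apply]
    simp only [form_sub_right, form_smul_right, hpp, hpp', hp_p', hp'_p]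
    constructor <;> ring
  obtain ⟨hpq, hp'q⟩ := horth hqπ
  obtain ⟨hpq', hp'q'⟩ := horth hqπ'
  have hneg (w : Ambient l) (h1 : form l p w = 0) (h2 : form l p' w = 0) (h3 : form l q w = 0)
      (h4 : form l q' w = 0) (hw : w ≠ 0) : form l w w < 0 := by
    refine form_neg_of_orthogonal_frame (e := p + p') (f := q + q') ?_ ?_ ?_ ?_ ?_ hw
    · simp only [form_add_left, form_add_right, hpp, hpp', hp_p', hp'_p]
      norm_num
    · simp only [form_add_left, form_add_right, hqq, hqq', hq_q', form_comm q' q]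
      norm_num
    · simp only [form_add_left, form_add_right, hpq, hpq', hp'q, hp'q']
      norm_num
    · rw [form_add_left, h1, h2, add_zero]
    · rw [form_add_left, h3, h4, add_zero]
  have F : IsNullFrame p p' q q' :=
    ⟨hpp, hpp', hqq, hqq', hp_p', hq_q', hpq, hpq', hp'q, hp'q', hneg⟩
  -- The projections commute with `𝔞`. A vector of non-zero weight is null, and the complement is
  -- definite, so only weight zero can occur there.
  have hzero (v : Ambient l) : hypProj q q' (hypProj p p' v) ∈ weightSpace 𝔞 0 := by
    have hv : v ∈ ⨆ χ, weightSpace 𝔞 χ := iSup_weightSpace hθ h𝔞.prop ▸ Submodule.mem_top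
    induction hv using Submodule.iSup_induction' with
    | mem φ x hx =>
      obtain ⟨y, hy⟩ : ∃ y, y = hypProj q q' (hypProj p p' x) := ⟨_, rfl⟩
      rw [← hy]
      have hyφ : y ∈ weightSpace 𝔞 φ := by
        intro H
        rw [hy, hsa hq hq', hsa hp hp', hx H, map_smul, map_smul]
      by_cases hφ : φ = 0
      · exact hφ ▸ hyφ
      · obtain ⟨H, hH⟩ := Function.ne_iff.mp hφ
        have hyy : form l y y = 0 := form_eq_zero_of_weight hyφ hyφ (H := H) (by
          intro h
          apply hH
          rw [Pi.zero_apply]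
          linarith)
        have hy0 : y = 0 := by
          by_contra hy0
          refine (hneg y ?_ ?_ ?_ ?_ hy0).ne hyy
          all_goals
            simp only [hy, hypProj_apply, form_sub_right, form_smul_right, hpp, hpp', hp_p', hp'_p,
              hpq, hpq', hp'q, hp'q', hqq, hqq', hq_q', form_comm q' q, form_comm q p,
              form_comm q p', form_comm q' p, form_comm q' p']
            ring
        rw [hy0]
        exact zero_mem _
    | zero => rw [map_zero, map_zero]; exact zero_mem _
    | add x y _ _ hx hy => rw [map_add, map_add]; exact add_mem hx hy
  -- Weights were arbitrary functions so far; pairing with a dual vector shows that those of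
  -- non-zero vectors are linear.
  have hlin {u u' : Ambient l} {φ : 𝔞 → ℝ} (hu : u ∈ weightSpace 𝔞 φ)
      (huu' : form l u' u = 2⁻¹) : ∃ a : Module.Dual ℝ 𝔞, ∀ H, φ H = a H := by
    refine ⟨{ toFun := φ, map_add' := fun H K => ?_, map_smul' := fun r H => ?_ }, fun H => rfl⟩
    · have h1 := congrArg (form l u') (hu (H + K))
      have h2 : (H + K).1.1 *ᵥ u = φ H • u + φ K • u := by
        rw [← hu H, ← hu K, ← add_mulVec]
        rfl
      rw [h2] at h1
      simp only [form_add_right, form_smul_right, huu'] at h1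
      linarith
    · have h1 := congrArg (form l u') (hu (r • H))
      have h2 : (r • H).1.1 *ᵥ u = r • φ H • u := by
        rw [← hu H, ← smul_mulVec]
        rfl
      rw [h2] at h1
      simp only [form_smul_right, huu'] at h1
      change _ = r * φ H
      linarith
  obtain ⟨a, ha⟩ := hlin hp hp'_p
  obtain ⟨b, hb⟩ := hlin hq (u' := q') (by rw [form_comm, hq_q'])
  refine ⟨a, b, p, p', q, q', F, hpmem, hqmem, fun H => ?_, fun H => ?_, fun H => ?_, fun H => ?_,
    fun H w h1 h2 h3 h4 => ?_⟩
  · rw [hp H, ha]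
  · rw [hp' H, Pi.neg_apply, ha]
  · rw [hq H, hb]
  · rw [hq' H, Pi.neg_apply, hb]
  · have h5 := hzero w H
    have h6 : hypProj q q' (hypProj p p' w) = w := by
      have h7 : hypProj p p' w = w := by
        rw [hypProj_apply, h1, h2]
        module
      rw [h7, hypProj_apply, h3, h4]
      module
    rwa [h6, Pi.zero_apply, zero_smul] at h5

/-- Exchanging `p` with `p'`, `q` with `q'`, or the two pairs realises all signed permutations of
`a, b`, enough to reach the positive chamber. -/
theorem exists_positive_weightFrame (hl : 3 ≤ l) (hθ : IsCartanInvolution θ)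
    (h𝔞 : IsMaximalAbelianIn θ 𝔞) {P : Set (Module.Dual ℝ 𝔞)} (hP : IsPositivity P) :
    ∃ (a b : Module.Dual ℝ 𝔞) (p p' q q' : Ambient l), IsWeightFrame 𝔞 a b p p' q q' ∧
      a ∈ P ∧ b ∈ P ∧ a - b ∈ P := by
  obtain ⟨a, b, p, p', q, q', F⟩ := exists_weightFrame hl hθ h𝔞
  wlog ha : a ∈ P generalizing a p p'
  · exact this _ _ _ F.swap_left' ((hP.mem_or_neg_mem F.left_ne_zero).resolve_left ha)
  wlog hb : b ∈ P generalizing b q q'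
  · exact this _ _ _ F.swap_right' ((hP.mem_or_neg_mem F.swap'.left_ne_zero).resolve_left hb)
  rcases hP.mem_or_neg_mem F.left_sub_ne_zero with h | h
  · exact ⟨a, b, p, p', q, q', F, ha, hb, h⟩
  · exact ⟨b, a, q, q', p, p', F.swap', hb, ha, by rwa [neg_sub] at h⟩

/-- A null frame adapted to the two Iwasawa groups `A N` and `A N̄`. -/
theorem exists_isIwasawaAlgebra (hl : 3 ≤ l) (hθ : IsCartanInvolution θ)
    (h𝔞 : IsMaximalAbelianIn θ 𝔞) {P : Set (Module.Dual ℝ 𝔞)} (hP : IsPositivity P) :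
    ∃ p p' q q' : Ambient l, IsNullFrame p p' q q' ∧
      IsIwasawaAlgebra p p' q q' (𝔞 ⊔ nilpotentPart 𝔞 P) ∧
      IsIwasawaAlgebra p' p q' q
        (𝔞 ⊔ (nilpotentPart 𝔞 P).map (θ : so2 l →ₗ[ℝ] so2 l)) := by
  obtain ⟨a, b, p, p', q, q', F, ha, hb, hab⟩ := exists_positive_weightFrame hl hθ h𝔞 hP
  refine ⟨p, p', q, q', F.toIsNullFrame, F.isIwasawaAlgebra hP ha hb hab, ?_⟩
  rw [map_nilpotentPart hθ h𝔞.prop]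
  -- For the opposite positivity the positive weights are `-a, -b`, carried by `p', q'`.
  refine F.swap_left'.swap_right'.isIwasawaAlgebra hP.neg ?_ ?_ ?_
  · simpa using ha
  · simpa using hb
  · change -(-a - -b) ∈ P
    rwa [neg_sub_neg, neg_sub]

end

end AntiDeSitter

open AntiDeSitter in
theorem mainTheorem1 (l : ℕ) (hl : 3 ≤ l)
    (θ : so2 l ≃ₗ⁅ℝ⁆ so2 l) (hθ : IsCartanInvolution θ)
    (hσθ : ∀ X, θ (sigma l X) = sigma l (θ X))
    (𝔞 : Submodule ℝ (so2 l)) (h𝔞 : IsMaximalAbelianIn θ 𝔞)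
    (hσ𝔞 : ∀ X ∈ 𝔞, sigma l X ∈ 𝔞)
    (P : Set (Module.Dual ℝ 𝔞)) (hP : IsPositivity P) :
    IsCausalSymmetricSpace l ∧
    (horizon (singularity θ 𝔞 P)).Nonempty ∧
    singularity θ 𝔞 P ⊂ blackHole (singularity θ 𝔞 P) ∧
    blackHole (singularity θ 𝔞 P) ⊂ Set.univ ∧
    (closedOrbits (iwasawaGroup 𝔞 P) ∪ closedOrbits (iwasawaGroupBar θ 𝔞 P)).Finite ∧
    HasFourOrbits (iwasawaGroup 𝔞 P) ∧
    HasFourOrbits (iwasawaGroupBar θ 𝔞 P) := by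
  obtain ⟨p, p', q, q', F, I, J⟩ := exists_isIwasawaAlgebra hl hθ h𝔞 hP
  have hS : singularity θ 𝔞 P = wall p p' :=
    congrArg₂ (· ∪ ·) (I.sUnion_closedOrbits F) (J.sUnion_closedOrbits F.symm)
  rw [hS]
  exact ⟨isCausalSymmetricSpace (by omega), F.horizon_nonempty, F.wall_ssubset_blackHole,
    F.blackHole_ssubset_univ, (I.finite_closedOrbits F).union (J.finite_closedOrbits F.symm),
    I.hasFourOrbits F, J.hasFourOrbits F.symm⟩
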